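/- All graphs are finite and simple. A graph $G$ is \emph{odd} if $|V(G)|$ is odd, \emph{equimatchable} if all its inclusion-maximal matchings have the same number of edges, and \emph{claw-free} if it has no induced subgraph isomorphic to $K_{1,3}$. Let $\alpha(G)$ be the independence number and $\kappa(G)$ the vertex connectivity of $G$ (the minimum size of a set of vertices whose removal leaves a disconnected graph or at most one vertex). For $U\subseteq V(G)$ let $N_U(v)$ be the set of neighbours of $v$ in $U$. An \emph{independent 2-cut} is an inclusion-minimal cut set $S=\{s_1,s_2\}$ consisting of two distinct non-adjacent vertices; when $G\setminus S$ has exactly two connected components, one of even and one of odd order, these are denoted by $A_S$ and $B_S$, respectively. Define three families of graphs: $G\in\mathcal G_{21}$ if $V(G)$ can be partitioned into $V_1$ and $V_2$ such that $V_1$ induces a $K_{2q+1}$ for some $q\ge 1$; $V_2$ induces a 4-cycle $v_1v_2v_3v_4$; $N_{V_1}(v_1)=N_{V_1}(v_2)$; $2\le |N_{V_1}(v_1)|<|V_1|$; and $N_{V_1}(v_3)=N_{V_1}(v_4)=\emptyset$. $G\in\mathcal G_{22}$ if $G$ has an independent 2-cut $S=\{s_1,s_2\}$ such that $G\setminus S$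 has exactly two components, an even one $A_S$ and an odd one $B_S$, with: $A_S$ is a $K_{2p}$ for some $p\ge 1$; $B_S$ is a $K_{2q+1}$ for some $q\ge 0$; $s_1$ and $s_2$ are adjacent to all vertices of $B_S$; $N_{A_S}(s_1)\cup N_{A_S}(s_2)\subsetneq A_S$; and $N_{A_S}(s_1)\cap N_{A_S}(s_2)=\emptyset$. $G\in\mathcal G_{23}$ if $G$ has an independent 2-cut $S=\{s_1,s_2\}$ such that $G\setminus S$ has exactly two components, an even one $A_S$ and an odd one $B_S$, with: $A_S$ is a $K_2$; $G[S\cup A_S]$ is a path $P_4$ on four vertices; $B_S$ is a $K_{2q+1}$ for some $q\ge 1$; $N_{B_S}(s_1)\cup N_{B_S}(s_2)=B_S$; and neither $s_1$ nor $s_2$ is adjacent to all vertices of $B_S$. \textbf{Proposition.} If $G$ is an equimatchable claw-free odd graph with $\alpha(G)\ge 3$ and $\kappa(G)=2$, then $G\in\mathcal G_{21}\cup\mathcal G_{22}\cup\mathcal G_{23}$ or $G$ is isomorphic to the 7-cycle $C_7$. -/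

import Mathlib

namespace EquimatchableClawFree

variable {V : Type*}

/-- `G` is equimatchable: any two inclusion-maximal matchings have the same number of edges. -/
def IsEquimatchable (G : SimpleGraph V) : Prop :=
  ∀ M N : G.Subgraph, Maximal (fun H : G.Subgraph => H.IsMatching) M →
    Maximal (fun H : G.Subgraph => H.IsMatching) N → M.edgeSet.ncard = N.edgeSet.ncard

/-- `G` is claw-free: `K_{1,3}` is not an induced subgraph of `G`. -/
def IsClawFree (G : SimpleGraph V) : Prop :=
  ¬ (completeBipartiteGraph (Fin 1) (Fin 3)).IsIndContained G

/-- `S` is a cut set of `G`: the graph `G \ S` has two vertices in different components. -/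
def IsCutSet (G : SimpleGraph V) (S : Set V) : Prop :=
  ¬ (G.induce Sᶜ).Preconnected

/-- `S` is an inclusion-minimal cut set of `G`. -/
def IsMinimalCutSet (G : SimpleGraph V) (S : Set V) : Prop :=
  Minimal (IsCutSet G) S

/-- The vertex connectivity `κ(G)` of a finite graph: the least size of a vertex set whose removal
leaves a disconnected graph or at most one vertex. For a graph that is not complete this is the
size of a smallest cut set; for `K_n` with `1 ≤ n` it is `n - 1`. -/
noncomputable def vertexConnectivity (G : SimpleGraph V) : ℕ :=
  sInf {k | ∃ S : Set V, S.ncard = k ∧ (IsCutSet G S ∨ Sᶜ.Subsingleton)}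

/-- `N_U(v)`, the set of neighbours of `v` in `U`. -/
def nbrIn (G : SimpleGraph V) (U : Set V) (v : V) : Set V :=
  G.neighborSet v ∩ U

/-- `U` is the vertex set of a clique on `n` vertices, that is, `G[U]` is a `K_n`. -/
def InducesComplete (G : SimpleGraph V) (U : Set V) (n : ℕ) : Prop :=
  G.IsClique U ∧ U.ncard = n

/-- `{s₁, s₂}` is an independent 2-cut of `G` (a minimal cut set consisting of two distinct
non-adjacent vertices), and `G \ {s₁, s₂}` has exactly two components, an even one with vertex
set `A` and an odd one with vertex set `B`. -/
structure IsIndepTwoCut (G : SimpleGraph V) (s₁ s₂ : V) (A B : Set V) : Prop where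
  ne : s₁ ≠ s₂
  not_adj : ¬ G.Adj s₁ s₂
  minimal_cut : IsMinimalCutSet G {s₁, s₂}
  disj : Disjoint A B
  union_eq : A ∪ B = {s₁, s₂}ᶜ
  connected_left : (G.induce A).Connected
  connected_right : (G.induce B).Connected
  no_edge : ∀ a ∈ A, ∀ b ∈ B, ¬ G.Adj a b
  even_left : Even A.ncard
  odd_right : Odd B.ncard

/-- The family `𝒢₂₁`. The 4-cycle `v₁v₂v₃v₄` induced by `V₂` is `e 0, e 1, e 2, e 3`. -/
def MemG21 (G : SimpleGraph V) : Prop :=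
  ∃ V₁ V₂ : Set V, Disjoint V₁ V₂ ∧ V₁ ∪ V₂ = Set.univ ∧
    (∃ q : ℕ, 1 ≤ q ∧ InducesComplete G V₁ (2 * q + 1)) ∧
    ∃ e : SimpleGraph.cycleGraph 4 ↪g G, Set.range e = V₂ ∧
      nbrIn G V₁ (e 0) = nbrIn G V₁ (e 1) ∧
      2 ≤ (nbrIn G V₁ (e 0)).ncard ∧ (nbrIn G V₁ (e 0)).ncard < V₁.ncard ∧
      nbrIn G V₁ (e 2) = ∅ ∧ nbrIn G V₁ (e 3) = ∅

/-- The family `𝒢₂₂`. -/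
def MemG22 (G : SimpleGraph V) : Prop :=
  ∃ (s₁ s₂ : V) (A B : Set V), IsIndepTwoCut G s₁ s₂ A B ∧
    (∃ p : ℕ, 1 ≤ p ∧ InducesComplete G A (2 * p)) ∧
    (∃ q : ℕ, InducesComplete G B (2 * q + 1)) ∧
    nbrIn G B s₁ = B ∧ nbrIn G B s₂ = B ∧
    nbrIn G A s₁ ∪ nbrIn G A s₂ ⊂ A ∧
    nbrIn G A s₁ ∩ nbrIn G A s₂ = ∅

/-- The family `𝒢₂₃`. The last two conditions say that each of the sets
`N_B(s₁) \ N_B(s₂)` and `N_B(s₂) \ N_B(s₁)` is non-empty. -/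
def MemG23 (G : SimpleGraph V) : Prop :=
  ∃ (s₁ s₂ : V) (A B : Set V), IsIndepTwoCut G s₁ s₂ A B ∧
    InducesComplete G A 2 ∧
    Nonempty (G.induce ({s₁, s₂} ∪ A) ≃g SimpleGraph.pathGraph 4) ∧
    (∃ q : ℕ, 1 ≤ q ∧ InducesComplete G B (2 * q + 1)) ∧
    nbrIn G B s₁ ∪ nbrIn G B s₂ = B ∧
    nbrIn G B s₁ ≠ B ∧ nbrIn G B s₂ ≠ B

end EquimatchableClawFree

/-!
The proof works with vertex sets `K` spanned by a matching (`PM G K`). By Sumner's theorem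
(`ConnOn.pm`) a connected claw-free graph of even order has a perfect matching; deleting a vertex
that is not a cut vertex, one sees that a connected claw-free graph of odd order has a matching
missing just one vertex. Equimatchability therefore says that a matching whose uncovered vertices
are independent never misses more than one vertex (`IsEquimatchable.eq_of_notMem`), and the
argument consists in producing matchings that contradict this, most often by missing exactly three
independent vertices (`IsTwoConnectedECF.false_of_pm`).

Let `s₁`, `s₂` separate `G` into `A`, of even order, and `B`, of odd order. Claw-freeness makes both
sides connected and the neighbourhoods of `s₁` and `s₂` in them cliques. If every matching inside
`A` extends to a perfect matching of `A`, then `A` is a clique or an induced 4-cycle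
(`ConnOn.isClique_or_inducesFourCycle`), and the 4-cycle can only occur if `s₁` and `s₂` are
adjacent.

* If `s₁` and `s₂` are non-adjacent and `B` has at least three vertices, then `A` is a clique, and
  each of `s₁`, `s₂` is complete to `A`, or complete to `B`, or `A` splits into one neighbour of one
  of them and the neighbours of the other (`full_or_full_or_split`). A vertex of `B` adjacent to
  neither of them forces `B` to be a path; otherwise `B` is a clique. This leads to `𝒢₂₂`, `𝒢₂₃` and
  `C₇` (`classification_of_three_le`).
* If all separating pairs were adjacent, the same trichotomy would make both sides cliques, which
  leaves no room for three independent vertices; so some separating pair is non-adjacent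
  (`exists_sep_not_adj`).
* What remains is that `B` is a single vertex `b` for every non-adjacent separating pair. If all
  matchings inside `A` extend, then `G` is in `𝒢₂₂`. Otherwise a matching of `A` misses two vertices
  `x`, `y` whose adjacencies to `s₁` and `s₂` are very restricted (`uncovered_of_singleton`). As
  `x`, `y`, `b` are independent, the other vertices have no perfect matching and fall apart into two
  odd components containing `s₁` and `s₂` (`exists_odd_components`). Reattaching `x` or `y` to one
  of them gives a contradiction (`false_of_odd_components`), except when `x` is adjacent to both
  `s₁` and `s₂` and is the only neighbour in `A` of one of them; this is the family `𝒢₂₁`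
  (`memG21_of_singleton`).
-/

namespace EquimatchableClawFree

section

variable {V : Type*} {G : SimpleGraph V}

theorem IsClawFree.adj_of_adj (h : IsClawFree G) {v a b c : V} (ha : G.Adj v a) (hb : G.Adj v b)
    (hc : G.Adj v c) (hab : a ≠ b) (hac : a ≠ c) (hbc : b ≠ c) :
    G.Adj a b ∨ G.Adj a c ∨ G.Adj b c := by
  by_contra! hcon
  obtain ⟨h1, h2, h3⟩ := hcon
  apply h
  have h1' : ¬ G.Adj b a := fun h' => h1 h'.symm
  have h2' : ¬ G.Adj c a := fun h' => h2 h'.symm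
  have h3' : ¬ G.Adj c b := fun h' => h3 h'.symm
  refine ⟨⟨⟨Sum.elim (fun _ => v) ![a, b, c], ?_⟩, ?_⟩⟩
  · rintro (i | i) (j | j) hij
    · simp [Subsingleton.elim i j]
    · fin_cases j <;> simp at hij <;> subst hij <;> simp_all
    · fin_cases i <;> simp at hij <;> subst hij <;> simp_all
    · fin_cases i <;> fin_cases j <;> simp_all
  · have key : ∀ p q : Fin 1 ⊕ Fin 3,
        G.Adj (Sum.elim (fun _ => v) ![a, b, c] p) (Sum.elim (fun _ => v) ![a, b, c] q) ↔
          (completeBipartiteGraph (Fin 1) (Fin 3)).Adj p q := by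
      rintro (i | i) (j | j)
      · simp
      · fin_cases j <;> simp [ha, hb, hc]
      · fin_cases i <;> simp [ha.symm, hb.symm, hc.symm]
      · fin_cases i <;> fin_cases j <;> simp [h1, h2, h3, h1', h2', h3']
    exact fun {p q} => key p q

/-- A matching that leaves only independent vertices uncovered is maximal. -/
theorem _root_.SimpleGraph.Subgraph.IsMatching.maximal_of_indep {M : G.Subgraph}
    (hM : M.IsMatching) (h : ∀ x ∉ M.verts, ∀ y ∉ M.verts, ¬ G.Adj x y) :
    Maximal (fun H : G.Subgraph => H.IsMatching) M := by
  refine ⟨hM, fun H hH hMH => ?_⟩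
  have key : ∀ v w, v ∈ M.verts → H.Adj v w → M.Adj v w := by
    intro v w hv hvw
    obtain ⟨w', hw', -⟩ := hM hv
    rwa [hH.eq_of_adj_left hvw (hMH.2 hw')]
  have hverts : ∀ v w, H.Adj v w → v ∈ M.verts := by
    intro v w hvw
    by_contra hv
    by_cases hw : w ∈ M.verts
    · exact hv (M.edge_vert (key w v hw hvw.symm).symm)
    · exact h v hv w hw hvw.adj_sub
  refine ⟨fun v hv => ?_, fun v w hvw => key v w (hverts v w hvw) hvw⟩
  obtain ⟨w, hw, -⟩ := hH hv
  exact hverts v w hw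

variable [DecidableEq V]

/-! ### Connected vertex sets -/

/-- `U` induces a connected subgraph, expressed through cuts: `U` is non-empty and every proper
non-empty subset of `U` is joined by an edge to the rest of `U`. -/
def ConnOn (G : SimpleGraph V) (U : Finset V) : Prop :=
  U.Nonempty ∧ ∀ X ⊆ U, X.Nonempty → X ≠ U → ∃ x ∈ X, ∃ y ∈ U, y ∉ X ∧ G.Adj x y

theorem ConnOn.insert_of_adj {U : Finset V} (h : ConnOn G U) {u v : V} (hu : u ∈ U)
    (huv : G.Adj u v) : ConnOn G (insert v U) := by
  by_cases hv : v ∈ U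
  · rwa [Finset.insert_eq_of_mem hv]
  refine ⟨Finset.insert_nonempty _ _, fun X hX hne hXU => ?_⟩
  by_cases hvX : v ∈ X
  · by_cases h0 : (X.erase v).Nonempty
    · have hsub : X.erase v ⊆ U := by
        intro x hx
        have := hX (Finset.mem_of_mem_erase hx)
        grind
      have hneq : X.erase v ≠ U := by
        intro h1
        apply hXU
        rw [← h1, Finset.insert_erase hvX]
      obtain ⟨x, hx, y, hy, hyX, hxy⟩ := h.2 _ hsub h0 hneq
      exact ⟨x, Finset.mem_of_mem_erase hx, y, by grind, by grind, hxy⟩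
    · refine ⟨v, hvX, u, by grind, ?_, huv.symm⟩
      intro huX
      exact h0 ⟨u, Finset.mem_erase.2 ⟨huv.ne, huX⟩⟩
  · have hsub : X ⊆ U := by grind
    by_cases h1 : X = U
    · exact ⟨u, by grind, v, by grind, hvX, huv⟩
    · obtain ⟨x, hx, y, hy, hyX, hxy⟩ := h.2 _ hsub hne h1
      exact ⟨x, hx, y, by grind, hyX, hxy⟩

theorem connOn_of_dominating {U : Finset V} {v : V} (hv : v ∈ U)
    (h : ∀ y ∈ U, y ≠ v → G.Adj v y) : ConnOn G U := by
  refine ⟨⟨v, hv⟩, fun X hX hne hXU => ?_⟩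
  obtain ⟨y, hy, hyX⟩ : ∃ y ∈ U, y ∉ X := by
    by_contra! hcon
    exact hXU (Finset.Subset.antisymm hX hcon)
  obtain ⟨x, hx⟩ := hne
  by_cases hvX : v ∈ X
  · exact ⟨v, hvX, y, hy, hyX, h y hy (by grind)⟩
  · exact ⟨x, hx, v, hv, hvX, (h x (hX hx) (by grind)).symm⟩

theorem connOn_of_isClique {U : Finset V} (hne : U.Nonempty) (h : G.IsClique (U : Set V)) :
    ConnOn G U := by
  obtain ⟨v, hv⟩ := hne
  exact connOn_of_dominating hv fun y hy hyv => h hv hy hyv.symm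

/-- A connected proper subset `W` of a connected set `U` grows one vertex at a time until a single
vertex is missing; hence some vertex outside `W` is not a cut vertex of `U`. -/
theorem ConnOn.exists_erase_of_ssubset {U : Finset V} (hU : ConnOn G U) :
    ∀ {W : Finset V}, ConnOn G W → W ⊆ U → W ≠ U → ∃ u ∈ U, u ∉ W ∧ ConnOn G (U.erase u) := by
  intro W
  induction hn : (U \ W).card using Nat.strong_induction_on generalizing W with
  | _ n ih =>
    intro hW hWU hne
    obtain ⟨x, hx, y, hy, hyW, hxy⟩ := hU.2 W hWU hW.1 hne
    have hc := hW.insert_of_adj hx hxy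
    by_cases h1 : insert y W = U
    · refine ⟨y, hy, hyW, ?_⟩
      rwa [← h1, Finset.erase_insert hyW]
    · have hsub : insert y W ⊆ U := by grind
      have hlt : (U \ insert y W).card < n := by
        rw [← hn]
        apply Finset.card_lt_card
        rw [Finset.ssubset_iff_of_subset (by grind)]
        exact ⟨y, by grind, by grind⟩
      obtain ⟨u, hu, huW, hc'⟩ := ih _ hlt rfl hc hsub h1
      exact ⟨u, hu, by grind, hc'⟩

theorem ConnOn.exists_erase_ne {U : Finset V} (hU : ConnOn G U) (h2 : 2 ≤ U.card) (v : V) :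
    ∃ u ∈ U, u ≠ v ∧ ConnOn G (U.erase u) := by
  obtain ⟨w, hw, hwv⟩ : ∃ w ∈ U, v ∈ U → w = v := by
    by_cases hv : v ∈ U
    · exact ⟨v, hv, fun _ => rfl⟩
    · obtain ⟨w, hw⟩ := hU.1
      exact ⟨w, hw, fun h => absurd h hv⟩
  have hc : ConnOn G {w} := connOn_of_dominating (Finset.mem_singleton_self w) (by grind)
  obtain ⟨u, hu, huw, h⟩ := hU.exists_erase_of_ssubset hc (by grind) (by
    rintro rfl
    simp at h2)
  exact ⟨u, hu, by grind, h⟩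

/-- If `U` is connected but not a clique, then two non-adjacent vertices of `U` are not cut
vertices: apply `ConnOn.exists_erase_of_ssubset` to closed neighbourhoods, twice. -/
theorem ConnOn.exists_not_adj_erase {U : Finset V} (hU : ConnOn G U)
    (h : ¬ G.IsClique (U : Set V)) :
    ∃ x ∈ U, ∃ y ∈ U, x ≠ y ∧ ¬ G.Adj x y ∧ ConnOn G (U.erase x) ∧ ConnOn G (U.erase y) := by
  classical
  have key : ∀ v ∈ U, (∃ w ∈ U, w ≠ v ∧ ¬ G.Adj v w) →
      ∃ u ∈ U, u ≠ v ∧ ¬ G.Adj v u ∧ ConnOn G (U.erase u) := by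
    rintro v hv ⟨w, hw, hwv, hadj⟩
    have hc : ConnOn G (U.filter fun y => y = v ∨ G.Adj v y) :=
      connOn_of_dominating (v := v) (by simp [hv]) (by grind)
    obtain ⟨u, hu, huW, hcu⟩ := hU.exists_erase_of_ssubset hc (Finset.filter_subset _ _) (by
      intro heq
      have : w ∈ U.filter fun y => y = v ∨ G.Adj v y := by rw [heq]; exact hw
      grind)
    exact ⟨u, hu, by grind, by grind, hcu⟩
  obtain ⟨v, hv, w, hw, hvw, hadj⟩ : ∃ v ∈ U, ∃ w ∈ U, v ≠ w ∧ ¬ G.Adj v w := by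
    by_contra! hcon
    exact h fun v hv w hw hvw => hcon v hv w hw hvw
  obtain ⟨x, hx, hxv, hvx, hcx⟩ := key v hv ⟨w, hw, hvw.symm, hadj⟩
  obtain ⟨y, hy, hyx, hxy, hcy⟩ := key x hx ⟨v, hv, hxv.symm, fun h' => hvx h'.symm⟩
  exact ⟨x, hx, y, hy, hyx.symm, hxy, hcx, hcy⟩

/-- A vertex whose neighbours in `U` form a clique is not a cut vertex of `U`. -/
theorem ConnOn.erase_of_nbrs_clique {U : Finset V} (hU : ConnOn G U) {s : V}
    (hs : ∀ x ∈ U, ∀ y ∈ U, x ≠ y → G.Adj s x → G.Adj s y → G.Adj x y)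
    (hne : (U.erase s).Nonempty) : ConnOn G (U.erase s) := by
  by_cases hsU : s ∈ U
  swap
  · rwa [Finset.erase_eq_of_notMem hsU]
  refine ⟨hne, fun X hX hXne hXU => ?_⟩
  by_contra! hcon
  obtain ⟨x, hx, x', hx', hxX', hxx'⟩ := hU.2 X (by grind) hXne (by grind)
  have hYne : ((U.erase s) \ X).Nonempty := by
    rw [Finset.sdiff_nonempty]
    intro h
    exact hXU (Finset.Subset.antisymm hX h)
  obtain ⟨y, hy, y', hy', hyY', hyy'⟩ := hU.2 ((U.erase s) \ X) (by grind) hYne (by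
    intro h
    have : s ∈ (U.erase s) \ X := by rw [h]; exact hsU
    simp at this)
  have h1 : x' = s := by
    by_contra hne'
    exact hcon x hx x' (by grind) hxX' hxx'
  have h2 : y' = s := by
    by_contra hne'
    exact hcon y' (by grind) y (by grind) (by grind) hyy'.symm
  subst h1
  subst h2
  exact hcon x hx y (by grind) (by grind)
    (hs x (by grind) y (by grind) (by grind) hxx'.symm hyy'.symm)

/-- A connected set that is not a clique contains an induced path on three vertices. -/
theorem ConnOn.exists_induced_path {U : Finset V} (hU : ConnOn G U)
    (h : ¬ G.IsClique (U : Set V)) :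
    ∃ x ∈ U, ∃ t ∈ U, ∃ z ∈ U, x ≠ z ∧ ¬ G.Adj x z ∧ G.Adj x t ∧ G.Adj t z := by
  classical
  obtain ⟨x, hx, w, hw, hxw, hadj⟩ : ∃ v ∈ U, ∃ w ∈ U, v ≠ w ∧ ¬ G.Adj v w := by
    by_contra! hcon
    exact h fun v hv w hw hvw => hcon v hv w hw hvw
  obtain ⟨t, ht, z, hz, hzX, htz⟩ := hU.2 (U.filter fun y => y = x ∨ G.Adj x y)
    (Finset.filter_subset _ _) ⟨x, by simp [hx]⟩ (by
      intro heq
      have : w ∈ U.filter fun y => y = x ∨ G.Adj x y := by rw [heq]; exact hw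
      grind)
  have hxz : z ≠ x ∧ ¬ G.Adj x z := by grind
  refine ⟨x, hx, t, by grind, z, hz, hxz.1.symm, hxz.2, ?_, htz⟩
  rcases (Finset.mem_filter.1 ht).2 with rfl | h'
  · exact absurd htz hxz.2
  · exact h'

/-- In a claw-free graph, if `insert v W` is connected and `W` splits into two parts without edges
between them, then each part is connected: otherwise `v` would see three pieces of `W`. -/
theorem IsClawFree.connOn_of_closed (hcf : IsClawFree G) {W X : Finset V} {v : V} (hv : v ∉ W)
    (hW : ConnOn G (insert v W)) (hXW : X ⊆ W) (hne : X.Nonempty) (hXne : X ≠ W)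
    (hcl : ∀ x ∈ X, ∀ y ∈ W, y ∉ X → ¬ G.Adj x y) : ConnOn G X := by
  refine ⟨hne, fun X₁ hX₁ hne₁ hX₁ne => ?_⟩
  by_contra! hcon
  have key : ∀ Z ⊆ W, Z.Nonempty → (∀ x ∈ Z, ∀ y ∈ W, y ∉ Z → ¬ G.Adj x y) →
      ∃ z ∈ Z, G.Adj v z := by
    intro Z hZ hZne hZcl
    obtain ⟨z, hz, y, hy, hyZ, hzy⟩ := hW.2 Z (by grind) hZne (by
      rintro rfl
      exact hv (hZ (by simp)))
    by_cases hyv : y = v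
    · exact ⟨z, hz, hyv ▸ hzy.symm⟩
    · exact absurd hzy (hZcl z hz y (by grind) hyZ)
  obtain ⟨a, ha, hva⟩ := key X₁ (by grind) hne₁ (by grind)
  obtain ⟨b, hb, hvb⟩ := key (X \ X₁) (by grind) (by
    rw [Finset.sdiff_nonempty]
    intro h'
    exact hX₁ne (Finset.Subset.antisymm hX₁ h')) (by
      intro x hx y hy hyZ hadj
      by_cases hyX : y ∈ X
      · exact hcon y (by grind) x (by grind) (by grind) hadj.symm
      · exact hcl x (by grind) y hy hyX hadj)
  obtain ⟨c, hc, hvc⟩ := key (W \ X) (by grind) (by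
    rw [Finset.sdiff_nonempty]
    intro h'
    exact hXne (Finset.Subset.antisymm hXW h')) (by
      intro x hx y hy hyZ hadj
      exact hcl y (by grind) x (by grind) (by grind) hadj.symm)
  rcases hcf.adj_of_adj hva hvb hvc (by grind) (by grind) (by grind) with h' | h' | h'
  · exact hcon a ha b (by grind) (by grind) h'
  · exact hcl a (by grind) c (by grind) (by grind) h'
  · exact hcl b (by grind) c (by grind) (by grind) h'

end

section

variable {V : Type*} [DecidableEq V] {G : SimpleGraph V}

/-! ### Perfectly matched vertex sets -/

/-- `U` is the vertex set of a matching of `G`; equivalently `G[U]` has a perfect matching. The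
matching is built edge by edge. -/
inductive PM (G : SimpleGraph V) : Finset V → Prop
  | empty : PM G ∅
  | insert_edge {U : Finset V} {x y : V} (h : PM G U) (hx : x ∉ U) (hy : y ∉ U) (hxy : G.Adj x y) :
      PM G (insert x (insert y U))

theorem PM.even {U : Finset V} (h : PM G U) : Even U.card := by
  induction h with
  | empty => simp
  | insert_edge h hx hy hxy ih =>
    have := hxy.ne
    rw [Finset.card_insert_of_notMem (by grind), Finset.card_insert_of_notMem hy]
    grind

/-- A union of components of a perfectly matched set has even order. -/
theorem PM.even_of_closed {U : Finset V} (h : PM G U) : ∀ {X : Finset V}, X ⊆ U →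
    (∀ x ∈ X, ∀ y ∈ U, y ∉ X → ¬ G.Adj x y) → Even X.card := by
  induction h with
  | empty =>
    intro X hX _
    simp [Finset.subset_empty.1 hX]
  | @insert_edge U x y h hx hy hxy ih =>
    intro X hX hcl
    by_cases hxX : x ∈ X
    · have hyX : y ∈ X := by
        by_contra hyX
        exact hcl x hxX y (by grind) hyX hxy
      have h1 : Even ((X.erase x).erase y).card := by
        refine ih (by grind) fun a ha b hb hbX => hcl a (by grind) b (by grind) (by grind)
      have h2 := Finset.card_erase_add_one hxX
      have h3 := Finset.card_erase_add_one (Finset.mem_erase.2 ⟨hxy.ne.symm, hyX⟩)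
      grind
    · have hyX : y ∉ X := by
        intro hyX
        exact hcl y hyX x (by grind) hxX hxy.symm
      refine ih (by grind) fun a ha b hb hbX => hcl a ha b (by grind) hbX

theorem PM.union {U W : Finset V} (hU : PM G U) (hW : PM G W) (h : Disjoint U W) :
    PM G (U ∪ W) := by
  induction hU with
  | empty => simpa
  | @insert_edge U x y hU hx hy hxy ih =>
    rw [Finset.insert_union, Finset.insert_union]
    rw [Finset.disjoint_insert_left, Finset.disjoint_insert_left] at h
    exact (ih h.2.2).insert_edge (by grind) (by grind) hxy

theorem PM.pair {x y : V} (h : G.Adj x y) : PM G {x, y} :=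
  PM.empty.insert_edge (by simp) (by simp) h

/-- In a perfectly matched set every vertex has a partner. -/
theorem PM.exists_partner {U : Finset V} (h : PM G U) {x : V} (hx : x ∈ U) :
    ∃ y ∈ U, G.Adj x y ∧ PM G (U \ {x, y}) := by
  induction h with
  | empty => simp at hx
  | @insert_edge U a b hU ha hb hab ih =>
    by_cases h1 : x = a
    · subst h1
      refine ⟨b, by simp, hab, ?_⟩
      have : insert x (insert b U) \ {x, b} = U := by grind
      rwa [this]
    by_cases h2 : x = b
    · subst h2
      refine ⟨a, by simp, hab.symm, ?_⟩
      have : insert a (insert x U) \ {x, a} = U := by grind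
      rwa [this]
    obtain ⟨y, hy, hxy, hPM⟩ := ih (by grind)
    refine ⟨y, by grind, hxy, ?_⟩
    have : insert a (insert b U) \ {x, y} =
        insert a (insert b (U \ {x, y})) := by grind
    rw [this]
    exact hPM.insert_edge (by grind) (by grind) hab

theorem PM.exists_partner_sdiff {A S : Finset V} (h : PM G (A \ S)) {x : V} (hx : x ∈ A)
    (hxS : x ∉ S) : ∃ y ∈ A, y ∉ S ∧ G.Adj x y ∧ PM G (A \ insert x (insert y S)) := by
  obtain ⟨y, hy, hxy, hPM⟩ := h.exists_partner (Finset.mem_sdiff.2 ⟨hx, hxS⟩)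
  refine ⟨y, by grind, by grind, hxy, ?_⟩
  convert hPM using 1
  grind

/-- Adding the edge `xy` to a matching that covers all vertices of `A` outside `T = S ∪ {x, y}`. -/
theorem PM.of_sdiff {A S T : Finset V} {x y : V} (h : PM G (A \ T)) (hxy : G.Adj x y)
    (hT : ∀ a, a ∈ T ↔ a = x ∨ a = y ∨ a ∈ S) (hx : x ∈ A) (hy : y ∈ A) (hxS : x ∉ S)
    (hyS : y ∉ S) : PM G (A \ S) := by
  convert h.insert_edge (x := x) (y := y) (by simp [hT]) (by simp [hT]) hxy using 1
  ext a
  have := hT a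
  simp only [Finset.mem_sdiff, Finset.mem_insert]
  grind

/-- Inside every set `U` there is a matching whose uncovered vertices are independent. -/
theorem PM.exists_maximal_subset (U : Finset V) :
    ∃ L ⊆ U, PM G L ∧ ∀ x ∈ U \ L, ∀ y ∈ U \ L, ¬ G.Adj x y := by
  induction hn : U.card using Nat.strong_induction_on generalizing U with
  | _ n ih =>
    by_cases h : ∀ x ∈ U, ∀ y ∈ U, ¬ G.Adj x y
    · exact ⟨∅, by simp, PM.empty, by simpa using h⟩
    · push Not at h
      obtain ⟨x, hx, y, hy, hxy⟩ := h
      have hlt : (U \ {x, y}).card < n := by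
        rw [← hn]
        apply Finset.card_lt_card
        rw [Finset.ssubset_iff_of_subset (by grind)]
        exact ⟨x, hx, by grind⟩
      obtain ⟨L, h1, h2, h3⟩ := ih _ hlt _ rfl
      refine ⟨insert x (insert y L), by grind, h2.insert_edge (by grind) (by grind) hxy, ?_⟩
      intro a ha b hb
      exact h3 a (by grind) b (by grind)

/-- A connected claw-free graph of even order has a perfect matching. -/
theorem ConnOn.pm (hcf : IsClawFree G) :
    ∀ {U : Finset V}, ConnOn G U → Even U.card → PM G U := by
  intro U
  induction hn : U.card using Nat.strong_induction_on generalizing U with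
  | _ n ih =>
  intro hU hev
  have h2 : 2 ≤ U.card := by
    have := hU.1.card_pos
    grind
  -- Match a vertex `u` that is not a cut vertex with one of its neighbours `v`; deleting both
  -- leaves at most two components, which are matched among themselves or with `u` and `v`.
  obtain ⟨u, hu, -, hcu⟩ := hU.exists_erase_ne h2 hU.1.choose
  obtain ⟨u', hu', v, hv, hvu, huv⟩ := hU.2 {u} (by simpa using hu) (by simp) (by
    rintro h'
    rw [← h'] at h2
    simp at h2)
  obtain rfl : u' = u := by simpa using hu'
  set W := (U.erase u').erase v with hW
  have hvE : v ∈ U.erase u' := by grind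
  have hvW : v ∉ W := by grind
  have huW : u' ∉ W := by grind
  have hins : insert v W = U.erase u' := Finset.insert_erase hvE
  have hins2 : insert u' (insert v W) = U := by rw [hins, Finset.insert_erase hu]
  have hcardW : W.card + 2 = U.card := by
    rw [← hins2, Finset.card_insert_of_notMem (by grind), Finset.card_insert_of_notMem hvW]
  suffices hPM : PM G W ∨ PM G U by
    rcases hPM with h | h
    · rw [← hins2]
      exact h.insert_edge huW hvW huv
    · exact h
  by_cases hW0 : W = ∅
  · left; rw [hW0]; exact PM.empty
  by_cases hWc : ConnOn G W
  · exact Or.inl (ih W.card (by grind) rfl hWc (by grind))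
  obtain ⟨X, hXW, hXne, hXW', hcl⟩ : ∃ X ⊆ W, X.Nonempty ∧ X ≠ W ∧
      ∀ x ∈ X, ∀ y ∈ W, y ∉ X → ¬ G.Adj x y := by
    by_contra! hcon
    exact hWc ⟨Finset.nonempty_iff_ne_empty.2 hW0, fun X h1 h2 h3 => hcon X h1 h2 h3⟩
  have hXc : ConnOn G X := hcf.connOn_of_closed hvW (hins ▸ hcu) hXW hXne hXW' hcl
  set Y := W \ X with hY
  have hYne : Y.Nonempty := by
    rw [hY, Finset.sdiff_nonempty]
    intro h'
    exact hXW' (Finset.Subset.antisymm hXW h')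
  have hYc : ConnOn G Y := hcf.connOn_of_closed hvW (hins ▸ hcu) (by grind) hYne
    (by
      intro h'
      obtain ⟨x, hx⟩ := hXne
      have : x ∈ Y := by rw [h']; exact hXW hx
      grind)
    (fun x hx y hy hyY hadj => hcl y (by grind) x (by grind) (by grind) hadj.symm)
  have hXY : X ∪ Y = W := by grind
  have hdisj : Disjoint X Y := Finset.disjoint_sdiff
  have hcard : X.card + Y.card = W.card := by rw [← Finset.card_union_of_disjoint hdisj, hXY]
  have hXpos := hXne.card_pos
  have hYpos := hYne.card_pos
  by_cases hXev : Even X.card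
  · left
    rw [← hXY]
    exact (ih X.card (by grind) rfl hXc hXev).union (ih Y.card (by grind) rfl hYc (by grind)) hdisj
  right
  -- Each part sends an edge to `v`, because `U.erase u` is connected.
  have hvpart : ∀ Z ⊆ W, Z.Nonempty → (∀ x ∈ Z, ∀ y ∈ W, y ∉ Z → ¬ G.Adj x y) →
      ∃ z ∈ Z, G.Adj v z := by
    intro Z hZ hZne hZcl
    obtain ⟨z, hz, y, hy, hyZ, hzy⟩ := hcu.2 Z (by grind) hZne (by
      rintro rfl
      exact hvW (hZ hvE))
    by_cases hyv : y = v
    · exact ⟨z, hz, hyv ▸ hzy.symm⟩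
    · exact absurd hzy (hZcl z hz y (by grind) hyZ)
  obtain ⟨a, ha, hva⟩ := hvpart X hXW hXne hcl
  obtain ⟨b, hb, hvb⟩ := hvpart Y (by grind) hYne
    (fun x hx y hy hyY hadj => hcl y (by grind) x (by grind) (by grind) hadj.symm)
  have huXY : (∃ x ∈ X, G.Adj u' x) ∨ ∃ y ∈ Y, G.Adj u' y := by
    rcases hcf.adj_of_adj huv.symm hva hvb (by grind) (by grind) (by grind) with h' | h' | h'
    · exact Or.inl ⟨a, ha, h'⟩
    · exact Or.inr ⟨b, hb, h'⟩
    · exact absurd h' (hcl a ha b (by grind) (by grind))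
  have finish : ∀ X Y : Finset V, X ∪ Y = W → Disjoint X Y → 0 < X.card → 0 < Y.card →
      X.card + Y.card = W.card → ¬ Even X.card → ConnOn G X → ConnOn G Y →
      (∃ x ∈ X, G.Adj u' x) → (∃ y ∈ Y, G.Adj v y) → PM G U := by
    rintro X Y hXY hdisj hXpos hYpos hcard hXev hXc hYc ⟨x, hx, hux⟩ ⟨y, hy, hvy⟩
    have e1 : (insert u' X).card = X.card + 1 := Finset.card_insert_of_notMem (by grind)
    have e2 : (insert v Y).card = Y.card + 1 := Finset.card_insert_of_notMem (by grind)
    have p1 := ih (insert u' X).card (by grind) rfl (hXc.insert_of_adj hx hux.symm) (by grind)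
    have p2 := ih (insert v Y).card (by grind) rfl (hYc.insert_of_adj hy hvy.symm) (by grind)
    have : insert u' X ∪ insert v Y = U := by
      rw [← hins2, ← hXY]
      grind
    rw [← this]
    refine p1.union p2 ?_
    rw [Finset.disjoint_left] at hdisj ⊢
    grind
  rcases huXY with h | h
  · exact finish X Y hXY hdisj hXpos hYpos hcard hXev hXc hYc h ⟨b, hb, hvb⟩
  · exact finish Y X (by rw [Finset.union_comm, hXY]) hdisj.symm hYpos hXpos (by omega) (by grind)
      hYc hXc h ⟨a, ha, hva⟩

theorem PM.of_isClique (hcf : IsClawFree G) {U : Finset V} (h : G.IsClique (U : Set V))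
    (hev : Even U.card) : PM G U := by
  rcases U.eq_empty_or_nonempty with rfl | hne
  · exact PM.empty
  · exact (connOn_of_isClique hne h).pm hcf hev

/-! ### Maximal matchings of equimatchable graphs -/

theorem PM.exists_isMatching {U : Finset V} (h : PM G U) :
    ∃ M : G.Subgraph, M.IsMatching ∧ M.verts = (U : Set V) ∧ M.edgeSet.Finite ∧
      2 * M.edgeSet.ncard = U.card := by
  induction h with
  | empty =>
    refine ⟨⊥, ?_, by simp, by simp, by simp⟩
    intro v hv
    simp at hv
  | @insert_edge U x y hU hx hy hxy ih =>
    obtain ⟨M, hM, hv, hfin, hcard⟩ := ih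
    have hne := hxy.ne
    refine ⟨G.subgraphOfAdj hxy ⊔ M, ?_, ?_, ?_, ?_⟩
    · refine (SimpleGraph.Subgraph.IsMatching.subgraphOfAdj hxy).sup hM ?_
      rw [SimpleGraph.support_subgraphOfAdj, hM.support_eq_verts, hv]
      rw [Set.disjoint_left]
      grind
    · rw [SimpleGraph.Subgraph.verts_sup, hv]
      ext z
      simp
      tauto
    · rw [SimpleGraph.Subgraph.edgeSet_sup]
      simp [hfin]
    · rw [SimpleGraph.Subgraph.edgeSet_sup, SimpleGraph.edgeSet_subgraphOfAdj,
        Set.singleton_union, Set.ncard_insert_of_notMem _ hfin,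
        Finset.card_insert_of_notMem (by grind), Finset.card_insert_of_notMem hy]
      · omega
      · intro hmem
        have : x ∈ M.verts := SimpleGraph.Subgraph.edge_vert _ hmem
        rw [hv] at this
        exact hx this

/-- In a connected equimatchable claw-free graph of odd order every maximal matching misses a
single vertex, since some matching does: delete a vertex that is not a cut vertex. -/
theorem IsEquimatchable.eq_of_notMem [Fintype V] (hequi : IsEquimatchable G)
    (hcf : IsClawFree G) (hodd : Odd (Fintype.card V)) (hconn : ConnOn G Finset.univ)
    {K : Finset V} (hK : PM G K) (hind : ∀ x ∉ K, ∀ y ∉ K, ¬ G.Adj x y) {x y : V}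
    (hx : x ∉ K) (hy : y ∉ K) : x = y := by
  by_contra hxy
  have h2 : 2 ≤ (Finset.univ : Finset V).card := Finset.one_lt_card.2 ⟨x, by simp, y, by simp, hxy⟩
  obtain ⟨u, hu, -, hcu⟩ := hconn.exists_erase_ne h2 x
  have hcard := Finset.card_erase_add_one hu
  rw [Finset.card_univ] at hcard
  have hPM := hcu.pm hcf (by grind)
  obtain ⟨M, hM, hMv, -, hMc⟩ := hPM.exists_isMatching
  obtain ⟨N, hN, hNv, -, hNc⟩ := hK.exists_isMatching
  have h1 := hequi M N
    (hM.maximal_of_indep (by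
      rw [hMv]
      intro a ha b hb hab
      have ha' : a = u := by simpa using ha
      have hb' : b = u := by simpa using hb
      subst ha'
      subst hb'
      exact G.irrefl hab))
    (hN.maximal_of_indep (by
      rw [hNv]
      exact fun a ha b hb => hind a (by simpa using ha) b (by simpa using hb)))
  have h3 : (insert x (insert y K)).card = K.card + 2 := by
    rw [Finset.card_insert_of_notMem (by grind), Finset.card_insert_of_notMem hy]
  have h4 := Finset.card_le_univ (insert x (insert y K))
  omega

end

section

variable {V : Type*} [DecidableEq V] {G : SimpleGraph V}

/-! ### Sets in which almost every matching extends to a perfect one -/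

/-- `C` is the vertex set of an induced 4-cycle with cyclic order `x, t, z, w`. -/
structure InducesFourCycle (G : SimpleGraph V) (C : Finset V) (x t z w : V) : Prop where
  eq : C = {x, t, z, w}
  xt : G.Adj x t
  tz : G.Adj t z
  zw : G.Adj z w
  wx : G.Adj w x
  xz : ¬ G.Adj x z
  tw : ¬ G.Adj t w
  xz_ne : x ≠ z
  tw_ne : t ≠ w

theorem InducesFourCycle.rotate {C : Finset V} {x t z w : V} (h : InducesFourCycle G C x t z w) :
    InducesFourCycle G C t z w x :=
  ⟨by rw [h.eq]; grind, h.tz, h.zw, h.wx, h.xt, h.tw, fun h' => h.xz h'.symm, h.tw_ne,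
    h.xz_ne.symm⟩

theorem InducesFourCycle.reflect {C : Finset V} {x t z w : V} (h : InducesFourCycle G C x t z w) :
    InducesFourCycle G C x w z t :=
  ⟨by rw [h.eq]; grind, h.wx.symm, h.zw.symm, h.tz.symm, h.xt.symm, h.xz,
    fun h' => h.tw h'.symm, h.xz_ne, h.tw_ne.symm⟩

/-- A vertex outside an induced 4-cycle of a claw-free graph that has a neighbour on the cycle is
adjacent to two consecutive vertices of the cycle. -/
theorem InducesFourCycle.exists_adj_adj (hcf : IsClawFree G) {C : Finset V} {x t z w r c : V}
    (h : InducesFourCycle G C x t z w) (hr : r ∉ C) (hc : c ∈ C) (hrc : G.Adj r c) :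
    ∃ x t z w, InducesFourCycle G C x t z w ∧ G.Adj r x ∧ G.Adj r t := by
  have key : ∀ x t z w, InducesFourCycle G C x t z w → G.Adj r x →
      ∃ x t z w, InducesFourCycle G C x t z w ∧ G.Adj r x ∧ G.Adj r t := by
    intro x t z w h hrx
    rw [h.eq] at hr
    rcases hcf.adj_of_adj h.xt h.wx.symm hrx.symm h.tw_ne (by grind) (by grind) with h' | h' | h'
    · exact absurd h' h.tw
    · exact ⟨x, t, z, w, h, hrx, h'.symm⟩
    · exact ⟨x, w, z, t, h.reflect, hrx, h'.symm⟩
  rw [h.eq] at hc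
  simp only [Finset.mem_insert, Finset.mem_singleton] at hc
  rcases hc with rfl | rfl | rfl | rfl
  · exact key _ _ _ _ h hrc
  · exact key _ _ _ _ h.rotate hrc
  · exact key _ _ _ _ h.rotate.rotate hrc
  · exact key _ _ _ _ h.rotate.rotate.rotate hrc

/-- Suppose `A` contains an induced 4-cycle `C` and an edge `rv` outside `C` such that `r` has a
neighbour in `C` and the rest of `A` is perfectly matched. Then two vertices among `v` and the
cycle can be left uncovered although they are not adjacent: with `r` adjacent to `x` and `t`, the
edges `tz`, `rx` leave `v, w`, and if these are adjacent, then `rt`, `vw` leave `x, z`. -/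
theorem InducesFourCycle.exists_not_adj (hcf : IsClawFree G) {A C : Finset V} {x t z w r c v : V}
    (h : InducesFourCycle G C x t z w) (hCA : C ⊆ A) (hr : r ∈ A) (hrC : r ∉ C) (hc : c ∈ C)
    (hrc : G.Adj r c) (hv : v ∈ A) (hvC : v ∉ C) (hrv : G.Adj r v)
    (hPM : PM G (A \ insert r (insert v C))) :
    ∃ p ∈ insert v C, ∃ q ∈ insert v C, p ≠ q ∧ ¬ G.Adj p q ∧ PM G (A \ {p, q}) := by
  obtain ⟨x, t, z, w, h, hrx, hrt⟩ := h.exists_adj_adj hcf hrC hc hrc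
  have hne := hrv.ne
  have h1 := h.xt.ne
  have h2 := h.tz.ne
  have h3 := h.zw.ne
  have h4 := h.wx.ne
  have h5 := h.xz_ne
  have h6 := h.tw_ne
  have heq := h.eq
  subst heq
  have hx : x ∈ A := hCA (by simp)
  have ht : t ∈ A := hCA (by simp)
  have hz : z ∈ A := hCA (by simp)
  have hw : w ∈ A := hCA (by simp)
  simp only [Finset.mem_insert, Finset.mem_singleton, not_or] at hrC hvC
  by_cases hvw : G.Adj v w
  · refine ⟨x, by simp, z, by simp, h5, h.xz, ?_⟩
    have := (hPM.insert_edge (x := t) (y := r) (by simp) (by simp) hrt.symm).insert_edge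
      (x := v) (y := w) (by grind) (by grind) hvw
    convert this using 1
    grind
  · refine ⟨v, by simp, w, by simp, by grind, hvw, ?_⟩
    have := (hPM.insert_edge (x := r) (y := x) (by simp) (by simp) hrx).insert_edge
      (x := t) (y := z) (by grind) (by grind) h.tz
    convert this using 1
    grind

/-- Suppose that every matching inside `A` that covers the vertices of `E` extends to a perfect
matching of `A`. Then what such a matching leaves uncovered is perfectly matched, and two vertices
outside `E` that can be left uncovered together are adjacent. -/
theorem PM.sdiff_and_adj {A E : Finset V}
    (hJ : ∀ K ⊆ A, PM G K → (∀ x ∈ A \ K, ∀ y ∈ A \ K, ¬ G.Adj x y) → E ⊆ K → K = A) :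
    (∀ K ⊆ A, PM G K → E ⊆ K → PM G (A \ K)) ∧
    ∀ p ∈ A, ∀ q ∈ A, p ≠ q → p ∉ E → q ∉ E → E ⊆ A → PM G (A \ {p, q}) → G.Adj p q := by
  constructor
  · intro K hKA hK hEK
    obtain ⟨L, hL, hLP, hind⟩ := PM.exists_maximal_subset (G := G) (A \ K)
    have hd : Disjoint K L := by
      rw [Finset.disjoint_left]
      grind
    have h1 := hJ (K ∪ L) (by grind) (hK.union hLP hd)
      (fun a ha b hb => hind a (by grind) b (by grind)) (by grind)
    have h' : A \ K = L := by
      rw [← h1]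
      rw [Finset.disjoint_left] at hd
      grind
    rwa [h']
  · intro p hp q hq hpq hpE hqE hEA hPM
    by_contra hcon
    have h1 := hJ (A \ {p, q}) (by grind) hPM (by
      intro a ha b hb hab
      have ha' : a = p ∨ a = q := by grind
      have hb' : b = p ∨ b = q := by grind
      rcases ha' with rfl | rfl <;> rcases hb' with rfl | rfl
      · exact G.irrefl hab
      · exact hcon hab
      · exact hcon hab.symm
      · exact G.irrefl hab) (by grind)
    rw [← h1] at hp
    simp at hp

/-- Let `A` be connected in a claw-free graph. If every matching inside `A` extends to a perfect
matching of `A`, then `A` is a clique or induces a 4-cycle. -/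
theorem ConnOn.isClique_or_inducesFourCycle (hcf : IsClawFree G) {A : Finset V} (hA : ConnOn G A)
    (hJ : ∀ K ⊆ A, PM G K → (∀ x ∈ A \ K, ∀ y ∈ A \ K, ¬ G.Adj x y) → K = A) :
    G.IsClique (A : Set V) ∨ ∃ x t z w, InducesFourCycle G A x t z w := by
  obtain ⟨hext, hadj⟩ := PM.sdiff_and_adj (E := ∅) fun K hK hP hi _ => hJ K hK hP hi
  by_cases hcl : G.IsClique (A : Set V)
  · exact Or.inl hcl
  right
  obtain ⟨x, hx, t, ht, z, hz, hxz_ne, hxz, hxt, htz⟩ := hA.exists_induced_path hcl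
  have hxt_ne := hxt.ne
  have htz_ne := htz.ne
  clear hJ
  obtain ⟨w, hwA, hw, hzw, hR⟩ :=
    (hext {x, t} (by grind) (PM.pair hxt) (by simp)).exists_partner_sdiff hz
      (by simp [hxz_ne.symm, htz_ne.symm])
  clear hext
  have hzw_ne := hzw.ne
  obtain ⟨hwx, hwt⟩ : w ≠ x ∧ w ≠ t := by simpa using hw
  have hxw : G.Adj x w := by
    refine hadj x hx w hwA hwx.symm (by simp) (by simp) (by simp)
      (hR.of_sdiff htz ?_ ht hz ?_ ?_)
    · clear * -
      simp
      tauto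
    · simp [hxt_ne.symm, hwt.symm]
    · simp [hxz_ne.symm, hzw_ne]
  have htw : ¬ G.Adj t w := by
    intro h'
    refine hxz (hadj x hx z hz hxz_ne (by simp) (by simp) (by simp)
      (hR.of_sdiff h' ?_ ht hwA ?_ ?_))
    · clear * -
      simp
      tauto
    · simp [hxt_ne.symm, htz_ne]
    · simp [hwx, hzw_ne.symm]
  have hC : InducesFourCycle G {x, t, z, w} x t z w :=
    ⟨rfl, hxt, htz, hzw, hxw.symm, hxz, htw, hxz_ne, hwt.symm⟩
  refine ⟨x, t, z, w, ?_⟩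
  suffices hCA : ({x, t, z, w} : Finset V) = A by rwa [hCA] at hC
  by_contra hCA
  have hsub : ({x, t, z, w} : Finset V) ⊆ A := by clear hadj; grind
  obtain ⟨c, hc, r, hr, hrC, hcr⟩ := hA.2 {x, t, z, w} hsub (by simp) hCA
  have hR' : PM G (A \ {x, t, z, w}) := by
    convert hR using 2
    clear hadj
    grind
  obtain ⟨v, hv, hvC, hrv, hQ⟩ := hR'.exists_partner_sdiff hr hrC
  obtain ⟨p, hp, q, hq, hpq, hnadj, hPM⟩ :=
    hC.exists_not_adj hcf hsub hr hrC hc hcr.symm hv hvC hrv hQ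
  have hins : insert v {x, t, z, w} ⊆ A := Finset.insert_subset hv hsub
  exact hnadj (hadj p (hins hp) q (hins hq) hpq (by simp) (by simp) (by simp) hPM)

/-- A variant of `ConnOn.isClique_or_inducesFourCycle` with an exceptional vertex `x₀` whose
neighbours in `A` form a clique with at least two vertices: if every matching inside `A` that
covers `x₀` extends to a perfect matching of `A`, then `A` without `x₀` is a clique. -/
theorem ConnOn.isClique_erase (hcf : IsClawFree G) {A : Finset V} (hA : ConnOn G A) {x₀ w₁ w₂ : V}
    (hx₀ : x₀ ∈ A) (hnb : ∀ x ∈ A, ∀ y ∈ A, x ≠ y → G.Adj x₀ x → G.Adj x₀ y → G.Adj x y)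
    (hw₁ : w₁ ∈ A) (hw₂ : w₂ ∈ A) (hw : w₁ ≠ w₂) (hxw₁ : G.Adj x₀ w₁) (hxw₂ : G.Adj x₀ w₂)
    (hJ : ∀ K ⊆ A, PM G K → (∀ x ∈ A \ K, ∀ y ∈ A \ K, ¬ G.Adj x y) → x₀ ∈ K → K = A) :
    G.IsClique ((A.erase x₀ : Finset V) : Set V) := by
  obtain ⟨hext', hadj'⟩ := PM.sdiff_and_adj (E := {x₀})
    fun K hK hP hi h' => hJ K hK hP hi (by simpa using h')
  have hext : ∀ K ⊆ A, PM G K → x₀ ∈ K → PM G (A \ K) :=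
    fun K hK hP h => hext' K hK hP (by simpa using h)
  have hadj : ∀ p ∈ A, ∀ q ∈ A, p ≠ q → p ≠ x₀ → q ≠ x₀ → PM G (A \ {p, q}) → G.Adj p q :=
    fun p hp q hq hpq hpx hqx hP =>
      hadj' p hp q hq hpq (by simpa using hpx) (by simpa using hqx) (by simpa using hx₀) hP
  clear hJ hext' hadj'
  by_contra hcl
  have hne₁ := hxw₁.ne
  have hne₂ := hxw₂.ne
  obtain ⟨p, hp, t, ht, q, hq, hpq_ne, hpq, hpt, htq⟩ :=
    (hA.erase_of_nbrs_clique hnb ⟨w₁, by simp [hw₁, hne₁.symm]⟩).exists_induced_path hcl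
  have hpt_ne := hpt.ne
  have htq_ne := htq.ne
  obtain ⟨hpx, hp⟩ := Finset.mem_erase.1 hp
  obtain ⟨htx, ht⟩ := Finset.mem_erase.1 ht
  obtain ⟨hqx, hq⟩ := Finset.mem_erase.1 hq
  -- A neighbour of `x₀` outside `{p, t, q}` exists: otherwise `x₀` is adjacent to `t` and, say, to
  -- `p`; then extend the matching `qt`, `px₀` and replace these two edges by `tx₀`.
  obtain ⟨w, hwA, hxw, hwp, hwt, hwq⟩ : ∃ w ∈ A, G.Adj x₀ w ∧ w ≠ p ∧ w ≠ t ∧ w ≠ q := by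
    by_contra! hcon
    have key : ∀ p q, p ∈ A → q ∈ A → p ≠ x₀ → q ≠ x₀ → p ≠ q → t ≠ p → t ≠ q → ¬ G.Adj p q →
        G.Adj t q → G.Adj x₀ p → ¬ G.Adj x₀ t := by
      clear hcon
      intro p q hpA hqA hpx hqx hpq_ne htp_ne htq_ne hpq htq hxp hxt
      have hP : PM G {q, t, p, x₀} :=
        (PM.pair hxp.symm).insert_edge (by simp [hqx, hpq_ne.symm]) (by simp [htx, htp_ne])
          htq.symm
      have h1 := hext {q, t, p, x₀} (by simp [Finset.insert_subset_iff, ht, hpA, hqA, hx₀]) hP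
        (by simp)
      refine hpq (hadj p hpA q hqA hpq_ne hpx hqx (h1.of_sdiff hxt.symm ?_ ht hx₀ ?_ ?_))
      · clear * -
        simp
        tauto
      · simp [htp_ne, htq_ne]
      · simp [hpx.symm, hqx.symm]
    have k1 := key p q hp hq hpx hqx hpq_ne hpt_ne.symm htq_ne hpq htq
    have k2 := key q p hq hp hqx hpx hpq_ne.symm htq_ne hpt_ne.symm
      (fun h => hpq h.symm) hpt.symm
    by_cases hxt : G.Adj x₀ t
    · have e : ∀ w ∈ A, G.Adj x₀ w → w = t := by
        intro w hwA hxw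
        by_contra hwt
        have hwp : w ≠ p := by
          rintro rfl
          exact k1 hxw hxt
        have hwq := hcon w hwA hxw hwp hwt
        rw [hwq] at hxw
        exact k2 hxw hxt
      exact hw ((e w₁ hw₁ hxw₁).trans (e w₂ hw₂ hxw₂).symm)
    · have e : ∀ w ∈ A, G.Adj x₀ w → w ≠ p → w = q := by
        intro w hwA hxw hwp
        refine hcon w hwA hxw hwp ?_
        rintro rfl
        exact hxt hxw
      by_cases h₁ : w₁ = p
      · rw [e w₂ hw₂ hxw₂ (by rw [← h₁]; exact hw.symm)] at hxw₂
        rw [h₁] at hxw₁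
        exact hpq (hnb p hp q hq hpq_ne hxw₁ hxw₂)
      · have h₂ : w₂ = p := by
          by_contra h₂
          exact hw ((e w₁ hw₁ hxw₁ h₁).trans (e w₂ hw₂ hxw₂ h₂).symm)
        rw [e w₁ hw₁ hxw₁ h₁] at hxw₁
        rw [h₂] at hxw₂
        exact hpq (hnb p hp q hq hpq_ne hxw₂ hxw₁)
  have hxw_ne := hxw.ne
  have hP : PM G {p, t, x₀, w} :=
    (PM.pair hxw).insert_edge (by simp [hpx, hwp.symm]) (by simp [htx, hwt.symm]) hpt
  obtain ⟨u, huA, hu, hqu, hR⟩ := (hext {p, t, x₀, w}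
    (by simp [Finset.insert_subset_iff, hp, ht, hx₀, hwA]) hP (by simp)).exists_partner_sdiff hq
      (by simp [hpq_ne.symm, htq_ne.symm, hqx, hwq.symm])
  have hqu_ne := hqu.ne
  obtain ⟨hup, hut, hux, huw⟩ : u ≠ p ∧ u ≠ t ∧ u ≠ x₀ ∧ u ≠ w := by simpa using hu
  have hR2 : PM G (A \ {p, t, q, u}) := by
    refine hR.of_sdiff hxw ?_ hx₀ hwA ?_ ?_
    · clear * -
      simp
      tauto
    · simp [hpx.symm, htx.symm, hqx.symm, hux.symm]
    · simp [hwp, hwt, hwq, huw.symm]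
  have hpu : G.Adj p u := by
    refine hadj p hp u huA hup.symm hpx hux (hR2.of_sdiff htq ?_ ht hq ?_ ?_)
    · clear * -
      simp
      tauto
    · simp [hpt_ne.symm, hut.symm]
    · simp [hpq_ne.symm, hqu_ne]
  have htu : ¬ G.Adj t u := by
    intro h'
    refine hpq (hadj p hp q hq hpq_ne hpx hqx (hR2.of_sdiff h' ?_ ht huA ?_ ?_))
    · clear * -
      simp
      tauto
    · simp [hpt_ne.symm, htq_ne]
    · simp [hup, hqu_ne.symm]
  have hC : InducesFourCycle G {p, t, q, u} p t q u :=
    ⟨rfl, hpt, htq, hqu, hpu.symm, hpq, htu, hpq_ne, hut.symm⟩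
  have hsub : ({p, t, q, u} : Finset V) ⊆ A := by
    simp [Finset.insert_subset_iff, hp, ht, hq, huA]
  have hx₀C : x₀ ∉ ({p, t, q, u} : Finset V) := by
    simp [hpx.symm, htx.symm, hqx.symm, hux.symm]
  have hPC : PM G {p, t, q, u} :=
    (PM.pair hqu).insert_edge (by simp [hpq_ne, hup.symm]) (by simp [htq_ne, hut.symm]) hpt
  have hCne : ({p, t, q, u} : Finset V).Nonempty := ⟨p, by simp⟩
  generalize ({p, t, q, u} : Finset V) = C at hR2 hC hsub hx₀C hPC hCne
  by_cases hx₀adj : ∃ c ∈ C, G.Adj x₀ c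
  · obtain ⟨c, hc, hxc⟩ := hx₀adj
    obtain ⟨v, hv, hvC, hxv, hQ⟩ := hR2.exists_partner_sdiff hx₀ hx₀C
    have hxv_ne := hxv.ne
    obtain ⟨a, ha, b, hb, hab, hnadj, hPM⟩ :=
      hC.exists_not_adj hcf hsub hx₀ hx₀C hc hxc hv hvC hxv hQ
    have hins : insert v C ⊆ A := Finset.insert_subset hv hsub
    have hnot : x₀ ∉ insert v C := by simp [hx₀C, hxv_ne]
    exact hnadj (hadj a (hins ha) b (hins hb) hab (by rintro rfl; exact hnot ha)
      (by rintro rfl; exact hnot hb) hPM)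
  · push Not at hx₀adj
    obtain ⟨c, hc, r, hr, hrC, hcr⟩ := hA.2 C hsub hCne
      (by rintro rfl; exact hx₀C hx₀)
    have hrx : r ≠ x₀ := by
      rintro rfl
      exact hx₀adj c hc hcr.symm
    -- Cover `x₀` by an edge that avoids both the cycle and `r`.
    obtain ⟨w', hw'A, hxw', hw'r⟩ : ∃ w' ∈ A, G.Adj x₀ w' ∧ w' ≠ r := by
      by_cases h' : w₁ = r
      · exact ⟨w₂, hw₂, hxw₂, by rw [← h']; exact hw.symm⟩
      · exact ⟨w₁, hw₁, hxw₁, h'⟩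
    have hw'C : w' ∉ C := fun h' => hx₀adj w' h' hxw'
    have hxw'_ne := hxw'.ne
    have hP2 := hext (insert x₀ (insert w' C)) (by simp [Finset.insert_subset_iff, hsub, hx₀, hw'A])
      (hPC.insert_edge hx₀C hw'C hxw') (by simp)
    obtain ⟨v, hv, hvC, hrv, hQ⟩ := hP2.exists_partner_sdiff hr (by simp [hrx, hw'r.symm, hrC])
    simp only [Finset.mem_insert, not_or] at hvC
    have hQ2 : PM G (A \ insert r (insert v C)) := by
      refine hQ.of_sdiff hxw' ?_ hx₀ hw'A ?_ ?_
      · clear * -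
        simp
        tauto
      · simp [hrx.symm, Ne.symm hvC.1, hx₀C]
      · simp [hw'r, Ne.symm hvC.2.1, hw'C]
    obtain ⟨a, ha, b, hb, hab, hnadj, hPM⟩ :=
      hC.exists_not_adj hcf hsub hr hrC hc hcr.symm hv hvC.2.2 hrv hQ2
    have hins : insert v C ⊆ A := Finset.insert_subset hv hsub
    have hnot : x₀ ∉ insert v C := by simp [hx₀C, Ne.symm hvC.1]
    exact hnadj (hadj a (hins ha) b (hins hb) hab (by rintro rfl; exact hnot ha)
      (by rintro rfl; exact hnot hb) hPM)

end

section

variable {V : Type*} {G : SimpleGraph V}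

/-! ### Separating pairs of vertices -/

/-- `G` is 2-connected, claw-free, of odd order, has three independent vertices, and every matching
of `G` whose uncovered vertices are independent misses at most one vertex. The field `exit` says
that neither the empty set nor a single vertex `s` separates `G`: a vertex set and its complement
stay joined by an edge after deletion of `s`. -/
structure IsTwoConnectedECF [Fintype V] [DecidableEq V] (G : SimpleGraph V) : Prop where
  claw : IsClawFree G
  odd : Odd (Fintype.card V)
  exit : ∀ (X : Finset V) (s : V), (∃ x ∈ X, x ≠ s) → (∃ y, y ∉ X ∧ y ≠ s) →
    ∃ x ∈ X, x ≠ s ∧ ∃ y, y ∉ X ∧ y ≠ s ∧ G.Adj x y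
  eq_of_notMem : ∀ K : Finset V, PM G K → (∀ x ∉ K, ∀ y ∉ K, ¬ G.Adj x y) →
    ∀ x ∉ K, ∀ y ∉ K, x = y
  triple : ∃ x y z, x ≠ y ∧ x ≠ z ∧ y ≠ z ∧ ¬ G.Adj x y ∧ ¬ G.Adj x z ∧ ¬ G.Adj y z

/-- The vertices of `G` other than `s₁` and `s₂` are partitioned into two non-empty sets `A` and `B`
without edges between them. -/
structure Sep (G : SimpleGraph V) (A B : Finset V) (s₁ s₂ : V) : Prop where
  left_ne : A.Nonempty
  right_ne : B.Nonempty
  ne : s₁ ≠ s₂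
  disj : ∀ v ∈ A, v ∉ B
  fst_left : s₁ ∉ A
  fst_right : s₁ ∉ B
  snd_left : s₂ ∉ A
  snd_right : s₂ ∉ B
  cover : ∀ v, v ∈ A ∨ v ∈ B ∨ v = s₁ ∨ v = s₂
  not_adj : ∀ a ∈ A, ∀ b ∈ B, ¬ G.Adj a b

theorem Sep.symm {A B : Finset V} {s₁ s₂ : V} (S : Sep G A B s₁ s₂) : Sep G B A s₁ s₂ :=
  ⟨S.right_ne, S.left_ne, S.ne, fun v hB hA => S.disj v hA hB, S.fst_right, S.fst_left,
    S.snd_right, S.snd_left, fun v => by have := S.cover v; tauto,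
    fun b hb a ha h => S.not_adj a ha b hb h.symm⟩

theorem Sep.swap {A B : Finset V} {s₁ s₂ : V} (S : Sep G A B s₁ s₂) : Sep G A B s₂ s₁ :=
  ⟨S.left_ne, S.right_ne, S.ne.symm, S.disj, S.snd_left, S.snd_right, S.fst_left, S.fst_right,
    fun v => by have := S.cover v; tauto, S.not_adj⟩

variable [DecidableEq V] [Fintype V]

/-- A non-empty set `Z` whose only outside neighbours are `p` and `q`, and which together with them
does not exhaust the graph, is separated from the rest by `p` and `q`. -/
theorem Sep.of_closed {Z : Finset V} {p q : V} (hZ : Z.Nonempty) (hpq : p ≠ q) (hp : p ∉ Z)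
    (hq : q ∉ Z) (hcl : ∀ z ∈ Z, ∀ v, v ∉ Z → v ≠ p → v ≠ q → ¬ G.Adj z v)
    (hex : ∃ v, v ∉ Z ∧ v ≠ p ∧ v ≠ q) : Sep G Z (Finset.univ \ insert p (insert q Z)) p q where
  left_ne := hZ
  right_ne := by
    obtain ⟨v, hv⟩ := hex
    exact ⟨v, by simp; tauto⟩
  ne := hpq
  disj := by
    intro v hv
    simp [hv]
  fst_left := hp
  fst_right := by simp
  snd_left := hq
  snd_right := by simp
  cover := by
    intro v
    simp
    tauto
  not_adj := by
    intro a ha b hb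
    simp at hb
    exact hcl a ha b hb.2.2 hb.1 hb.2.1

theorem Sep.card_add {A B : Finset V} {s₁ s₂ : V} (S : Sep G A B s₁ s₂) :
    A.card + B.card + 2 = Fintype.card V := by
  have h1 : (insert s₁ (insert s₂ (A ∪ B))).card = A.card + B.card + 2 := by
    rw [Finset.card_insert_of_notMem, Finset.card_insert_of_notMem,
      Finset.card_union_of_disjoint (Finset.disjoint_left.2 S.disj)]
    · simp [S.snd_left, S.snd_right]
    · simp [S.fst_left, S.fst_right, S.ne]
  rw [← h1, ← Finset.card_univ]
  congr 1
  ext v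
  have := S.cover v
  simp only [Finset.mem_insert, Finset.mem_union, Finset.mem_univ, iff_true]
  tauto

namespace IsTwoConnectedECF

/-- Deleting three independent vertices leaves a graph without perfect matching. -/
theorem false_of_pm (hG : IsTwoConnectedECF G) {K : Finset V} (hK : PM G K) {a b c : V}
    (h : ∀ v, v ∉ K → v = a ∨ v = b ∨ v = c) (ha : a ∉ K) (hb : b ∉ K) (hab : a ≠ b)
    (nab : ¬ G.Adj a b) (nac : ¬ G.Adj a c) (nbc : ¬ G.Adj b c) : False := by
  refine hab (hG.eq_of_notMem K hK ?_ a ha b hb)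
  intro x hx y hy hxy
  rcases h x hx with rfl | rfl | rfl <;> rcases h y hy with rfl | rfl | rfl <;>
    first
      | exact G.irrefl hxy
      | exact nab hxy
      | exact nac hxy
      | exact nbc hxy
      | exact nab hxy.symm
      | exact nac hxy.symm
      | exact nbc hxy.symm

/-- If both sides of a separation are cliques, then three independent vertices consist of both
separating vertices and one other, or of one separating vertex and one vertex from each side. -/
theorem exists_not_adj_of_isClique (hG : IsTwoConnectedECF G) {A B : Finset V} {s₁ s₂ : V}
    (S : Sep G A B s₁ s₂) (hA : G.IsClique (A : Set V)) (hB : G.IsClique (B : Set V)) :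
    (¬ G.Adj s₁ s₂ ∧ ∃ v, (v ∈ A ∨ v ∈ B) ∧ ¬ G.Adj s₁ v ∧ ¬ G.Adj s₂ v) ∨
      ∃ a ∈ A, ∃ b ∈ B, (¬ G.Adj s₁ a ∧ ¬ G.Adj s₁ b) ∨ (¬ G.Adj s₂ a ∧ ¬ G.Adj s₂ b) := by
  by_contra! hcon
  obtain ⟨k1, k2⟩ := hcon
  obtain ⟨x, y, z, hxy, hxz, hyz, nxy, nxz, nyz⟩ := hG.triple
  have cA : ∀ v w, v ≠ w → ¬ G.Adj v w → v ∈ A → w ∉ A := fun v w h h' hv hw => h' (hA hv hw h)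
  have cB : ∀ v w, v ≠ w → ¬ G.Adj v w → v ∈ B → w ∉ B := fun v w h h' hv hw => h' (hB hv hw h)
  have c1 := S.cover x
  have c2 := S.cover y
  have c3 := S.cover z
  have nyx : ¬ G.Adj y x := fun h => nxy h.symm
  have nzx : ¬ G.Adj z x := fun h => nxz h.symm
  have nzy : ¬ G.Adj z y := fun h => nyz h.symm
  have d1 := cA x y hxy nxy
  have d2 := cA x z hxz nxz
  have d3 := cA y z hyz nyz
  have d4 := cB x y hxy nxy
  have d5 := cB x z hxz nxz
  have d6 := cB y z hyz nyz
  clear cA cB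
  grind

theorem exists_adj_fst_left (hG : IsTwoConnectedECF G) {A B : Finset V} {s₁ s₂ : V}
    (S : Sep G A B s₁ s₂) :
    ∃ a ∈ A, G.Adj s₁ a := by
  obtain ⟨a, ha⟩ := S.left_ne
  obtain ⟨x, hx, -, y, hy, hys, hxy⟩ := hG.exit A s₂
    ⟨a, ha, by rintro rfl; exact S.snd_left ha⟩ ⟨s₁, S.fst_left, S.ne⟩
  rcases S.cover y with h | h | h | h
  · exact absurd h hy
  · exact absurd hxy (S.not_adj x hx y h)
  · exact ⟨x, hx, h ▸ hxy.symm⟩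
  · exact absurd h hys

theorem exists_adj_snd_left (hG : IsTwoConnectedECF G) {A B : Finset V} {s₁ s₂ : V}
    (S : Sep G A B s₁ s₂) :
    ∃ a ∈ A, G.Adj s₂ a :=
  hG.exists_adj_fst_left S.swap

theorem exists_adj_fst_right (hG : IsTwoConnectedECF G) {A B : Finset V} {s₁ s₂ : V}
    (S : Sep G A B s₁ s₂) :
    ∃ b ∈ B, G.Adj s₁ b :=
  hG.exists_adj_fst_left S.symm

theorem exists_adj_snd_right (hG : IsTwoConnectedECF G) {A B : Finset V} {s₁ s₂ : V}
    (S : Sep G A B s₁ s₂) :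
    ∃ b ∈ B, G.Adj s₂ b :=
  hG.exists_adj_fst_left S.symm.swap

/-- By claw-freeness at `s₁`, which has a neighbour on the other side. -/
theorem adj_of_adj_fst_left (hG : IsTwoConnectedECF G) {A B : Finset V} {s₁ s₂ : V}
    (S : Sep G A B s₁ s₂) :
    ∀ x ∈ A, ∀ y ∈ A, x ≠ y → G.Adj s₁ x → G.Adj s₁ y → G.Adj x y := by
  intro x hx y hy hxy h₁ h₂
  obtain ⟨b, hb, h₃⟩ := hG.exists_adj_fst_right S
  rcases hG.claw.adj_of_adj h₁ h₂ h₃ hxy (by rintro rfl; exact S.disj _ hx hb)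
    (by rintro rfl; exact S.disj _ hy hb) with h | h | h
  · exact h
  · exact absurd h (S.not_adj x hx b hb)
  · exact absurd h (S.not_adj y hy b hb)

/-- Both sides are connected, since `s₁` cannot have neighbours in three pieces. -/
theorem connOn_left (hG : IsTwoConnectedECF G) {A B : Finset V} {s₁ s₂ : V}
    (S : Sep G A B s₁ s₂) : ConnOn G A := by
  refine ⟨S.left_ne, fun X hX hne hXA => ?_⟩
  by_contra! hcon
  have hY : (A \ X).Nonempty := by
    rw [Finset.sdiff_nonempty]
    intro h
    exact hXA (Finset.Subset.antisymm hX h)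
  have h1A := S.fst_left
  have h2A := S.snd_left
  have h1B := S.fst_right
  have h2B := S.snd_right
  have S₁ : Sep G X ((A \ X) ∪ B) s₁ s₂ := by
    refine ⟨hne, hY.inl, S.ne, ?_, ?_, ?_, ?_, ?_, ?_, ?_⟩
    · intro v hv hv'
      have := S.disj v (hX hv)
      grind
    · grind
    · grind
    · grind
    · grind
    · intro v
      have := S.cover v
      grind
    · intro a ha b hb hab
      rcases Finset.mem_union.1 hb with hb | hb
      · exact hcon a ha b (by grind) (by grind) hab
      · exact S.not_adj a (hX ha) b hb hab
  have S₂ : Sep G (A \ X) (X ∪ B) s₁ s₂ := by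
    refine ⟨hY, hne.inl, S.ne, ?_, ?_, ?_, ?_, ?_, ?_, ?_⟩
    · intro v hv hv'
      have := S.disj v (by grind)
      grind
    · grind
    · grind
    · grind
    · grind
    · intro v
      have := S.cover v
      grind
    · intro a ha b hb hab
      rcases Finset.mem_union.1 hb with hb | hb
      · exact hcon b hb a (by grind) (by grind) hab.symm
      · exact S.not_adj a (by grind) b hb hab
  obtain ⟨a, ha, h₁⟩ := hG.exists_adj_fst_left S₁
  obtain ⟨b, hb, h₂⟩ := hG.exists_adj_fst_left S₂
  exact hcon a ha b (by grind) (by grind)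
    (hG.adj_of_adj_fst_left S a (hX ha) b (by grind) (by grind) h₁ h₂)

theorem pm_left (hG : IsTwoConnectedECF G) {A B : Finset V} {s₁ s₂ : V}
    (S : Sep G A B s₁ s₂) (h : Even A.card) : PM G A :=
  (hG.connOn_left S).pm hG.claw h

/-- An odd side of a separation has a vertex whose deletion leaves it perfectly matched. -/
theorem exists_pm_erase_right (hG : IsTwoConnectedECF G) {A B : Finset V} {s₁ s₂ : V}
    (S : Sep G A B s₁ s₂)
    (hB : Odd B.card) : ∃ b ∈ B, PM G (B.erase b) := by
  by_cases h1 : B.card = 1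
  · obtain ⟨b, rfl⟩ := Finset.card_eq_one.1 h1
    exact ⟨b, by simp, by simpa using PM.empty⟩
  · have hpos := S.right_ne.card_pos
    obtain ⟨b, hb, -, hc⟩ := (hG.connOn_left S.symm).exists_erase_ne (by omega) s₁
    refine ⟨b, hb, hc.pm hG.claw ?_⟩
    have := Finset.card_erase_add_one hb
    grind

/-- If a matching covers `s₁` and all of `A` but a non-neighbour `a` of `s₂`, then every vertex `b`
for which `B` without `b` is perfectly matched must be adjacent to `s₂`, as otherwise `s₂`, `a`, `b`
are left uncovered. Since the neighbours of `s₂` in `B` form a clique, and a connected graph that is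
not a clique has two non-adjacent vertices that are not cut vertices, `B` is a clique. -/
theorem full_of_pm (hG : IsTwoConnectedECF G) {A B : Finset V} {s₁ s₂ a : V}
    (S : Sep G A B s₁ s₂) (hB : Odd B.card)
    (ha : a ∈ A) (hna : ¬ G.Adj s₂ a) (hPM : PM G (insert s₁ (A.erase a))) :
    G.IsClique (B : Set V) ∧ ∀ b ∈ B, G.Adj s₂ b := by
  have key : ∀ b ∈ B, PM G (B.erase b) → G.Adj s₂ b := by
    intro b hb hb'
    by_contra hnb
    have h1A := S.fst_left
    have h2A := S.snd_left
    have h1B := S.fst_right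
    have h2B := S.snd_right
    have hne := S.ne
    have haB := S.disj a ha
    have hbA : b ∉ A := fun h => S.disj b h hb
    have hd : Disjoint (insert s₁ (A.erase a)) (B.erase b) := by
      rw [Finset.disjoint_left]
      intro v hv hv'
      have := S.disj v
      grind
    refine hG.false_of_pm (hPM.union hb' hd) (a := s₂) (b := a) (c := b) ?_ ?_ ?_ ?_ hna hnb
      (S.not_adj a ha b hb)
    · intro v hv
      have := S.cover v
      grind
    · grind
    · grind
    · grind
  have key2 : ∀ b ∈ B, ConnOn G (B.erase b) → G.Adj s₂ b := by
    intro b hb hc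
    refine key b hb (hc.pm hG.claw ?_)
    have := Finset.card_erase_add_one hb
    grind
  have hcl : G.IsClique (B : Set V) := by
    by_contra hcl
    obtain ⟨x, hx, y, hy, hxy, hnadj, hcx, hcy⟩ :=
      (hG.connOn_left S.symm).exists_not_adj_erase hcl
    exact hnadj (hG.adj_of_adj_fst_left S.symm.swap x hx y hy hxy (key2 x hx hcx) (key2 y hy hcy))
  refine ⟨hcl, fun b hb => key b hb (PM.of_isClique hG.claw (hcl.subset ?_) ?_)⟩
  · exact_mod_cast Finset.erase_subset b B
  · have := Finset.card_erase_add_one hb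
    grind

/-- The behaviour of `s₂` when the even side is a clique: it is complete to `A`, or it is complete
to the clique `B`, or `A` splits into a single neighbour of `s₁` and the neighbours of `s₂`. -/
theorem full_or_full_or_split (hG : IsTwoConnectedECF G) {A B : Finset V} {s₁ s₂ : V}
    (S : Sep G A B s₁ s₂)
    (hA : Even A.card) (hB : Odd B.card) (hAc : G.IsClique (A : Set V)) :
    (∀ a ∈ A, G.Adj s₂ a) ∨ (G.IsClique (B : Set V) ∧ ∀ b ∈ B, G.Adj s₂ b) ∨
      ∃ a ∈ A, G.Adj s₁ a ∧ ¬ G.Adj s₂ a ∧ ∀ x ∈ A, x ≠ a → ¬ G.Adj s₁ x ∧ G.Adj s₂ x := by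
  have key : ∀ a ∈ A, ¬ G.Adj s₂ a → (∃ x ∈ A, x ≠ a ∧ G.Adj s₁ x) →
      G.IsClique (B : Set V) ∧ ∀ b ∈ B, G.Adj s₂ b := by
    rintro a ha hna ⟨x, hx, hxa, hsx⟩
    refine hG.full_of_pm S hB ha hna ?_
    have hsub : (((A.erase a).erase x : Finset V) : Set V) ⊆ A := by
      intro v hv
      exact Finset.mem_of_mem_erase (Finset.mem_of_mem_erase hv)
    have h1 : PM G ((A.erase a).erase x) := by
      refine PM.of_isClique hG.claw (hAc.subset hsub) ?_
      have e1 := Finset.card_erase_add_one ha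
      have e2 := Finset.card_erase_add_one (Finset.mem_erase.2 ⟨hxa, hx⟩)
      grind
    have h2 := h1.insert_edge (x := s₁) (y := x) (by simp [S.fst_left]) (by simp) hsx
    rwa [Finset.insert_erase (Finset.mem_erase.2 ⟨hxa, hx⟩)] at h2
  by_cases h1 : ∀ a ∈ A, G.Adj s₂ a
  · exact Or.inl h1
  right
  push Not at h1
  obtain ⟨a, ha, hna⟩ := h1
  by_cases h2 : ∃ x ∈ A, x ≠ a ∧ G.Adj s₁ x
  · exact Or.inl (key a ha hna h2)
  have hsa : G.Adj s₁ a := by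
    obtain ⟨x, hx, hsx⟩ := hG.exists_adj_fst_left S
    by_cases hxa : x = a
    · rwa [← hxa]
    · exact absurd ⟨x, hx, hxa, hsx⟩ h2
  by_cases h3 : ∃ x ∈ A, x ≠ a ∧ ¬ G.Adj s₂ x
  · obtain ⟨x, hx, hxa, hnx⟩ := h3
    exact Or.inl (key x hx hnx ⟨a, ha, hxa.symm, hsa⟩)
  · push Not at h2 h3
    exact Or.inr ⟨a, ha, hsa, hna, fun x hx hxa => ⟨h2 x hx hxa, h3 x hx hxa⟩⟩

/-- If a matching covers `s₁`, `s₂` and all of `B` but one vertex, then every matching inside `A`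
extends to a perfect matching of `A`. -/
theorem left_isClique_or_inducesFourCycle (hG : IsTwoConnectedECF G) {A B : Finset V}
    {s₁ s₂ x : V} (S : Sep G A B s₁ s₂) (hx : x ∈ B)
    (hPM : PM G (insert s₁ (insert s₂ (B.erase x)))) :
    G.IsClique (A : Set V) ∨ ∃ p t z w, InducesFourCycle G A p t z w := by
  refine (hG.connOn_left S).isClique_or_inducesFourCycle hG.claw fun K hKA hK hind => ?_
  have h1A := S.fst_left
  have h2A := S.snd_left
  have h1B := S.fst_right
  have h2B := S.snd_right
  have hxA : x ∉ A := fun h => S.disj x h hx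
  have hd : Disjoint K (insert s₁ (insert s₂ (B.erase x))) := by
    rw [Finset.disjoint_left]
    intro v hv hv'
    have := S.disj v
    grind
  have hout : ∀ v, v ∉ K ∪ insert s₁ (insert s₂ (B.erase x)) → v ∈ A \ K ∨ v = x := by
    intro v hv
    have := S.cover v
    grind
  by_contra hKA'
  obtain ⟨a, ha, haK⟩ : ∃ a ∈ A, a ∉ K := by
    by_contra! hcon
    exact hKA' (Finset.Subset.antisymm hKA hcon)
  have haB := S.disj a ha
  have hax : a = x := by
    refine hG.eq_of_notMem _ (hK.union hPM hd) ?_ a (by grind) x (by grind)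
    intro v hv w hw hvw
    rcases hout v hv with hv | rfl <;> rcases hout w hw with hw | rfl
    · exact hind v hv w hw hvw
    · exact S.not_adj v (by grind) _ hx hvw
    · exact S.not_adj w (by grind) _ hx hvw.symm
    · exact G.irrefl hvw
  exact hxA (hax ▸ ha)

/-- If the odd side has at least three vertices, then together with `s₁` and `s₂` it is perfectly
matched up to one of its vertices. -/
theorem exists_pm_insert_insert_erase (hG : IsTwoConnectedECF G) {A B : Finset V} {s₁ s₂ : V}
    (S : Sep G A B s₁ s₂)
    (hB : Odd B.card) (h3 : 3 ≤ B.card) :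
    ∃ x ∈ B, PM G (insert s₁ (insert s₂ (B.erase x))) := by
  have hc := hG.connOn_left S.symm
  have h1B := S.fst_right
  have h2B := S.snd_right
  have hne := S.ne
  have key : ∀ b ∈ B, ConnOn G (B.erase b) → (∃ x ∈ B, x ≠ b ∧ G.Adj s₁ x) →
      (∃ x ∈ B, x ≠ b ∧ G.Adj s₂ x) → ∃ x ∈ B, PM G (insert s₁ (insert s₂ (B.erase x))) := by
    rintro b hb hcb ⟨x, hx, hxb, hsx⟩ ⟨y, hy, hyb, hsy⟩
    refine ⟨b, hb, ConnOn.pm hG.claw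
      ((hcb.insert_of_adj (u := y) (v := s₂) ?_ hsy.symm).insert_of_adj
        (u := x) (v := s₁) ?_ hsx.symm) ?_⟩
    · grind
    · grind
    · have := Finset.card_erase_add_one hb
      rw [Finset.card_insert_of_notMem (by grind), Finset.card_insert_of_notMem (by grind)]
      grind
  -- If `b` is the only neighbour of `s` in `B` and is not a cut vertex of `B`, match `b` with `s`,
  -- and match the rest after deleting a further vertex that is not a neighbour of the other `s'`.
  have key2 : ∀ s s' b c, s ∉ B → s' ∉ B → s ≠ s' → b ∈ B → ConnOn G (B.erase b) → G.Adj s b →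
      c ∈ B → c ≠ b → G.Adj s' c → ∃ x ∈ B, PM G (insert s (insert s' (B.erase x))) := by
    intro s s' b c hsB hs'B hss hb hcb hsb hc hcb' hs'c
    have e1 := Finset.card_erase_add_one hb
    obtain ⟨x, hx, hxc, hcx⟩ := hcb.exists_erase_ne (by omega) c
    have e2 := Finset.card_erase_add_one hx
    have h1 := (hcx.insert_of_adj (u := c) (v := s') (by grind) hs'c.symm).pm hG.claw (by
      rw [Finset.card_insert_of_notMem (by grind)]
      grind)
    refine ⟨x, by grind, ?_⟩
    convert h1.insert_edge (x := s) (y := b) (by grind) (by grind) hsb using 1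
    grind
  obtain ⟨b, hb, -, hcb⟩ := hc.exists_erase_ne (by omega) s₁
  by_cases k1 : ∃ x ∈ B, x ≠ b ∧ G.Adj s₁ x
  · by_cases k2 : ∃ x ∈ B, x ≠ b ∧ G.Adj s₂ x
    · exact key b hb hcb k1 k2
    · obtain ⟨y, hy, hsy⟩ := hG.exists_adj_snd_right S
      have hyb : y = b := by
        by_contra hyb
        exact k2 ⟨y, hy, hyb, hsy⟩
      subst hyb
      obtain ⟨x, hx, hxb, hsx⟩ := k1
      obtain ⟨z, hz, hP⟩ := key2 s₂ s₁ y x h2B h1B hne.symm hb hcb hsy hx hxb hsx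
      exact ⟨z, hz, by rwa [Finset.insert_comm]⟩
  · obtain ⟨y, hy, hsy⟩ := hG.exists_adj_fst_right S
    have hyb : y = b := by
      by_contra hyb
      exact k1 ⟨y, hy, hyb, hsy⟩
    subst hyb
    by_cases k2 : ∃ x ∈ B, x ≠ y ∧ G.Adj s₂ x
    · obtain ⟨x, hx, hxb, hsx⟩ := k2
      exact key2 s₁ s₂ y x h1B h2B hne hb hcb hsy hx hxb hsx
    · -- Now `y` separates the rest of `B` from everything else.
      exfalso
      push Not at k1 k2
      obtain ⟨u, hu, huy⟩ : ∃ u ∈ B, u ≠ y := by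
        by_contra! hcon
        have : B ⊆ {y} := fun v hv => by simpa using hcon v hv
        have := Finset.card_le_card this
        simp at this
        omega
      obtain ⟨p, hp, hpy, q, hq, hqy, hpq⟩ := hG.exit B y ⟨u, hu, huy⟩
        ⟨s₁, h1B, by rintro rfl; exact h1B hb⟩
      rcases S.cover q with h | h | h | h
      · exact S.not_adj q h p hp hpq.symm
      · exact hq h
      · exact k1 p hp hpy (h ▸ hpq.symm)
      · exact k2 p hp hpy (h ▸ hpq.symm)

/-- If one side of a separation induces a 4-cycle and the other side is odd, then both separating
vertices are adjacent to the same two consecutive vertices of the cycle: otherwise they can be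
matched to two opposite vertices of the cycle, and the other two are left uncovered together with a
vertex of `B`. So the separating vertices are adjacent, and two opposite vertices of the cycle
separate a third one from the rest of the graph. -/
theorem adj_and_exists_sep_of_inducesFourCycle (hG : IsTwoConnectedECF G) {A B : Finset V}
    {s₁ s₂ : V} (S : Sep G A B s₁ s₂)
    (hB : Odd B.card) {p t z w : V} (h : InducesFourCycle G A p t z w) :
    G.Adj s₁ s₂ ∧ ∃ A' B' q₁ q₂, Sep G A' B' q₁ q₂ ∧ ¬ G.Adj q₁ q₂ := by
  obtain ⟨b, hb, hbPM⟩ := hG.exists_pm_erase_right S hB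
  have key : ∀ x t z w, InducesFourCycle G A x t z w → G.Adj s₁ x → ¬ G.Adj s₂ z := by
    intro x t z w h hsx hsz
    have hx : x ∈ A := by simp [h.eq]
    have ht : t ∈ A := by simp [h.eq]
    have hz : z ∈ A := by simp [h.eq]
    have hw : w ∈ A := by simp [h.eq]
    have hA : ∀ v ∈ A, v = x ∨ v = t ∨ v = z ∨ v = w := by
      intro v hv
      simpa [h.eq] using hv
    have hP : PM G ({s₁, x} ∪ {s₂, z}) := by
      refine (PM.pair hsx).union (PM.pair hsz) (Finset.disjoint_left.2 ?_)
      have := S.ne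
      have := h.xz_ne
      have := S.fst_left
      have := S.snd_left
      grind
    have hd : Disjoint ({s₁, x} ∪ {s₂, z}) (B.erase b) := by
      rw [Finset.disjoint_left]
      have := S.fst_right
      have := S.snd_right
      have := S.disj x hx
      have := S.disj z hz
      grind
    have htB := S.disj t ht
    have hwB := S.disj w hw
    have hts₁ : t ≠ s₁ := by rintro rfl; exact S.fst_left ht
    have hts₂ : t ≠ s₂ := by rintro rfl; exact S.snd_left ht
    have hws₁ : w ≠ s₁ := by rintro rfl; exact S.fst_left hw
    have hws₂ : w ≠ s₂ := by rintro rfl; exact S.snd_left hw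
    have e1 := h.xt.ne
    have e2 := h.tz.ne
    have e3 := h.zw.ne
    have e4 := h.wx.ne
    refine hG.false_of_pm (hP.union hbPM hd) (a := t) (b := w) (c := b) ?_ ?_ ?_ h.tw_ne h.tw
      (S.not_adj t ht b hb) (S.not_adj w hw b hb)
    · intro v hv
      have c1 := S.cover v
      have c2 := hA v
      grind
    · simp [hts₁, hts₂, e1.symm, e2, htB]
    · simp [hws₁, hws₂, e3.symm, e4, hwB]
  obtain ⟨a, ha, hsa⟩ := hG.exists_adj_fst_left S
  obtain ⟨x, t, z, w, h, hsx, hst⟩ := h.exists_adj_adj hG.claw S.fst_left ha hsa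
  obtain ⟨a', ha', hsa'⟩ := hG.exists_adj_snd_left S
  obtain ⟨x', t', z', w', h', hsx', hst'⟩ := h.exists_adj_adj hG.claw S.snd_left ha' hsa'
  have hx : x ∈ A := by simp [h.eq]
  have ht : t ∈ A := by simp [h.eq]
  have hz : z ∈ A := by simp [h.eq]
  have hw : w ∈ A := by simp [h.eq]
  have hx' : x' ∈ A := by simp [h'.eq]
  have ht' : t' ∈ A := by simp [h'.eq]
  have h1 := h.xt.ne
  have h2 := h.tz.ne
  have h3 := h.zw.ne
  have h4 := h.wx.ne
  have h5 := h.xz_ne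
  have h6 := h.tw_ne
  have n1 : ¬ G.Adj s₂ z := key x t z w h hsx
  have n2 : ¬ G.Adj s₂ w := key t z w x h.rotate hst
  have n3 : ¬ G.Adj s₁ z := fun hsz => h.xz (hG.adj_of_adj_fst_left S x hx z hz h5 hsx hsz)
  have n4 : ¬ G.Adj s₁ w := fun hsw => h.tw (hG.adj_of_adj_fst_left S t ht w hw h6 hst hsw)
  have hx't' := h'.xt.ne
  have hmem : ∀ v ∈ A, v = x ∨ v = t ∨ v = z ∨ v = w := by
    intro v hv
    simpa [h.eq] using hv
  have hs₂x : G.Adj s₂ x := by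
    rcases hmem x' hx' with e | e | e | e
    · rwa [← e]
    · rcases hmem t' ht' with e' | e' | e' | e'
      · rwa [← e']
      · exact absurd (e.trans e'.symm) hx't'
      · exact absurd (e' ▸ hst') n1
      · exact absurd (e' ▸ hst') n2
    · exact absurd (e ▸ hsx') n1
    · exact absurd (e ▸ hsx') n2
  have hxw_B : w ∉ B := S.disj w hw
  have hws₁ : w ≠ s₁ := by rintro rfl; exact S.fst_left hw
  have hws₂ : w ≠ s₂ := by rintro rfl; exact S.snd_left hw
  have hs : G.Adj s₁ s₂ := by
    rcases hG.claw.adj_of_adj h.wx.symm hsx.symm hs₂x.symm hws₁ hws₂ S.ne with e | e | e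
    · exact absurd e.symm n4
    · exact absurd e.symm n2
    · exact e
  refine ⟨hs, {w}, _, x, z, Sep.of_closed (by simp) h5 (by simpa using h4.symm) (by simpa using h3)
    ?_ ⟨t, by simpa using h6, h1.symm, h2⟩, h.xz⟩
  intro u hu v _ hvx hvz hwv
  rw [Finset.mem_singleton.1 hu] at hwv
  rcases S.cover v with e | e | e | e
  · rcases hmem v e with e | e | e | e
    · exact hvx e
    · exact h.tw (e ▸ hwv.symm)
    · exact hvz e
    · exact G.irrefl (e ▸ hwv)
  · exact S.not_adj w hw v e hwv
  · exact n4 (e ▸ hwv.symm)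
  · exact n2 (e ▸ hwv.symm)

/-- For an independent separating pair with an odd side of at least three vertices, the other side
is a clique. -/
theorem left_isClique (hG : IsTwoConnectedECF G) {A B : Finset V} {s₁ s₂ : V}
    (S : Sep G A B s₁ s₂) (hs : ¬ G.Adj s₁ s₂)
    (hB : Odd B.card) (h3 : 3 ≤ B.card) : G.IsClique (A : Set V) := by
  obtain ⟨x, hx, hPM⟩ := hG.exists_pm_insert_insert_erase S hB h3
  rcases hG.left_isClique_or_inducesFourCycle S hx hPM with h | ⟨p, t, z, w, h⟩
  · exact h
  · exact absurd (hG.adj_and_exists_sep_of_inducesFourCycle S hB h).1 hs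

end IsTwoConnectedECF

end

section

/-! ### Recognising the families -/

/-- Connectedness of an induced subgraph in terms of cuts. -/
theorem preconnected_induce_iff {V : Type*} {G : SimpleGraph V} {W : Set V} :
    (G.induce W).Preconnected ↔
      ∀ X ⊆ W, X.Nonempty → X ≠ W → ∃ x ∈ X, ∃ y ∈ W, y ∉ X ∧ G.Adj x y := by
  constructor
  · rintro h X hXW ⟨x, hx⟩ hne
    by_contra! hcon
    obtain ⟨y, hy, hyX⟩ : ∃ y ∈ W, y ∉ X := by
      by_contra! hcon'
      exact hne (Set.Subset.antisymm hXW hcon')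
    obtain ⟨p⟩ := h ⟨x, hXW hx⟩ ⟨y, hy⟩
    have key : ∀ u v : W, (G.induce W).Walk u v → (u : V) ∈ X → (v : V) ∈ X := by
      intro u v p
      induction p with
      | nil => exact id
      | @cons u v w huv _ ih =>
        intro hu
        refine ih ?_
        by_contra hv
        exact hcon u hu v v.2 hv huv
    exact hyX (key _ _ p hx)
  · intro h u v
    by_contra hcon
    obtain ⟨x, ⟨hxW, hx⟩, y, hy, hyX, hxy⟩ := h {x | ∃ hx : x ∈ W, (G.induce W).Reachable u ⟨x, hx⟩}
      (fun x hx => hx.1) ⟨u, u.2, SimpleGraph.Reachable.refl _⟩ (by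
        intro heq
        have hv : (v : V) ∈ {x | ∃ hx : x ∈ W, (G.induce W).Reachable u ⟨x, hx⟩} := by
          rw [heq]
          exact v.2
        exact hcon hv.2)
    refine hyX ⟨hy, hx.trans ?_⟩
    exact SimpleGraph.Adj.reachable (by simpa using hxy)

theorem nonempty_induce_iso {V W : Type*} {G : SimpleGraph V} {H : SimpleGraph W} (f : W → V)
    (hf : Function.Injective f) (hadj : ∀ i j, G.Adj (f i) (f j) ↔ H.Adj i j) {U : Set V}
    (hU : Set.range f = U) : Nonempty (G.induce U ≃g H) := by
  subst hU
  exact ⟨SimpleGraph.Iso.symm ⟨Equiv.ofInjective f hf, fun {i j} => hadj i j⟩⟩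

variable {V : Type*} {G : SimpleGraph V}

theorem nonempty_iso_cycleGraph_seven {f : Fin 7 → V} (hf : Function.Bijective f)
    (hadj : ∀ i, G.Adj (f i) (f (i + 1))) (h2 : ∀ i, ¬ G.Adj (f i) (f (i + 2)))
    (h3 : ∀ i, ¬ G.Adj (f i) (f (i + 3))) : Nonempty (G ≃g SimpleGraph.cycleGraph 7) := by
  refine ⟨SimpleGraph.Iso.symm ⟨Equiv.ofBijective f hf, fun {i j} => ?_⟩⟩
  change G.Adj (f i) (f j) ↔ _
  have key : ∀ i j : Fin 7, j = i ∨ j = i + 1 ∨ i = j + 1 ∨ j = i + 2 ∨ i = j + 2 ∨ j = i + 3 ∨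
      i = j + 3 := by decide
  have hc : ∀ i j : Fin 7, (SimpleGraph.cycleGraph 7).Adj i j ↔ (j = i + 1 ∨ i = j + 1) := by
    decide
  have e2 : ∀ i : Fin 7, ¬ (SimpleGraph.cycleGraph 7).Adj i (i + 2) := by decide
  have e3 : ∀ i : Fin 7, ¬ (SimpleGraph.cycleGraph 7).Adj i (i + 3) := by decide
  rcases key i j with rfl | rfl | rfl | rfl | rfl | rfl | rfl
  · simp
  · exact iff_of_true (hadj i) ((hc _ _).2 (Or.inl rfl))
  · exact iff_of_true (hadj j).symm ((hc _ _).2 (Or.inr rfl))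
  · exact iff_of_false (h2 i) (e2 i)
  · exact iff_of_false (fun h => h2 j h.symm) (fun h => e2 j h.symm)
  · exact iff_of_false (h3 i) (e3 i)
  · exact iff_of_false (fun h => h3 j h.symm) (fun h => e3 j h.symm)

theorem ConnOn.connected_induce {U : Finset V} (h : ConnOn G U) :
    (G.induce (U : Set V)).Connected := by
  classical
  have : Nonempty (U : Set V) := ⟨⟨h.1.choose, h.1.choose_spec⟩⟩
  refine ⟨preconnected_induce_iff.2 fun X hX hne hXU => ?_⟩
  have hfin : X.Finite := U.finite_toSet.subset hX
  lift X to Finset V using hfin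
  obtain ⟨x, hx, y, hy, hyX, hxy⟩ := h.2 X (by exact_mod_cast hX) (by exact_mod_cast hne)
    (by exact_mod_cast hXU)
  exact ⟨x, hx, y, hy, hyX, hxy⟩

theorem Sep.isCutSet {A B : Finset V} {s₁ s₂ : V} (S : Sep G A B s₁ s₂) :
    IsCutSet G {s₁, s₂} := by
  intro h
  obtain ⟨b, hb⟩ := S.right_ne
  obtain ⟨x, hx, y, hy, hyX, hxy⟩ := preconnected_induce_iff.1 h (A : Set V) (by
      intro v hv hv'
      rcases hv' with rfl | rfl
      · exact S.fst_left hv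
      · exact S.snd_left hv)
    (by exact_mod_cast S.left_ne) (by
      intro heq
      have : b ∈ (A : Set V) := by
        rw [heq]
        rintro (rfl | rfl)
        · exact S.fst_right hb
        · exact S.snd_right hb
      exact S.disj b this hb)
  have hyB : y ∈ B := by
    rcases S.cover y with h | h | h | h
    · exact absurd h hyX
    · exact h
    · exact absurd (Or.inl h) hy
    · exact absurd (Or.inr h) hy
  exact S.not_adj x hx y hyB hxy

variable [DecidableEq V] [Fintype V]

namespace IsTwoConnectedECF

theorem not_isCutSet_of_subset_singleton (hG : IsTwoConnectedECF G) {T : Set V} {s : V}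
    (hT : T ⊆ {s}) : ¬ IsCutSet G T := by
  classical
  intro h
  refine h (preconnected_induce_iff.2 fun X hX hne hXT => ?_)
  by_contra! hcon
  obtain ⟨x, hx⟩ := hne
  obtain ⟨y, hy, hyX⟩ : ∃ y ∈ Tᶜ, y ∉ X := by
    by_contra! hcon'
    exact hXT (Set.Subset.antisymm hX hcon')
  obtain ⟨r, hr, hrx, hry⟩ : ∃ r, (∀ v ∈ T, v = r) ∧ x ≠ r ∧ y ≠ r := by
    rcases Set.subset_singleton_iff_eq.1 hT with rfl | rfl
    · obtain ⟨p, q, r, h1, h2, h3, -⟩ := hG.triple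
      have : ∃ r, x ≠ r ∧ y ≠ r := by
        by_contra! hcon'
        have c1 := hcon' p
        have c2 := hcon' q
        have c3 := hcon' r
        clear hcon' hcon
        by_cases hp : x = p <;> by_cases hq : x = q <;> simp_all
      obtain ⟨r, hr⟩ := this
      exact ⟨r, by simp, hr⟩
    · exact ⟨s, by simp, fun h => hX hx h, fun h => hy h⟩
  obtain ⟨a, ha, har, b, hb, hbr, hab⟩ := hG.exit (Finset.univ.filter (· ∈ X)) r
    ⟨x, by simpa using hx, hrx⟩ ⟨y, by simpa using hyX, hry⟩
  exact hcon a (by simpa using ha) b (fun h => hbr (hr b h)) (by simpa using hb) hab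

theorem isIndepTwoCut (hG : IsTwoConnectedECF G) {A B : Finset V} {s₁ s₂ : V}
    (S : Sep G A B s₁ s₂) (hs : ¬ G.Adj s₁ s₂) (hA : Even A.card) (hB : Odd B.card) :
    IsIndepTwoCut G s₁ s₂ (A : Set V) (B : Set V) where
  ne := S.ne
  not_adj := hs
  minimal_cut := by
    refine ⟨S.isCutSet, fun T hT hTS => ?_⟩
    rintro v (rfl | rfl)
    · by_contra hv
      refine hG.not_isCutSet_of_subset_singleton (s := s₂) ?_ hT
      intro w hw
      rcases hTS hw with rfl | h
      · exact absurd hw hv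
      · exact h
    · by_contra hv
      refine hG.not_isCutSet_of_subset_singleton (s := s₁) ?_ hT
      intro w hw
      rcases hTS hw with h | rfl
      · exact h
      · exact absurd hw hv
  disj := by
    rw [Set.disjoint_left]
    exact S.disj
  union_eq := by
    ext v
    have h1 := S.cover v
    have h2 := S.fst_left
    have h3 := S.fst_right
    have h4 := S.snd_left
    have h5 := S.snd_right
    simp only [Set.mem_union, Finset.mem_coe, Set.mem_compl_iff, Set.mem_insert_iff,
      Set.mem_singleton_iff]
    grind
  connected_left := (hG.connOn_left S).connected_induce
  connected_right := (hG.connOn_left S.symm).connected_induce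
  no_edge := S.not_adj
  even_left := by rwa [Set.ncard_coe_finset]
  odd_right := by rwa [Set.ncard_coe_finset]

/-- Since there are three independent vertices, some vertex of `A` is adjacent to neither `s₁` nor
`s₂`; by claw-freeness the neighbourhoods of `s₁` and `s₂` in `A` are then disjoint. -/
theorem memG22_of_full (hG : IsTwoConnectedECF G) {A B : Finset V} {s₁ s₂ : V}
    (S : Sep G A B s₁ s₂) (hs : ¬ G.Adj s₁ s₂) (hA : Even A.card) (hB : Odd B.card)
    (hAc : G.IsClique (A : Set V)) (hBc : G.IsClique (B : Set V)) (h₁ : ∀ b ∈ B, G.Adj s₁ b)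
    (h₂ : ∀ b ∈ B, G.Adj s₂ b) : MemG22 G := by
  obtain ⟨a, ha, ha₁, ha₂⟩ : ∃ a ∈ A, ¬ G.Adj s₁ a ∧ ¬ G.Adj s₂ a := by
    rcases hG.exists_not_adj_of_isClique S hAc hBc with ⟨-, v, hv | hv, h⟩ | ⟨a, -, b, hb, h⟩
    · exact ⟨v, hv, h⟩
    · exact absurd (h₁ v hv) h.1
    · rcases h with h | h
      · exact absurd (h₁ b hb) h.2
      · exact absurd (h₂ b hb) h.2
  have hpos := S.left_ne.card_pos
  obtain ⟨p, hp⟩ := hA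
  obtain ⟨q, hq⟩ := hB
  refine ⟨s₁, s₂, A, B, hG.isIndepTwoCut S hs ⟨p, hp⟩ ⟨q, hq⟩, ⟨p, by omega, hAc, ?_⟩,
    ⟨q, hBc, ?_⟩, ?_, ?_, ?_, ?_⟩
  · rw [Set.ncard_coe_finset]
    omega
  · rw [Set.ncard_coe_finset]
    omega
  · exact Set.inter_eq_right.2 fun b hb => h₁ b hb
  · exact Set.inter_eq_right.2 fun b hb => h₂ b hb
  · refine (Set.ssubset_iff_of_subset
      (Set.union_subset Set.inter_subset_right Set.inter_subset_right)).2 ⟨a, ha, ?_⟩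
    rintro (h | h)
    · exact ha₁ h.1
    · exact ha₂ h.1
  · refine Set.eq_empty_iff_forall_notMem.2 fun x hx => ?_
    have hx₁ : G.Adj s₁ x := hx.1.1
    have hx₂ : G.Adj s₂ x := hx.2.1
    have hxA : x ∈ A := hx.1.2
    have hxa : x ≠ a := by
      rintro rfl
      exact ha₁ hx₁
    rcases hG.claw.adj_of_adj hx₁.symm hx₂.symm (hAc hxA ha hxa) S.ne
      (by rintro rfl; exact S.fst_left ha) (by rintro rfl; exact S.snd_left ha) with h | h | h
    · exact hs h
    · exact ha₁ h
    · exact ha₂ h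

/-- The even side is an edge `a₁a₂` completing `s₁` and `s₂` to an induced path `s₁a₁a₂s₂`. -/
theorem memG23_of_path (hG : IsTwoConnectedECF G) {B : Finset V} {s₁ s₂ a₁ a₂ : V}
    (S : Sep G {a₁, a₂} B s₁ s₂) (hs : ¬ G.Adj s₁ s₂) (ha : G.Adj a₁ a₂) (h₁₁ : G.Adj s₁ a₁)
    (h₂₂ : G.Adj s₂ a₂) (h₁₂ : ¬ G.Adj s₁ a₂) (h₂₁ : ¬ G.Adj s₂ a₁) (hB : Odd B.card)
    (h3 : 3 ≤ B.card) (hBc : G.IsClique (B : Set V)) (hcov : ∀ b ∈ B, G.Adj s₁ b ∨ G.Adj s₂ b)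
    (h₁ : ∃ b ∈ B, ¬ G.Adj s₁ b) (h₂ : ∃ b ∈ B, ¬ G.Adj s₂ b) : MemG23 G := by
  have hcard : ({a₁, a₂} : Finset V).card = 2 := Finset.card_pair ha.ne
  obtain ⟨q, hq⟩ := hB
  have n1 := h₁₁.ne
  have n2 := h₂₂.ne
  have n3 := ha.ne
  have n4 := S.ne
  have n5 : s₁ ≠ a₂ := by rintro rfl; exact S.fst_left (by simp)
  have n6 : s₂ ≠ a₁ := by rintro rfl; exact S.snd_left (by simp)
  refine ⟨s₁, s₂, (({a₁, a₂} : Finset V) : Set V), B,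
    hG.isIndepTwoCut S hs (by rw [hcard]; exact even_two) ⟨q, hq⟩, ⟨?_, ?_⟩, ?_,
    ⟨q, by omega, hBc, ?_⟩, ?_, ?_, ?_⟩
  · intro x hx y hy hxy
    simp only [Finset.coe_insert, Finset.coe_singleton, Set.mem_insert_iff,
      Set.mem_singleton_iff] at hx hy
    rcases hx with rfl | rfl <;> rcases hy with rfl | rfl
    · exact absurd rfl hxy
    · exact ha
    · exact ha.symm
    · exact absurd rfl hxy
  · rw [Set.ncard_coe_finset, hcard]
  · refine nonempty_induce_iso ![s₁, a₁, a₂, s₂] ?_ ?_ ?_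
    · intro i j hij
      fin_cases i <;> fin_cases j <;> simp_all
    · intro i j
      rw [SimpleGraph.pathGraph_adj]
      fin_cases i <;> fin_cases j <;> simp [*, h₁₁.symm, h₂₂.symm, ha.symm, G.adj_comm]
    · ext v
      simp
      tauto
  · rw [Set.ncard_coe_finset]
    omega
  · refine Set.Subset.antisymm
      (Set.union_subset Set.inter_subset_right Set.inter_subset_right) fun b hb => ?_
    rcases hcov b hb with h | h
    · exact Or.inl ⟨h, hb⟩
    · exact Or.inr ⟨h, hb⟩
  · obtain ⟨b, hb, hb'⟩ := h₁
    intro heq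
    exact hb' (Set.inter_eq_right.1 heq hb)
  · obtain ⟨b, hb, hb'⟩ := h₂
    intro heq
    exact hb' (Set.inter_eq_right.1 heq hb)

end IsTwoConnectedECF

end

section

variable {V : Type*} [DecidableEq V] {G : SimpleGraph V} [Fintype V]

namespace IsTwoConnectedECF

/-! ### Independent pairs whose odd side has at least three vertices -/

/-- One half of the structure described in `exists_path_of_not_adj`: if `d` is a non-neighbour of
both separating vertices and `B` without `d` falls apart into `X` and `Y`, where `s₁` has a
neighbour in `X`, then `X` and `Y` are single vertices. Indeed `s₁, d` and `s₂, d` are independent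
separating pairs, and the sides opposite to `X` and `Y` are not cliques. -/
theorem exists_path_of_split (hG : IsTwoConnectedECF G) {A B X Y : Finset V} {s₁ s₂ d : V}
    (S : Sep G A B s₁ s₂) (hs : ¬ G.Adj s₁ s₂) (hA : Even A.card) (hB : Odd B.card) (hd : d ∈ B)
    (hd₁ : ¬ G.Adj s₁ d) (hd₂ : ¬ G.Adj s₂ d) (hX : X.Nonempty) (hY : Y.Nonempty)
    (hXY : X ∪ Y = B.erase d) (hdisj : Disjoint X Y) (hno : ∀ x ∈ X, ∀ y ∈ Y, ¬ G.Adj x y)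
    (hsX : ∃ x ∈ X, G.Adj s₁ x) :
    ∃ c₁ c₂, B = {c₁, d, c₂} ∧ c₁ ≠ d ∧ c₂ ≠ d ∧ c₁ ≠ c₂ ∧ G.Adj s₁ c₁ ∧ G.Adj s₂ c₂ ∧ G.Adj c₁ d ∧
      G.Adj d c₂ ∧ ¬ G.Adj c₁ c₂ ∧ ¬ G.Adj s₁ c₂ ∧ ¬ G.Adj s₂ c₁ := by
  have h1A := S.fst_left
  have h2A := S.snd_left
  have h1B := S.fst_right
  have h2B := S.snd_right
  have hne := S.ne
  have hXB : ∀ x ∈ X, x ∈ B ∧ x ≠ d := by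
    intro x hx
    have : x ∈ B.erase d := hXY ▸ Finset.mem_union_left _ hx
    exact ⟨Finset.mem_of_mem_erase this, Finset.ne_of_mem_erase this⟩
  have hYB : ∀ y ∈ Y, y ∈ B ∧ y ≠ d := by
    intro y hy
    have : y ∈ B.erase d := hXY ▸ Finset.mem_union_right _ hy
    exact ⟨Finset.mem_of_mem_erase this, Finset.ne_of_mem_erase this⟩
  have hBXY : ∀ v ∈ B, v = d ∨ v ∈ X ∨ v ∈ Y := by
    intro v hv
    by_cases hvd : v = d
    · exact Or.inl hvd
    · right
      rw [← Finset.mem_union, hXY]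
      exact Finset.mem_erase.2 ⟨hvd, hv⟩
  have hXnY : ∀ x ∈ X, x ∉ Y := Finset.disjoint_left.1 hdisj
  have hs₁Y : ∀ y ∈ Y, ¬ G.Adj s₁ y := by
    intro y hy hsy
    obtain ⟨x, hx, hsx⟩ := hsX
    exact hno x hx y hy (hG.adj_of_adj_fst_left S.symm x (hXB x hx).1 y (hYB y hy).1
      (by rintro rfl; exact hXnY _ hx hy) hsx hsy)
  have hds₁ : d ≠ s₁ := by rintro rfl; exact h1B hd
  have hds₂ : d ≠ s₂ := by rintro rfl; exact h2B hd
  have hdA : d ∉ A := fun h => S.disj d h hd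
  -- `Y` is not attached to `s₁`, and `d` is not a cut vertex of `G`.
  have hsY : ∃ y ∈ Y, G.Adj s₂ y := by
    obtain ⟨y, hy⟩ := hY
    obtain ⟨u, hu, hud, v, hv, hvd, huv⟩ := hG.exit Y d ⟨y, hy, (hYB y hy).2⟩
      ⟨s₁, fun h => h1B (hYB _ h).1, hds₁.symm⟩
    rcases S.cover v with h | h | h | h
    · exact absurd huv.symm (S.not_adj v h u (hYB u hu).1)
    · rcases hBXY v h with h | h | h
      · exact absurd h hvd
      · exact absurd huv.symm (hno v h u hu)
      · exact absurd h hv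
    · exact absurd (h ▸ huv.symm) (hs₁Y u hu)
    · exact ⟨u, hu, h ▸ huv.symm⟩
  have hs₂X : ∀ x ∈ X, ¬ G.Adj s₂ x := by
    intro x hx hsx
    obtain ⟨y, hy, hsy⟩ := hsY
    exact hno x hx y hy (hG.adj_of_adj_fst_left S.symm.swap x (hXB x hx).1 y (hYB y hy).1
      (by rintro rfl; exact hXnY _ hx hy) hsx hsy)
  have SX : Sep G (insert s₂ (A ∪ Y)) X s₁ d := by
    refine ⟨⟨s₂, by simp⟩, hX, hds₁.symm, ?_, ?_, ?_, ?_, ?_, ?_, ?_⟩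
    · intro v hv hvX
      have h1 := hXB v hvX
      have h2 := S.disj v
      have h3 := hXnY v hvX
      grind
    · have := hYB s₁
      grind
    · exact fun h => h1B (hXB _ h).1
    · have := hYB d
      grind
    · exact fun h => (hXB _ h).2 rfl
    · intro v
      have h1 := S.cover v
      have h2 := hBXY v
      grind
    · intro a ha b hb hab
      rcases Finset.mem_insert.1 ha with rfl | ha
      · exact hs₂X b hb hab
      rcases Finset.mem_union.1 ha with ha | ha
      · exact S.not_adj a ha b (hXB b hb).1 hab
      · exact hno b hb a ha hab.symm
  have SY : Sep G (insert s₁ (A ∪ X)) Y s₂ d := by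
    refine ⟨⟨s₁, by simp⟩, hY, hds₂.symm, ?_, ?_, ?_, ?_, ?_, ?_, ?_⟩
    · intro v hv hvY
      have h1 := hYB v hvY
      have h2 := S.disj v
      have h3 := hXnY v
      grind
    · have := hXB s₂
      grind
    · exact fun h => h2B (hYB _ h).1
    · have := hXB d
      grind
    · exact fun h => (hYB _ h).2 rfl
    · intro v
      have h1 := S.cover v
      have h2 := hBXY v
      grind
    · intro a ha b hb hab
      rcases Finset.mem_insert.1 ha with rfl | ha
      · exact hs₁Y b hb hab
      rcases Finset.mem_union.1 ha with ha | ha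
      · exact S.not_adj a ha b (hYB b hb).1 hab
      · exact hno a ha b hb hab
  have hcard : X.card + Y.card + 1 = B.card := by
    rw [← Finset.card_union_of_disjoint hdisj, hXY, Finset.card_erase_add_one hd]
  have hXodd : Odd X.card := by
    by_contra hXe
    have hXe : Even X.card := by simpa using hXe
    have hYe : Even Y.card := by grind
    have hP := (hG.pm_left SX.symm hXe).union (hG.pm_left SY.symm hYe) hdisj
    rw [hXY] at hP
    refine hG.false_of_pm ((hG.pm_left S hA).union hP ?_) (a := s₁) (b := s₂) (c := d) ?_ ?_ ?_
      hne hs hd₁ hd₂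
    · rw [Finset.disjoint_left]
      intro v hv hv'
      exact S.disj v hv (Finset.mem_of_mem_erase hv')
    · intro v hv
      have := S.cover v
      grind
    · grind
    · grind
  have hYodd : Odd Y.card := by grind
  obtain ⟨a, ha⟩ := S.left_ne
  have hX1 : X.card = 1 := by
    by_contra hX1
    have h3 : 3 ≤ X.card := by
      have := hX.card_pos
      grind
    obtain ⟨y, hy⟩ := hY
    have haY : a ≠ y := by rintro rfl; exact S.disj _ ha (hYB _ hy).1
    exact S.not_adj a ha y (hYB y hy).1
      (hG.left_isClique SX hd₁ hXodd h3 (by simp [ha]) (by simp [hy]) haY)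
  have hY1 : Y.card = 1 := by
    by_contra hY1
    have h3 : 3 ≤ Y.card := by
      have := hY.card_pos
      grind
    obtain ⟨x, hx⟩ := hX
    have haX : a ≠ x := by rintro rfl; exact S.disj _ ha (hXB _ hx).1
    exact S.not_adj a ha x (hXB x hx).1
      (hG.left_isClique SY hd₂ hYodd h3 (by simp [ha]) (by simp [hx]) haX)
  obtain ⟨c₁, rfl⟩ := Finset.card_eq_one.1 hX1
  obtain ⟨c₂, rfl⟩ := Finset.card_eq_one.1 hY1
  obtain ⟨u, hu, hdu⟩ := hG.exists_adj_snd_right SX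
  obtain ⟨w, hw, hdw⟩ := hG.exists_adj_snd_right SY
  simp only [Finset.mem_singleton, forall_eq, exists_eq_left] at *
  subst hu
  subst hw
  refine ⟨u, w, ?_, hXB.2, hYB.2, hXnY, hsX, hsY, hdu.symm, hdw, hno, hs₁Y, hs₂X⟩
  ext v
  have := hBXY v
  simp only [Finset.mem_insert, Finset.mem_singleton]
  constructor
  · intro hv
    have := hBXY v hv
    tauto
  · rintro (rfl | rfl | rfl)
    · exact hXB.1
    · exact hd
    · exact hYB.1

/-- If the odd side `B` of an independent separating pair has a vertex `d` that is adjacent to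
neither of the two vertices, then `B` is a path on three vertices joining them, with midpoint `d`:
as `s₁`, `s₂`, `d` are independent, `B` without `d` is not connected. -/
theorem exists_path_of_not_adj (hG : IsTwoConnectedECF G) {A B : Finset V} {s₁ s₂ d : V}
    (S : Sep G A B s₁ s₂) (hs : ¬ G.Adj s₁ s₂) (hA : Even A.card) (hB : Odd B.card) (hd : d ∈ B)
    (hd₁ : ¬ G.Adj s₁ d) (hd₂ : ¬ G.Adj s₂ d) :
    ∃ c₁ c₂, B = {c₁, d, c₂} ∧ c₁ ≠ d ∧ c₂ ≠ d ∧ c₁ ≠ c₂ ∧ G.Adj s₁ c₁ ∧ G.Adj s₂ c₂ ∧ G.Adj c₁ d ∧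
      G.Adj d c₂ ∧ ¬ G.Adj c₁ c₂ ∧ ¬ G.Adj s₁ c₂ ∧ ¬ G.Adj s₂ c₁ := by
  have hcard := Finset.card_erase_add_one hd
  obtain ⟨b, hb, hsb⟩ := hG.exists_adj_fst_right S
  have hbd : b ≠ d := by rintro rfl; exact hd₁ hsb
  have hbE : b ∈ B.erase d := Finset.mem_erase.2 ⟨hbd, hb⟩
  have hnc : ¬ ConnOn G (B.erase d) := by
    intro hc
    refine hG.false_of_pm ((hG.pm_left S hA).union (hc.pm hG.claw (by grind)) ?_)
      (a := s₁) (b := s₂) (c := d) ?_ ?_ ?_ S.ne hs hd₁ hd₂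
    · rw [Finset.disjoint_left]
      intro v hv hv'
      exact S.disj v hv (Finset.mem_of_mem_erase hv')
    · intro v hv
      have := S.cover v
      grind
    · have := S.fst_left
      have := S.fst_right
      grind
    · have := S.snd_left
      have := S.snd_right
      grind
  obtain ⟨X, hXE, hXne, hXE', hcl⟩ : ∃ X ⊆ B.erase d, X.Nonempty ∧ X ≠ B.erase d ∧
      ∀ x ∈ X, ∀ y ∈ B.erase d, y ∉ X → ¬ G.Adj x y := by
    by_contra! hcon
    exact hnc ⟨⟨b, hbE⟩, fun X h1 h2 h3 => hcon X h1 h2 h3⟩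
  have hY : (B.erase d \ X).Nonempty := by
    rw [Finset.sdiff_nonempty]
    intro h
    exact hXE' (Finset.Subset.antisymm hXE h)
  by_cases hbX : b ∈ X
  · exact hG.exists_path_of_split S hs hA hB hd hd₁ hd₂ hXne hY
      (Finset.union_sdiff_of_subset hXE) Finset.disjoint_sdiff
      (fun x hx y hy => hcl x hx y (Finset.mem_sdiff.1 hy).1 (Finset.mem_sdiff.1 hy).2)
      ⟨b, hbX, hsb⟩
  · exact hG.exists_path_of_split S hs hA hB hd hd₁ hd₂ hY hXne
      (Finset.sdiff_union_of_subset hXE) Finset.sdiff_disjoint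
      (fun y hy x hx h => hcl x hx y (Finset.mem_sdiff.1 hy).1 (Finset.mem_sdiff.1 hy).2 h.symm)
      ⟨b, Finset.mem_sdiff.2 ⟨hbE, hbX⟩, hsb⟩

/-- Suppose that each vertex of the odd side `B` is adjacent to `s₁` or to `s₂`, and that either of
`s₁`, `s₂` together with `A` is perfectly matched up to a vertex of `A`. Then `B` is a clique: for
non-adjacent `b₁`, `b₂` in `B`, the rest of `B` splits into two cliques of different parity,
complete to `s₁` and to `s₂` respectively; whichever of them is odd is matched together with its
`sᵢ`, and `A` with the other one. -/
theorem isClique_right_of_cover (hG : IsTwoConnectedECF G) {A B : Finset V} {s₁ s₂ a₁ a₂ : V}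
    (S : Sep G A B s₁ s₂) (hB : Odd B.card) (hcov : ∀ b ∈ B, G.Adj s₁ b ∨ G.Adj s₂ b)
    (ha₁ : a₁ ∈ A) (hP₁ : PM G (insert s₁ (A.erase a₁))) (ha₂ : a₂ ∈ A)
    (hP₂ : PM G (insert s₂ (A.erase a₂))) : G.IsClique (B : Set V) := by
  classical
  have h1A := S.fst_left
  have h2A := S.snd_left
  have h1B := S.fst_right
  have h2B := S.snd_right
  have hne := S.ne
  have cl₁ := hG.adj_of_adj_fst_left S.symm
  have cl₂ := hG.adj_of_adj_fst_left S.symm.swap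
  have main : ∀ b₁ ∈ B, ∀ b₂ ∈ B, b₁ ≠ b₂ → ¬ G.Adj b₁ b₂ → ¬ G.Adj s₁ b₂ := by
    intro b₁ hb₁ b₂ hb₂ hbne hnadj hsb₂
    have hs₁b₁ : ¬ G.Adj s₁ b₁ := fun h => hnadj (cl₁ b₁ hb₁ b₂ hb₂ hbne h hsb₂)
    have hs₂b₁ : G.Adj s₂ b₁ := (hcov b₁ hb₁).resolve_left hs₁b₁
    have hs₂b₂ : ¬ G.Adj s₂ b₂ := fun h => hnadj (cl₂ b₁ hb₁ b₂ hb₂ hbne hs₂b₁ h)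
    set P := B.filter (fun v => G.Adj s₁ v ∧ v ≠ b₂) with hPdef
    set Q := B.filter (fun v => ¬ G.Adj s₁ v ∧ v ≠ b₁) with hQdef
    have hPm : ∀ v, v ∈ P ↔ v ∈ B ∧ G.Adj s₁ v ∧ v ≠ b₂ := by simp [hPdef]
    have hQm : ∀ v, v ∈ Q ↔ v ∈ B ∧ ¬ G.Adj s₁ v ∧ v ≠ b₁ := by simp [hQdef]
    have hPc : ∀ x ∈ insert s₁ P, ∀ y ∈ insert s₁ P, x ≠ y → G.Adj x y := by
      intro x hx y hy hxy
      rcases Finset.mem_insert.1 hx with rfl | hx <;> rcases Finset.mem_insert.1 hy with rfl | hy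
      · exact absurd rfl hxy
      · exact ((hPm y).1 hy).2.1
      · exact ((hPm x).1 hx).2.1.symm
      · exact cl₁ x ((hPm x).1 hx).1 y ((hPm y).1 hy).1 hxy ((hPm x).1 hx).2.1 ((hPm y).1 hy).2.1
    have hQs : ∀ x ∈ Q, G.Adj s₂ x := fun x hx =>
      (hcov x ((hQm x).1 hx).1).resolve_left ((hQm x).1 hx).2.1
    have hQc : ∀ x ∈ insert s₂ Q, ∀ y ∈ insert s₂ Q, x ≠ y → G.Adj x y := by
      intro x hx y hy hxy
      rcases Finset.mem_insert.1 hx with hx' | hx' <;> rcases Finset.mem_insert.1 hy with hy' | hy'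
      · exact absurd (hx'.trans hy'.symm) hxy
      · exact hx' ▸ hQs y hy'
      · exact hy' ▸ (hQs x hx').symm
      · exact cl₂ x ((hQm x).1 hx').1 y ((hQm y).1 hy').1 hxy (hQs x hx') (hQs y hy')
    have hcard : P.card + Q.card + 2 = B.card := by
      have e : insert b₁ (insert b₂ (P ∪ Q)) = B := by
        ext v
        simp only [Finset.mem_insert, Finset.mem_union, hPm, hQm]
        constructor
        · rintro (rfl | rfl | h | h)
          · exact hb₁
          · exact hb₂
          · exact h.1
          · exact h.1
        · intro hv
          tauto
      rw [← e, Finset.card_insert_of_notMem, Finset.card_insert_of_notMem,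
        Finset.card_union_of_disjoint]
      · rw [Finset.disjoint_left]
        intro v hv hv'
        exact ((hQm v).1 hv').2.1 ((hPm v).1 hv).2.1
      · simp [hPm, hQm, hsb₂]
      · simp [hPm, hQm, hbne, hs₁b₁]
    have hs₁P : s₁ ∉ P := fun h => h1B ((hPm _).1 h).1
    have hs₂Q : s₂ ∉ Q := fun h => h2B ((hQm _).1 h).1
    by_cases hPodd : Odd P.card
    · have p1 : PM G (insert s₁ P) := by
        refine PM.of_isClique hG.claw (fun x hx y hy => hPc x hx y hy) ?_
        rw [Finset.card_insert_of_notMem hs₁P]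
        grind
      have p2 : PM G Q := by
        refine PM.of_isClique hG.claw (fun x hx y hy => hQc x (Finset.mem_insert_of_mem hx) y
          (Finset.mem_insert_of_mem hy)) ?_
        grind
      have d1 : Disjoint (insert s₁ P) Q := by
        rw [Finset.disjoint_left]
        intro v hv hv'
        rcases Finset.mem_insert.1 hv with rfl | hv
        · exact h1B ((hQm _).1 hv').1
        · exact ((hQm v).1 hv').2.1 ((hPm v).1 hv).2.1
      have d2 : Disjoint (insert s₁ P ∪ Q) (insert s₂ (A.erase a₂)) := by
        rw [Finset.disjoint_left]
        intro v hv hv'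
        have c1 := hPm v
        have c2 := hQm v
        have c3 := S.disj v
        clear hPm hQm hPc hQs hQc hcov cl₁ cl₂
        grind
      refine hG.false_of_pm ((p1.union p2 d1).union hP₂ d2) (a := a₂) (b := b₁) (c := b₂) ?_ ?_ ?_
        (by rintro rfl; exact S.disj _ ha₂ hb₁) (S.not_adj a₂ ha₂ b₁ hb₁)
        (S.not_adj a₂ ha₂ b₂ hb₂) hnadj
      · intro v hv
        have c1 := hPm v
        have c2 := hQm v
        have c3 := S.cover v
        clear hPm hQm hPc hQs hQc hcov cl₁ cl₂
        grind
      · have c1 := hPm a₂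
        have c2 := hQm a₂
        have c3 := S.disj a₂ ha₂
        clear hPm hQm hPc hQs hQc hcov cl₁ cl₂
        grind
      · have c1 := hPm b₁
        have c2 := hQm b₁
        have c3 := S.symm.disj b₁ hb₁
        clear hPm hQm hPc hQs hQc hcov cl₁ cl₂
        grind
    · have p1 : PM G (insert s₂ Q) := by
        refine PM.of_isClique hG.claw (fun x hx y hy => hQc x hx y hy) ?_
        rw [Finset.card_insert_of_notMem hs₂Q]
        grind
      have p2 : PM G P := by
        refine PM.of_isClique hG.claw (fun x hx y hy => hPc x (Finset.mem_insert_of_mem hx) y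
          (Finset.mem_insert_of_mem hy)) ?_
        grind
      have d1 : Disjoint (insert s₂ Q) P := by
        rw [Finset.disjoint_left]
        intro v hv hv'
        rcases Finset.mem_insert.1 hv with rfl | hv
        · exact h2B ((hPm _).1 hv').1
        · exact ((hQm v).1 hv).2.1 ((hPm v).1 hv').2.1
      have d2 : Disjoint (insert s₂ Q ∪ P) (insert s₁ (A.erase a₁)) := by
        rw [Finset.disjoint_left]
        intro v hv hv'
        have c1 := hPm v
        have c2 := hQm v
        have c3 := S.disj v
        clear hPm hQm hPc hQs hQc hcov cl₁ cl₂
        grind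
      refine hG.false_of_pm ((p1.union p2 d1).union hP₁ d2) (a := a₁) (b := b₁) (c := b₂) ?_ ?_ ?_
        (by rintro rfl; exact S.disj _ ha₁ hb₁) (S.not_adj a₁ ha₁ b₁ hb₁)
        (S.not_adj a₁ ha₁ b₂ hb₂) hnadj
      · intro v hv
        have c1 := hPm v
        have c2 := hQm v
        have c3 := S.cover v
        clear hPm hQm hPc hQs hQc hcov cl₁ cl₂
        grind
      · have c1 := hPm a₁
        have c2 := hQm a₁
        have c3 := S.disj a₁ ha₁
        clear hPm hQm hPc hQs hQc hcov cl₁ cl₂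
        grind
      · have c1 := hPm b₁
        have c2 := hQm b₁
        have c3 := S.symm.disj b₁ hb₁
        clear hPm hQm hPc hQs hQc hcov cl₁ cl₂
        grind
  intro x hx y hy hxy
  by_contra hnadj
  have e1 := main x hx y hy hxy hnadj
  have e2 := main y hy x hx hxy.symm (fun h => hnadj h.symm)
  exact hnadj (cl₂ x hx y hy hxy ((hcov x hx).resolve_left e2) ((hcov y hy).resolve_left e1))

end IsTwoConnectedECF

end

section

variable {V : Type*} [DecidableEq V] {G : SimpleGraph V}

/-- If `s₁` has at most one neighbour `a` in `A`, it can be replaced by `a` in the separating pair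
and moved to the other side. -/
theorem Sep.of_split {A B : Finset V} {s₁ s₂ a : V} (S : Sep G A B s₁ s₂) (ha : a ∈ A)
    (hne : (A.erase a).Nonempty) (h : ∀ x ∈ A, x ≠ a → ¬ G.Adj s₁ x) :
    Sep G (insert s₁ B) (A.erase a) a s₂ where
  left_ne := Finset.insert_nonempty _ _
  right_ne := hne
  ne := by rintro rfl; exact S.snd_left ha
  disj := by
    intro v hv hv'
    rcases Finset.mem_insert.1 hv with rfl | hv
    · exact S.fst_left (Finset.mem_of_mem_erase hv')
    · exact S.disj v (Finset.mem_of_mem_erase hv') hv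
  fst_left := by
    intro hv
    rcases Finset.mem_insert.1 hv with rfl | hv
    · exact S.fst_left ha
    · exact S.disj a ha hv
  fst_right := by simp
  snd_left := by
    simp [S.snd_right, S.ne.symm]
  snd_right := by simp [S.snd_left]
  cover := by
    intro v
    have := S.cover v
    grind
  not_adj := by
    intro x hx y hy hxy
    obtain ⟨hya, hyA⟩ := Finset.mem_erase.1 hy
    rcases Finset.mem_insert.1 hx with rfl | hx
    · exact h y hyA hya hxy
    · exact S.not_adj y hyA x hx hxy.symm

variable [Fintype V]

namespace IsTwoConnectedECF

/-- If `A` consists of a neighbour `a` of `s₁` and of neighbours of `s₂`, and `s₁` is complete to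
the clique `B`, then `a, s₂` is a separating pair as required in the family `𝒢₂₂`. -/
theorem memG22_of_split (hG : IsTwoConnectedECF G) {A B : Finset V} {s₁ s₂ a : V}
    (S : Sep G A B s₁ s₂) (hA : Even A.card) (hB : Odd B.card) (hAc : G.IsClique (A : Set V))
    (hBc : G.IsClique (B : Set V)) (ha : a ∈ A) (hs₂a : ¬ G.Adj s₂ a)
    (hsplit : ∀ x ∈ A, x ≠ a → ¬ G.Adj s₁ x ∧ G.Adj s₂ x) (h₁ : ∀ b ∈ B, G.Adj s₁ b) :
    MemG22 G := by
  have hcard := Finset.card_erase_add_one ha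
  have hodd : Odd (A.erase a).card := by grind
  have hne : (A.erase a).Nonempty := Finset.card_pos.1 hodd.pos
  refine hG.memG22_of_full (S.of_split ha hne fun x hx hxa => (hsplit x hx hxa).1)
    (fun h => hs₂a h.symm) ?_ hodd ?_ (hAc.subset ?_) ?_ ?_
  · rw [Finset.card_insert_of_notMem S.fst_right]
    grind
  · rw [Finset.coe_insert]
    exact hBc.insert fun b hb _ => h₁ b hb
  · intro v hv
    exact Finset.mem_of_mem_erase hv
  · intro x hx
    obtain ⟨hxa, hxA⟩ := Finset.mem_erase.1 hx
    exact hAc ha hxA hxa.symm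
  · intro x hx
    obtain ⟨hxa, hxA⟩ := Finset.mem_erase.1 hx
    exact (hsplit x hxA hxa).2

/-- The even side `A` consists of a neighbour `a` of `s₁` and of neighbours of `s₂`. Unless the pair
`a, s₂` already shows that `G` belongs to `𝒢₂₂`, the same holds with `s₁` and `s₂` exchanged, so
that `A` has just two vertices and `s₁`, `s₂` are the ends of an induced path through `A`. Then `G`
is the 7-cycle if some vertex of `B` is adjacent to neither end; otherwise `B` is a clique, and `G`
belongs to `𝒢₂₂` or `𝒢₂₃`. -/
theorem classification_of_split (hG : IsTwoConnectedECF G) {A B : Finset V} {s₁ s₂ a : V}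
    (S : Sep G A B s₁ s₂) (hs : ¬ G.Adj s₁ s₂) (hA : Even A.card) (hB : Odd B.card)
    (h3 : 3 ≤ B.card) (hAc : G.IsClique (A : Set V)) (ha : a ∈ A) (hs₁a : G.Adj s₁ a)
    (hs₂a : ¬ G.Adj s₂ a) (hsplit : ∀ x ∈ A, x ≠ a → ¬ G.Adj s₁ x ∧ G.Adj s₂ x) :
    MemG22 G ∨ MemG23 G ∨ Nonempty (G ≃g SimpleGraph.cycleGraph 7) := by
  have hcard := Finset.card_erase_add_one ha
  obtain ⟨x, hx⟩ : (A.erase a).Nonempty := Finset.card_pos.1 (by grind)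
  obtain ⟨hxa, hxA⟩ := Finset.mem_erase.1 hx
  rcases hG.full_or_full_or_split S.swap hA hB hAc with h | ⟨hBc, h⟩ | ⟨a', ha', h1, h2, h'⟩
  · exact absurd (h x hxA) (hsplit x hxA hxa).1
  · exact Or.inl (hG.memG22_of_split S hA hB hAc hBc ha hs₂a hsplit h)
  have haa' : a ≠ a' := by rintro rfl; exact h2 hs₁a
  obtain rfl : A = {a, a'} := by
    ext v
    simp only [Finset.mem_insert, Finset.mem_singleton]
    constructor
    · intro hv
      by_contra hcon
      push Not at hcon
      exact (hsplit v hv hcon.1).1 (h' v hv hcon.2).2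
    · rintro (rfl | rfl)
      · exact ha
      · exact ha'
  clear hx hxa hxA x h'
  have haa'_adj : G.Adj a a' := hAc ha ha' haa'
  have e1 : ({a, a'} : Finset V).erase a = {a'} := by grind
  have e2 : ({a, a'} : Finset V).erase a' = {a} := by grind
  by_cases hd : ∃ d ∈ B, ¬ G.Adj s₁ d ∧ ¬ G.Adj s₂ d
  · obtain ⟨d, hdB, hd₁, hd₂⟩ := hd
    obtain ⟨c₁, c₂, hBeq, n1, n2, n3, k1, k2, k3, k4, k5, k6, k7⟩ :=
      hG.exists_path_of_not_adj S hs hA hB hdB hd₁ hd₂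
    right; right
    have hna : ∀ v ∈ ({a, a'} : Finset V), ∀ w ∈ ({c₁, d, c₂} : Finset V), ¬ G.Adj v w :=
      hBeq ▸ S.not_adj
    have hcov := S.cover
    have hdis := S.disj
    have f1 := S.fst_left
    have f2 := S.fst_right
    have f3 := S.snd_left
    have f4 := S.snd_right
    have f5 := S.ne
    simp only [hBeq, Finset.mem_insert, Finset.mem_singleton, not_or, forall_eq_or_imp,
      forall_eq] at hna hcov hdis f1 f2 f3 f4
    refine nonempty_iso_cycleGraph_seven (f := ![s₁, a, a', s₂, c₂, d, c₁]) ⟨?_, ?_⟩ ?_ ?_ ?_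
    · intro i j hij
      fin_cases i <;> fin_cases j <;> simp_all
    · intro v
      rcases hcov v with (rfl | rfl) | (rfl | rfl | rfl) | rfl | rfl
      · exact ⟨1, rfl⟩
      · exact ⟨2, rfl⟩
      · exact ⟨6, rfl⟩
      · exact ⟨5, rfl⟩
      · exact ⟨4, rfl⟩
      · exact ⟨0, rfl⟩
      · exact ⟨3, rfl⟩
    · intro i
      fin_cases i
      · exact hs₁a
      · exact haa'_adj
      · exact h1.symm
      · exact k2
      · exact k4.symm
      · exact k3.symm
      · exact k1.symm
    · intro i
      fin_cases i
      · exact h2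
      · exact fun h => hs₂a h.symm
      · exact hna.2.2.2
      · exact hd₂
      · exact fun h => k5 h.symm
      · exact fun h => hd₁ h.symm
      · exact fun h => hna.1.1 h.symm
    · intro i
      fin_cases i
      · exact hs
      · exact hna.1.2.2
      · exact hna.2.2.1
      · exact k7
      · exact fun h => k6 h.symm
      · exact fun h => hna.1.2.1 h.symm
      · exact fun h => hna.2.1 h.symm
  push Not at hd
  have hcov : ∀ b ∈ B, G.Adj s₁ b ∨ G.Adj s₂ b := fun b hb => by
    by_contra! hcon
    exact hcon.2 (hd b hb hcon.1)
  have hBc := hG.isClique_right_of_cover S hB hcov (a₁ := a') (a₂ := a) (by simp)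
    (by rw [e2]; exact PM.pair hs₁a) (by simp) (by rw [e1]; exact PM.pair h1)
  by_cases g1 : ∀ b ∈ B, G.Adj s₁ b
  · exact Or.inl (hG.memG22_of_split S hA hB hAc hBc ha hs₂a hsplit g1)
  by_cases g2 : ∀ b ∈ B, G.Adj s₂ b
  · refine Or.inl (hG.memG22_of_split S.swap hA hB hAc hBc ha' h2 ?_ g2)
    intro x hx hxa'
    have hxa : x = a := by
      simp only [Finset.mem_insert, Finset.mem_singleton] at hx
      tauto
    rw [hxa]
    exact ⟨hs₂a, hs₁a⟩
  push Not at g1 g2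
  exact Or.inr (Or.inl (hG.memG23_of_path S hs haa'_adj hs₁a h1 h2 hs₂a hB h3 hBc hcov g1 g2))

/-- The classification when some independent separating pair has an odd side of at least three
vertices. -/
theorem classification_of_three_le (hG : IsTwoConnectedECF G) {A B : Finset V} {s₁ s₂ : V}
    (S : Sep G A B s₁ s₂) (hs : ¬ G.Adj s₁ s₂) (hA : Even A.card) (hB : Odd B.card)
    (h3 : 3 ≤ B.card) :
    MemG22 G ∨ MemG23 G ∨ Nonempty (G ≃g SimpleGraph.cycleGraph 7) := by
  have hAc := hG.left_isClique S hs hB h3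
  have hA2 : 2 ≤ A.card := by
    have := S.left_ne.card_pos
    grind
  rcases hG.full_or_full_or_split S hA hB hAc with g₂ | ⟨hBc, g₂⟩ | ⟨a, ha, h1, h2, h'⟩
  · rcases hG.full_or_full_or_split S.swap hA hB hAc with g₁ | ⟨hBc, g₁⟩ | ⟨a, ha, h1, h2, h'⟩
    · obtain ⟨a, ha⟩ := S.left_ne
      by_cases hd : ∃ d ∈ B, ¬ G.Adj s₁ d ∧ ¬ G.Adj s₂ d
      · obtain ⟨d, hdB, hd₁, hd₂⟩ := hd
        obtain ⟨c₁, c₂, rfl, n1, n2, n3, k1, k2, k3, k4, k5, k6, k7⟩ :=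
          hG.exists_path_of_not_adj S hs hA hB hdB hd₁ hd₂
        right; left
        -- Now `c₁, s₂` is a separating pair with sides `{d, c₂}` and `A ∪ {s₁}`.
        have S' : Sep G {d, c₂} (insert s₁ A) c₁ s₂ := by
          have f1 := S.fst_left
          have f2 := S.fst_right
          have f3 := S.snd_left
          have f4 := S.snd_right
          have f5 := S.ne
          have f6 := S.symm.disj
          simp only [Finset.mem_insert, Finset.mem_singleton, not_or, forall_eq_or_imp,
            forall_eq] at f2 f4 f6
          refine ⟨by simp, by simp, Ne.symm f4.1, ?_, ?_, ?_, ?_, ?_, ?_, ?_⟩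
          · simp only [Finset.mem_insert, Finset.mem_singleton, not_or, forall_eq_or_imp,
              forall_eq]
            exact ⟨⟨Ne.symm f2.2.1, f6.2.1⟩, ⟨Ne.symm f2.2.2, f6.2.2⟩⟩
          · simp [n1, n3]
          · simp [Ne.symm f2.1, f6.1]
          · simp [f4.2.1, f4.2.2]
          · simp [f5.symm, f3]
          · intro v
            have := S.cover v
            simp only [Finset.mem_insert, Finset.mem_singleton] at this ⊢
            tauto
          · intro x hx y hy hxy
            simp only [Finset.mem_insert, Finset.mem_singleton] at hx hy
            rcases hx with rfl | rfl <;> rcases hy with rfl | hy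
            · exact hd₁ hxy.symm
            · exact S.not_adj y hy _ (by simp) hxy.symm
            · exact k6 hxy.symm
            · exact S.not_adj y hy _ (by simp) hxy.symm
        refine hG.memG23_of_path S' (fun h => k7 h.symm) k4 k3 k2 k5 hd₂ ?_ ?_ ?_ ?_ ?_ ?_
        · rw [Finset.card_insert_of_notMem S.fst_left]
          grind
        · rw [Finset.card_insert_of_notMem S.fst_left]
          omega
        · rw [Finset.coe_insert]
          exact hAc.insert fun b hb _ => g₁ b hb
        · intro b hb
          rcases Finset.mem_insert.1 hb with rfl | hb
          · exact Or.inl k1.symm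
          · exact Or.inr (g₂ b hb)
        · exact ⟨a, by simp [ha], fun h => S.not_adj a ha c₁ (by simp) h.symm⟩
        · exact ⟨s₁, by simp, fun h => hs h.symm⟩
      · exfalso
        push Not at hd
        have hcov : ∀ b ∈ B, G.Adj s₁ b ∨ G.Adj s₂ b := fun b hb => by
          by_contra! hcon
          exact hcon.2 (hd b hb hcon.1)
        have hcard := Finset.card_erase_add_one ha
        have hsub : ((A.erase a : Finset V) : Set V) ⊆ A := by
          intro v hv
          exact Finset.mem_of_mem_erase hv
        have hP : ∀ s, s ∉ A → (∀ x ∈ A, G.Adj s x) → PM G (insert s (A.erase a)) := by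
          intro s hsA hsx
          refine PM.of_isClique hG.claw ?_ ?_
          · rw [Finset.coe_insert]
            exact (hAc.subset hsub).insert fun b hb _ => hsx b (hsub hb)
          · rw [Finset.card_insert_of_notMem (by simp [hsA])]
            grind
        have hBc := hG.isClique_right_of_cover S hB hcov ha (hP s₁ S.fst_left g₁) ha
          (hP s₂ S.snd_left g₂)
        rcases hG.exists_not_adj_of_isClique S hAc hBc with
          ⟨-, v, hv | hv, h, h'⟩ | ⟨x, hx, y, hy, h⟩
        · exact h (g₁ v hv)
        · exact h' (hd v hv h)
        · rcases h with h | h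
          · exact h.1 (g₁ x hx)
          · exact h.1 (g₂ x hx)
    · exfalso
      rcases hG.exists_not_adj_of_isClique S hAc hBc with ⟨-, v, hv | hv, h, h'⟩ | ⟨x, hx, y, hy, h⟩
      · exact h' (g₂ v hv)
      · exact h (g₁ v hv)
      · rcases h with h | h
        · exact h.2 (g₁ y hy)
        · exact h.1 (g₂ x hx)
    · exfalso
      obtain ⟨x, hx, hxa⟩ := Finset.exists_mem_ne hA2 a
      exact (h' x hx hxa).1 (g₂ x hx)
  · rcases hG.full_or_full_or_split S.swap hA hB hAc with g₁ | ⟨hBc, g₁⟩ | ⟨a, ha, h1, h2, h'⟩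
    · exfalso
      rcases hG.exists_not_adj_of_isClique S hAc hBc with ⟨-, v, hv | hv, h, h'⟩ | ⟨x, hx, y, hy, h⟩
      · exact h (g₁ v hv)
      · exact h' (g₂ v hv)
      · rcases h with h | h
        · exact h.1 (g₁ x hx)
        · exact h.2 (g₂ y hy)
    · exact Or.inl (hG.memG22_of_full S hs hA hB hAc hBc g₁ g₂)
    · exact hG.classification_of_split S.swap (fun h => hs h.symm) hA hB h3 hAc ha h1 h2 h'
  · exact hG.classification_of_split S hs hA hB h3 hAc ha h1 h2 h'

/-! ### Adjacent separating pairs -/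

/-- Some separating pair is independent. Otherwise `A` is a clique, as the other possibility in
`left_isClique_or_inducesFourCycle` provides an independent pair, and so does a splitting of `A` in
`full_or_full_or_split`. If both `s₁` and `s₂` are complete to `A`, then `B` is a clique, since two
non-adjacent vertices of `B` together with a vertex of `A` could be left uncovered. Now both sides
are cliques and each of the adjacent vertices `s₁`, `s₂` is complete to one of them, so there are no
three independent vertices. -/
theorem exists_sep_not_adj (hG : IsTwoConnectedECF G) {A B : Finset V} {s₁ s₂ : V}
    (S : Sep G A B s₁ s₂) (hA : Even A.card) (hB : Odd B.card) :
    ∃ A' B' q₁ q₂, Sep G A' B' q₁ q₂ ∧ ¬ G.Adj q₁ q₂ := by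
  by_contra! hcon
  have hs : G.Adj s₁ s₂ := hcon _ _ _ _ S
  have h1A := S.fst_left
  have h2A := S.snd_left
  have h1B := S.fst_right
  have h2B := S.snd_right
  have hA2 : 2 ≤ A.card := by
    have := S.left_ne.card_pos
    grind
  obtain ⟨b, hb, hP⟩ := hG.exists_pm_erase_right S hB
  have hAc : G.IsClique (A : Set V) := by
    rcases hG.left_isClique_or_inducesFourCycle S hb
      (hP.insert_edge (by simp [h1B]) (by simp [h2B]) hs) with h | ⟨p, t, z, w, h⟩
    · exact h
    · obtain ⟨A', B', q₁, q₂, S', hq⟩ := (hG.adj_and_exists_sep_of_inducesFourCycle S hB h).2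
      exact absurd (hcon _ _ _ _ S') hq
  have hsplit : ∀ s₁ s₂ a, Sep G A B s₁ s₂ → a ∈ A → ¬ G.Adj s₂ a →
      ¬ ∀ x ∈ A, x ≠ a → ¬ G.Adj s₁ x ∧ G.Adj s₂ x := by
    intro s₁ s₂ a S ha hna h'
    obtain ⟨x, hx, hxa⟩ := Finset.exists_mem_ne hA2 a
    exact hna (hcon _ _ _ _ (S.of_split ha ⟨x, Finset.mem_erase.2 ⟨hxa, hx⟩⟩
      fun y hy hya => (h' y hy hya).1)).symm
  rcases hG.full_or_full_or_split S hA hB hAc with g₂ | ⟨hBc, g₂⟩ | ⟨a, ha, h1, h2, h'⟩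
  · rcases hG.full_or_full_or_split S.swap hA hB hAc with g₁ | ⟨hBc, g₁⟩ | ⟨a, ha, h1, h2, h'⟩
    · have hBc : G.IsClique (B : Set V) := by
        intro b₁ hb₁ b₂ hb₂ hbne
        by_contra hnadj
        obtain ⟨a, ha⟩ := S.left_ne
        have hb₁A := S.symm.disj b₁ hb₁
        have hb₂A := S.symm.disj b₂ hb₂
        -- Deleting `a`, `b₁`, `b₂` leaves a disconnected graph; a component that avoids `s₁` and
        -- `s₂` is separated from the rest by `b₁` and `b₂`.
        set U : Finset V := Finset.univ \ {a, b₁, b₂} with hU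
        have hmem : ∀ v, v ∈ U ↔ v ≠ a ∧ v ≠ b₁ ∧ v ≠ b₂ := by
          intro v
          simp [hU]
        have hab₁ : a ≠ b₁ := by rintro rfl; exact hb₁A ha
        have hab₂ : a ≠ b₂ := by rintro rfl; exact hb₂A ha
        have hs₁U : s₁ ∈ U := by
          rw [hmem]
          refine ⟨?_, ?_, ?_⟩ <;> rintro rfl
          · exact h1A ha
          · exact h1B hb₁
          · exact h1B hb₂
        have hs₂U : s₂ ∈ U := by
          rw [hmem]
          refine ⟨?_, ?_, ?_⟩ <;> rintro rfl
          · exact h2A ha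
          · exact h2B hb₁
          · exact h2B hb₂
        have hcl : ∀ Z ⊆ U, Z.Nonempty → s₁ ∉ Z →
            (∀ z ∈ Z, ∀ v ∈ U, v ∉ Z → ¬ G.Adj z v) → False := by
          intro Z hZU hZ hs₁Z hZcl
          have hs₂Z : s₂ ∉ Z := fun h => hZcl s₂ h s₁ hs₁U hs₁Z hs.symm
          have hZA : ∀ z ∈ Z, z ∉ A := fun z hz hzA =>
            hZcl z hz s₁ hs₁U hs₁Z (g₁ z hzA).symm
          have hZB : ∀ z ∈ Z, z ∈ B := by
            intro z hz
            rcases S.cover z with h | h | h | h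
            · exact absurd h (hZA z hz)
            · exact h
            · exact absurd (h ▸ hz) hs₁Z
            · exact absurd (h ▸ hz) hs₂Z
          refine hnadj (hcon _ _ _ _ (Sep.of_closed hZ hbne (fun h => ((hmem _).1 (hZU h)).2.1 rfl)
            (fun h => ((hmem _).1 (hZU h)).2.2 rfl) ?_ ⟨s₁, hs₁Z, ((hmem _).1 hs₁U).2⟩))
          intro z hz v hvZ hv₁ hv₂ hzv
          by_cases hva : v = a
          · exact S.not_adj a ha z (hZB z hz) (hva ▸ hzv.symm)
          · exact hZcl z hz v ((hmem v).2 ⟨hva, hv₁, hv₂⟩) hvZ hzv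
        have hUc : ConnOn G U := by
          refine ⟨⟨s₁, hs₁U⟩, fun X hXU hX hXne => ?_⟩
          by_contra! hno
          by_cases hs₁X : s₁ ∈ X
          · refine hcl (U \ X) Finset.sdiff_subset ?_ (by simp [hs₁X]) ?_
            · rw [Finset.sdiff_nonempty]
              intro h
              exact hXne (Finset.Subset.antisymm hXU h)
            · intro z hz v hv hvZ hzv
              obtain ⟨hzU, hzX⟩ := Finset.mem_sdiff.1 hz
              have hvX : v ∈ X := by
                by_contra h
                exact hvZ (Finset.mem_sdiff.2 ⟨hv, h⟩)
              exact hno v hvX z hzU hzX hzv.symm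
          · exact hcl X hXU hX hs₁X hno
        have hcard : U.card + 3 = Fintype.card V := by
          have h3 : ({a, b₁, b₂} : Finset V).card = 3 := by
            rw [Finset.card_insert_of_notMem (by simp [hab₁, hab₂]), Finset.card_pair hbne]
          rw [← h3, ← Finset.card_univ]
          exact Finset.card_sdiff_add_card_eq_card (Finset.subset_univ _)
        have hodd := hG.odd
        refine hG.false_of_pm (hUc.pm hG.claw (by grind)) (a := a) (b := b₁) (c := b₂) ?_ ?_ ?_
          hab₁ (S.not_adj a ha b₁ hb₁) (S.not_adj a ha b₂ hb₂) hnadj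
        · intro v hv
          rw [hmem] at hv
          tauto
        · rw [hmem]
          tauto
        · rw [hmem]
          tauto
      rcases hG.exists_not_adj_of_isClique S hAc hBc with ⟨h, -⟩ | ⟨x, hx, y, hy, h⟩
      · exact h hs
      · rcases h with h | h
        · exact h.1 (g₁ x hx)
        · exact h.1 (g₂ x hx)
    · rcases hG.exists_not_adj_of_isClique S hAc hBc with ⟨h, -⟩ | ⟨x, hx, y, hy, h⟩
      · exact h hs
      · rcases h with h | h
        · exact h.2 (g₁ y hy)
        · exact h.1 (g₂ x hx)
    · exact hsplit _ _ _ S.swap ha h2 h'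
  · rcases hG.full_or_full_or_split S.swap hA hB hAc with g₁ | ⟨-, g₁⟩ | ⟨a, ha, h1, h2, h'⟩
    · rcases hG.exists_not_adj_of_isClique S hAc hBc with ⟨h, -⟩ | ⟨x, hx, y, hy, h⟩
      · exact h hs
      · rcases h with h | h
        · exact h.1 (g₁ x hx)
        · exact h.2 (g₂ y hy)
    · rcases hG.exists_not_adj_of_isClique S hAc hBc with ⟨h, -⟩ | ⟨x, hx, y, hy, h⟩
      · exact h hs
      · rcases h with h | h
        · exact h.2 (g₁ y hy)
        · exact h.2 (g₂ y hy)
    · exact hsplit _ _ _ S.swap ha h2 h'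
  · exact hsplit _ _ _ S ha h2 h'

end IsTwoConnectedECF

end

section

variable {V : Type*} [DecidableEq V] {G : SimpleGraph V}

/-! ### Independent pairs with a single common neighbour on one side -/

/-- Let `U` be of even order without perfect matching, in a claw-free graph. If every non-empty
union of components of `U` contains `s₁` or `s₂`, then `U` consists of two odd components, one
containing `s₁` and one containing `s₂`. -/
theorem exists_odd_components (hcf : IsClawFree G) {U : Finset V} {s₁ s₂ : V} (h₁ : s₁ ∈ U)
    (h₂ : s₂ ∈ U) (hev : Even U.card) (hPM : ¬ PM G U)
    (hcl : ∀ Z ⊆ U, Z.Nonempty → s₁ ∉ Z → s₂ ∉ Z → ¬ ∀ z ∈ Z, ∀ v ∈ U, v ∉ Z → ¬ G.Adj z v) :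
    ∃ X Y, X ∪ Y = U ∧ Disjoint X Y ∧ s₁ ∈ X ∧ s₂ ∈ Y ∧ ConnOn G X ∧ ConnOn G Y ∧
      Odd X.card ∧ Odd Y.card ∧ ∀ x ∈ X, ∀ y ∈ Y, ¬ G.Adj x y := by
  have hnc : ¬ ConnOn G U := fun h => hPM (h.pm hcf hev)
  obtain ⟨X, hXU, hs₁X, hXne, hno⟩ : ∃ X ⊆ U, s₁ ∈ X ∧ X ≠ U ∧
      ∀ x ∈ X, ∀ y ∈ U, y ∉ X → ¬ G.Adj x y := by
    obtain ⟨X, hXU, hX, hXne, hno⟩ : ∃ X ⊆ U, X.Nonempty ∧ X ≠ U ∧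
        ∀ x ∈ X, ∀ y ∈ U, y ∉ X → ¬ G.Adj x y := by
      by_contra! hcon
      exact hnc ⟨⟨s₁, h₁⟩, fun X h1 h2 h3 => hcon X h1 h2 h3⟩
    by_cases hs : s₁ ∈ X
    · exact ⟨X, hXU, hs, hXne, hno⟩
    · refine ⟨U \ X, Finset.sdiff_subset, Finset.mem_sdiff.2 ⟨h₁, hs⟩, ?_, ?_⟩
      · intro h
        obtain ⟨x, hx⟩ := hX
        have : x ∈ U \ X := by rw [h]; exact hXU hx
        exact (Finset.mem_sdiff.1 this).2 hx
      · intro x hx y hy hyX hxy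
        obtain ⟨hxU, hxX⟩ := Finset.mem_sdiff.1 hx
        have hyX' : y ∈ X := by
          by_contra h
          exact hyX (Finset.mem_sdiff.2 ⟨hy, h⟩)
        exact hno y hyX' x hxU hxX hxy.symm
  have hno' : ∀ x ∈ X, ∀ y ∈ U \ X, ¬ G.Adj x y := fun x hx y hy =>
    hno x hx y (Finset.mem_sdiff.1 hy).1 (Finset.mem_sdiff.1 hy).2
  have hYne : (U \ X).Nonempty := by
    rw [Finset.sdiff_nonempty]
    intro h
    exact hXne (Finset.Subset.antisymm hXU h)
  have hs₂X : s₂ ∉ X := by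
    intro hs₂X
    refine hcl (U \ X) Finset.sdiff_subset hYne (by simp [hs₁X]) (by simp [hs₂X]) ?_
    intro z hz v hv hvZ hzv
    have hvX : v ∈ X := by
      by_contra h
      exact hvZ (Finset.mem_sdiff.2 ⟨hv, h⟩)
    exact hno' v hvX z hz hzv.symm
  have hconn : ∀ X Y : Finset V, X ⊆ U → (∀ v ∈ U, v ∈ X ∨ v ∈ Y) →
      (∀ x ∈ X, ∀ y ∈ Y, ¬ G.Adj x y) →
      (∀ s, (s = s₁ ∨ s = s₂) → s ∈ X → ∀ s', (s' = s₁ ∨ s' = s₂) → s' ∈ X → s = s') →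
      X.Nonempty → ConnOn G X := by
    intro X Y hXU hXY hno huniq hX
    refine ⟨hX, fun Z hZX hZ hZne => ?_⟩
    by_contra! hZno
    have hc₁ := hcl Z (hZX.trans hXU) hZ
    have hc₂ := hcl (X \ Z) (Finset.sdiff_subset.trans hXU) (by
      rw [Finset.sdiff_nonempty]
      intro h
      exact hZne (Finset.Subset.antisymm hZX h))
    have k₁ : ∀ z ∈ Z, ∀ v ∈ U, v ∉ Z → ¬ G.Adj z v := by
      intro z hz v hv hvZ hzv
      rcases hXY v hv with h | h
      · exact hZno z hz v h hvZ hzv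
      · exact hno z (hZX hz) v h hzv
    have k₂ : ∀ z ∈ X \ Z, ∀ v ∈ U, v ∉ X \ Z → ¬ G.Adj z v := by
      intro z hz v hv hvZ hzv
      obtain ⟨hzX, hzZ⟩ := Finset.mem_sdiff.1 hz
      rcases hXY v hv with h | h
      · have hvZ' : v ∈ Z := by
          by_contra h'
          exact hvZ (Finset.mem_sdiff.2 ⟨h, h'⟩)
        exact hZno v hvZ' z hzX hzZ hzv.symm
      · exact hno z hzX v h hzv
    obtain ⟨s, hs, hsZ⟩ : ∃ s, (s = s₁ ∨ s = s₂) ∧ s ∈ Z := by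
      by_contra! hcon
      exact hc₁ (hcon s₁ (Or.inl rfl)) (hcon s₂ (Or.inr rfl)) k₁
    obtain ⟨s', hs', hsZ'⟩ : ∃ s, (s = s₁ ∨ s = s₂) ∧ s ∈ X \ Z := by
      by_contra! hcon
      exact hc₂ (hcon s₁ (Or.inl rfl)) (hcon s₂ (Or.inr rfl)) k₂
    obtain ⟨hsX', hsZ'⟩ := Finset.mem_sdiff.1 hsZ'
    exact hsZ' (huniq s hs (hZX hsZ) s' hs' hsX' ▸ hsZ)
  have hXc : ConnOn G X := by
    refine hconn X (U \ X) hXU (fun v hv => ?_) hno' ?_ ⟨s₁, hs₁X⟩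
    · rw [Finset.mem_sdiff]
      tauto
    · rintro s (rfl | rfl) hs s' (rfl | rfl) hs'
      · rfl
      · exact absurd hs' hs₂X
      · exact absurd hs hs₂X
      · rfl
  have hYc : ConnOn G (U \ X) := by
    refine hconn (U \ X) X Finset.sdiff_subset (fun v hv => ?_)
      (fun y hy x hx h => hno' x hx y hy h.symm) ?_ hYne
    · rw [Finset.mem_sdiff]
      tauto
    · rintro s (rfl | rfl) hs s' (rfl | rfl) hs'
      · rfl
      · exact absurd hs₁X (Finset.mem_sdiff.1 hs).2
      · exact absurd hs₁X (Finset.mem_sdiff.1 hs').2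
      · rfl
  have hcard : (U \ X).card + X.card = U.card := Finset.card_sdiff_add_card_eq_card hXU
  have hXodd : Odd X.card := by
    by_contra hXe
    have hXe : Even X.card := by simpa using hXe
    have hP := (hXc.pm hcf hXe).union (hYc.pm hcf (by grind)) Finset.disjoint_sdiff
    rw [Finset.union_sdiff_of_subset hXU] at hP
    exact hPM hP
  exact ⟨X, U \ X, Finset.union_sdiff_of_subset hXU, Finset.disjoint_sdiff, hs₁X,
    Finset.mem_sdiff.2 ⟨h₂, hs₂X⟩, hXc, hYc, hXodd, by grind, hno'⟩

variable [Fintype V]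

namespace IsTwoConnectedECF

/-- When `b` is the only vertex on its side of an independent separating pair, a matching inside `A`
with independent uncovered vertices either is perfect or misses exactly two vertices, and these have
restricted adjacencies to `s₁` and `s₂`: extend it by `s₁b` or `s₂b`, or by `s₁x` and `s₂b`. -/
theorem uncovered_of_singleton (hG : IsTwoConnectedECF G) {A K : Finset V} {s₁ s₂ b : V}
    (S : Sep G A {b} s₁ s₂) (hs : ¬ G.Adj s₁ s₂) (hA : Even A.card) (hKA : K ⊆ A) (hK : PM G K)
    (hind : ∀ x ∈ A \ K, ∀ y ∈ A \ K, ¬ G.Adj x y) :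
    K = A ∨ ∃ x y, x ≠ y ∧ A \ K = {x, y} ∧ G.Adj s₁ x ∧
      ((G.Adj s₂ y ∧ ¬ G.Adj s₁ y ∧ ¬ G.Adj s₂ x) ∨
        (G.Adj s₂ x ∧ ¬ G.Adj s₁ y ∧ ¬ G.Adj s₂ y)) := by
  by_cases hKA' : K = A
  · exact Or.inl hKA'
  right
  have h1A := S.fst_left
  have h2A := S.snd_left
  have hne := S.ne
  have hb₁ : G.Adj s₁ b := by simpa using hG.exists_adj_fst_right S
  have hb₂ : G.Adj s₂ b := by simpa using hG.exists_adj_snd_right S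
  have hbA : b ∉ A := S.symm.disj b (by simp)
  have hJ : (A \ K).Nonempty := by
    rw [Finset.sdiff_nonempty]
    intro h
    exact hKA' (Finset.Subset.antisymm hKA h)
  have hJcard : Even (A \ K).card := by
    have h1 := Finset.card_sdiff_add_card_eq_card hKA
    have h2 := hK.even
    grind
  have hcov : ∀ v, v ∈ K ∨ v ∈ A \ K ∨ v = b ∨ v = s₁ ∨ v = s₂ := by
    intro v
    have := S.cover v
    simp only [Finset.mem_singleton] at this
    rw [Finset.mem_sdiff]
    tauto
  have key : ∀ s s', Sep G A {b} s s' → ∃ x ∈ A \ K, G.Adj s x := by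
    intro s s' S
    by_contra! hcon
    have hs'b : G.Adj s' b := by simpa using hG.exists_adj_snd_right S
    have hsK : s ∉ K := fun h => S.fst_left (hKA h)
    have hs'K : s' ∉ K := fun h => S.snd_left (hKA h)
    have hsb : s ≠ b := by
      rintro rfl
      exact S.fst_right (by simp)
    have hout : ∀ v, v ∉ insert s' (insert b K) → v ∈ A \ K ∨ v = s := by
      intro v hv
      have := S.cover v
      simp only [Finset.mem_singleton, Finset.mem_insert, not_or, Finset.mem_sdiff] at this hv ⊢
      tauto
    obtain ⟨j, hj⟩ := hJ
    obtain ⟨hjA, hjK⟩ := Finset.mem_sdiff.1 hj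
    have : s = j := by
      refine hG.eq_of_notMem _ (hK.insert_edge hs'K (fun h => hbA (hKA h)) hs'b) ?_ s
        (by simp [S.ne, hsb, hsK]) j ?_
      · intro x hx y hy hxy
        rcases hout x hx with hx | rfl <;> rcases hout y hy with hy | rfl
        · exact hind x hx y hy hxy
        · exact hcon x hx hxy.symm
        · exact hcon y hy hxy
        · exact G.irrefl hxy
      · simp only [Finset.mem_insert, not_or]
        exact ⟨by rintro rfl; exact S.snd_left hjA, by rintro rfl; exact hbA hjA, hjK⟩
    exact S.fst_left (this ▸ hjA)
  obtain ⟨x, hx, hsx⟩ := key s₁ s₂ S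
  obtain ⟨z, hz, hsz⟩ := key s₂ s₁ S.swap
  obtain ⟨hxA, hxK⟩ := Finset.mem_sdiff.1 hx
  obtain ⟨hzA, hzK⟩ := Finset.mem_sdiff.1 hz
  have hxb : x ≠ b := by rintro rfl; exact hbA hxA
  have hxs₂ : x ≠ s₂ := by rintro rfl; exact h2A hxA
  have hbs₁ : s₁ ≠ b := hb₁.ne
  have hP : PM G (insert s₁ (insert x (insert s₂ (insert b K)))) := by
    refine (hK.insert_edge (fun h => h2A (hKA h)) (fun h => hbA (hKA h)) hb₂).insert_edge ?_ ?_ hsx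
    · have hs₁K : s₁ ∉ K := fun h => h1A (hKA h)
      simp [hne, hbs₁, hs₁K]
    · simp [hxb, hxs₂, hxK]
  have huniq : ∀ y ∈ A \ K, y ≠ x → ∀ y' ∈ A \ K, y' ≠ x → y = y' := by
    have hout : ∀ v, v ∉ insert s₁ (insert x (insert s₂ (insert b K))) ↔ v ∈ A \ K ∧ v ≠ x := by
      intro v
      have := hcov v
      simp only [Finset.mem_insert, not_or, Finset.mem_sdiff] at this ⊢
      constructor
      · tauto
      · rintro ⟨⟨hvA, hvK⟩, hvx⟩
        exact ⟨by rintro rfl; exact h1A hvA, hvx, by rintro rfl; exact h2A hvA,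
          by rintro rfl; exact hbA hvA, hvK⟩
    intro y hy hyx y' hy' hyx'
    refine hG.eq_of_notMem _ hP ?_ y ((hout y).2 ⟨hy, hyx⟩) y' ((hout y').2 ⟨hy', hyx'⟩)
    intro v hv w hw
    exact hind v ((hout v).1 hv).1 w ((hout w).1 hw).1
  obtain ⟨y, hy⟩ : ((A \ K).erase x).Nonempty := by
    have := Finset.card_erase_add_one hx
    rw [← Finset.card_pos]
    grind
  obtain ⟨hyx, hyJ⟩ := Finset.mem_erase.1 hy
  obtain ⟨hyA, hyK⟩ := Finset.mem_sdiff.1 hyJ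
  have hxy : ¬ G.Adj x y := hind x hx y hyJ
  have hs₁y : ¬ G.Adj s₁ y := fun h => hxy (hG.adj_of_adj_fst_left S x hxA y hyA hyx.symm hsx h)
  have hs₂xy : ¬ (G.Adj s₂ x ∧ G.Adj s₂ y) := fun h =>
    hxy (hG.adj_of_adj_fst_left S.swap x hxA y hyA hyx.symm h.1 h.2)
  refine ⟨x, y, hyx.symm, ?_, hsx, ?_⟩
  · ext v
    simp only [Finset.mem_insert, Finset.mem_singleton]
    constructor
    · intro hv
      by_cases hvx : v = x
      · exact Or.inl hvx
      · exact Or.inr (huniq v hv hvx y hyJ hyx)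
    · rintro (rfl | rfl)
      · exact hx
      · exact hyJ
  · by_cases hzx : z = x
    · rw [hzx] at hsz
      tauto
    · rw [huniq z hz hzx y hyJ hyx] at hsz
      tauto

/-- The situation excluded here: `b, u, w` separate two odd connected sets `X` and `Y` containing
`s₁` and `s₂`, where `u` has a neighbour `d` in `Y` besides `s₂`, and `w` is adjacent to `s₂`.
Delete `b`, a vertex `c ≠ s₁` of `X` and a vertex `e ≠ s₂` of `Y`, chosen such that `X` without `c`
and `Y` with `s₂` replaced by `u` and without `e` are connected; match these two sets perfectly and
`w` to `s₂`. Then the independent vertices `b, c, e` are left uncovered. -/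
theorem false_of_odd_components (hG : IsTwoConnectedECF G) {A X Y : Finset V} {s₁ s₂ b u w d : V}
    (S : Sep G A {b} s₁ s₂) (hX : ConnOn G X) (hY : ConnOn G Y) (hXo : Odd X.card)
    (hYo : Odd Y.card) (hX2 : 2 ≤ X.card) (hY2 : 2 ≤ Y.card) (h₁ : s₁ ∈ X) (h₂ : s₂ ∈ Y)
    (hdisj : ∀ v ∈ X, v ∉ Y) (hno : ∀ x ∈ X, ∀ y ∈ Y, ¬ G.Adj x y) (huX : u ∉ X) (huY : u ∉ Y)
    (hwX : w ∉ X) (hwY : w ∉ Y) (huw : u ≠ w) (hbX : b ∉ X) (hbY : b ∉ Y) (hub : u ≠ b)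
    (hwb : w ≠ b) (hcov : ∀ v, v ∈ X ∨ v ∈ Y ∨ v = u ∨ v = w ∨ v = b) (hd : d ∈ Y) (hds : d ≠ s₂)
    (hud : G.Adj u d) (hws : G.Adj w s₂) : False := by
  have hmemA : ∀ v, v ≠ s₁ → v ≠ s₂ → v ≠ b → v ∈ A := by
    intro v hv₁ hv₂ hvb
    have := S.cover v
    simp only [Finset.mem_singleton] at this
    tauto
  obtain ⟨c, hc, hcs, hXc⟩ := hX.exists_erase_ne hX2 s₁
  have hcX := Finset.card_erase_add_one hc
  have hP₁ : PM G (X.erase c) := hXc.pm hG.claw (by grind)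
  have hYs : ConnOn G (Y.erase s₂) := by
    refine hY.erase_of_nbrs_clique ?_ ⟨d, Finset.mem_erase.2 ⟨hds, hd⟩⟩
    intro x hx y hy hxy hsx hsy
    have hA : ∀ v ∈ Y, G.Adj s₂ v → v ∈ A := fun v hv hsv =>
      hmemA v (by rintro rfl; exact hdisj _ h₁ hv) hsv.ne.symm (by rintro rfl; exact hbY hv)
    exact hG.adj_of_adj_fst_left S.swap x (hA x hx hsx) y (hA y hy hsy) hxy hsx hsy
  have hYu : ConnOn G (insert u (Y.erase s₂)) :=
    hYs.insert_of_adj (Finset.mem_erase.2 ⟨hds, hd⟩) hud.symm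
  have hYcard := Finset.card_erase_add_one h₂
  have hYucard : (insert u (Y.erase s₂)).card = Y.card := by
    rw [Finset.card_insert_of_notMem (by simp [huY]), hYcard]
  obtain ⟨e, he, heu, hYe⟩ := hYu.exists_erase_ne (by omega) u
  have heY : e ∈ Y ∧ e ≠ s₂ := by
    rcases Finset.mem_insert.1 he with h | h
    · exact absurd h heu
    · exact ⟨Finset.mem_of_mem_erase h, Finset.ne_of_mem_erase h⟩
  have hecard := Finset.card_erase_add_one he
  have hP₂ : PM G ((insert u (Y.erase s₂)).erase e) := hYe.pm hG.claw (by grind)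
  have hcY := hdisj c hc
  have heX : e ∉ X := fun h => hdisj e h heY.1
  have hs₂X : s₂ ∉ X := fun h => hdisj s₂ h h₂
  have hbs₂ : b ≠ s₂ := by rintro rfl; exact hbY h₂
  have hbe : b ≠ e := by rintro rfl; exact hbY heY.1
  have hbc : b ≠ c := by rintro rfl; exact hbX hc
  have hcA : c ∈ A := hmemA c hcs (by rintro rfl; exact hs₂X hc) hbc.symm
  have heA : e ∈ A := hmemA e (by rintro rfl; exact hdisj _ h₁ heY.1) heY.2 hbe.symm
  have hd₁ : Disjoint (X.erase c) ((insert u (Y.erase s₂)).erase e) := by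
    rw [Finset.disjoint_left]
    intro v hv hv'
    have hvX := Finset.mem_of_mem_erase hv
    rcases Finset.mem_insert.1 (Finset.mem_of_mem_erase hv') with rfl | h
    · exact huX hvX
    · exact hdisj v hvX (Finset.mem_of_mem_erase h)
  have hP := (hP₁.union hP₂ hd₁).insert_edge (x := w) (y := s₂) (by simp [hwX, hwY, huw.symm])
    (by
      simp only [Finset.mem_union, Finset.mem_erase, Finset.mem_insert, not_or, not_and]
      exact ⟨fun _ => hs₂X, fun _ => ⟨by rintro rfl; exact huY h₂, fun h => absurd rfl h⟩⟩) hws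
  refine hG.false_of_pm hP (a := b) (b := c) (c := e) ?_ ?_ ?_ hbc
    (fun h => S.not_adj c hcA b (by simp) h.symm) (fun h => S.not_adj e heA b (by simp) h.symm)
    (hno c hc e heY.1)
  · intro v hv
    have hv' := hcov v
    simp only [Finset.mem_insert, Finset.mem_union, Finset.mem_erase, not_or] at hv
    tauto
  · simp [hwb.symm, hbs₂, hbX, hbY, hub.symm]
  · have hcw : c ≠ w := by rintro rfl; exact hwX hc
    have hcu : c ≠ u := by rintro rfl; exact huX hc
    have hcs₂ : c ≠ s₂ := by rintro rfl; exact hs₂X hc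
    simp [hcw, hcs₂, hcu, hcY]

/-- The family `𝒢₂₁` arises with 4-cycle `s₁, x, s₂, b` when `x` is the only neighbour of `s₂` in
`A` and is adjacent to `s₁` as well. -/
theorem memG21_of_singleton (hG : IsTwoConnectedECF G) {A : Finset V} {s₁ s₂ b x y : V}
    (S : Sep G A {b} s₁ s₂) (hs : ¬ G.Adj s₁ s₂) (hA : Even A.card) (hx : x ∈ A)
    (h₁x : G.Adj s₁ x) (h₂x : G.Adj s₂ x) (h₂ : ∀ c ∈ A, c ≠ x → ¬ G.Adj s₂ c) (hy : y ∈ A)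
    (hyx : y ≠ x) (h₁y : ¬ G.Adj s₁ y) : MemG21 G := by
  have h1A := S.fst_left
  have h2A := S.snd_left
  have hne := S.ne
  have hb₁ : G.Adj s₁ b := by simpa using hG.exists_adj_fst_right S
  have hb₂ : G.Adj s₂ b := by simpa using hG.exists_adj_snd_right S
  have hbA : b ∉ A := S.symm.disj b (by simp)
  have hbx : ¬ G.Adj x b := S.not_adj x hx b (by simp)
  have hnb : ∀ c ∈ A, c ≠ x → (G.Adj s₁ c ↔ G.Adj x c) := by
    intro c hc hcx
    constructor
    · intro h
      exact hG.adj_of_adj_fst_left S x hx c hc hcx.symm h₁x h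
    · intro h
      rcases hG.claw.adj_of_adj h h₁x.symm h₂x.symm (by rintro rfl; exact h1A hc)
        (by rintro rfl; exact h2A hc) hne with h' | h' | h'
      · exact h'.symm
      · exact absurd h'.symm (h₂ c hc hcx)
      · exact absurd h' hs
  -- No vertex `s` separates the 4-cycle from `y`.
  have hW : ∀ s, s ≠ y → s ≠ s₁ → ∃ w ∈ A, w ≠ x ∧ w ≠ s ∧ G.Adj s₁ w := by
    intro s hsy hss₁
    obtain ⟨p, hp, hps, w, hw, hws, hpw⟩ := hG.exit {s₁, x, s₂, b} s ⟨s₁, by simp, hss₁.symm⟩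
      ⟨y, by
        simp only [Finset.mem_insert, Finset.mem_singleton, not_or]
        exact ⟨by rintro rfl; exact h1A hy, hyx, by rintro rfl; exact h2A hy,
          by rintro rfl; exact hbA hy⟩, hsy.symm⟩
    simp only [Finset.mem_insert, Finset.mem_singleton, not_or] at hp hw
    have hwA : w ∈ A := by
      have := S.cover w
      simp only [Finset.mem_singleton] at this
      tauto
    refine ⟨w, hwA, hw.2.1, hws, ?_⟩
    rcases hp with rfl | rfl | rfl | rfl
    · exact hpw
    · exact (hnb w hwA hw.2.1).2 hpw
    · exact absurd hpw (h₂ w hwA hw.2.1)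
    · exact absurd hpw.symm (S.not_adj w hwA _ (by simp))
  obtain ⟨w₁, hw₁, hw₁x, -, hsw₁⟩ := hW b (by rintro rfl; exact hbA hy) hb₁.ne.symm
  obtain ⟨w₂, hw₂, hw₂x, hw₂₁, hsw₂⟩ := hW w₁ (by rintro rfl; exact h₁y hsw₁) hsw₁.ne.symm
  have hcl : G.IsClique ((A.erase x : Finset V) : Set V) := by
    refine (hG.connOn_left S).isClique_erase hG.claw hx ?_ hw₁ hw₂ hw₂₁.symm
      ((hnb w₁ hw₁ hw₁x).1 hsw₁) ((hnb w₂ hw₂ hw₂x).1 hsw₂) ?_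
    · intro p hp q hq hpq hxp hxq
      exact hG.adj_of_adj_fst_left S p hp q hq hpq ((hnb p hp hxp.ne.symm).2 hxp)
        ((hnb q hq hxq.ne.symm).2 hxq)
    · intro K hKA hK hind hxK
      rcases hG.uncovered_of_singleton S hs hA hKA hK hind with h | ⟨p, q, -, hpq, -, h⟩
      · exact h
      · have hp : p ∈ A \ K := by simp [hpq]
        have hq : q ∈ A \ K := by simp [hpq]
        obtain ⟨hpA, hpK⟩ := Finset.mem_sdiff.1 hp
        obtain ⟨hqA, hqK⟩ := Finset.mem_sdiff.1 hq
        rcases h with h | h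
        · exact absurd h.1 (h₂ q hqA (by rintro rfl; exact hqK hxK))
        · exact absurd h.1 (h₂ p hpA (by rintro rfl; exact hpK hxK))
  have hcard := Finset.card_erase_add_one hx
  obtain ⟨q, hq⟩ : Odd (A.erase x).card := by grind
  have h2card : 2 ≤ (A.erase x).card :=
    Finset.one_lt_card.2 ⟨w₁, by simp [hw₁, hw₁x], w₂, by simp [hw₂, hw₂x], hw₂₁.symm⟩
  refine ⟨((A.erase x : Finset V) : Set V), {s₁, x, s₂, b}, ?_, ?_, ⟨q, by omega, hcl, ?_⟩,
    ⟨⟨![s₁, x, s₂, b], ?_⟩, ?_⟩, ?_, ?_, ?_, ?_, ?_, ?_⟩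
  · rw [Set.disjoint_left]
    intro v hv hv'
    obtain ⟨hvx, hvA⟩ := Finset.mem_erase.1 (Finset.mem_coe.1 hv)
    rcases hv' with rfl | rfl | rfl | rfl
    · exact h1A hvA
    · exact hvx rfl
    · exact h2A hvA
    · exact hbA hvA
  · ext v
    have := S.cover v
    simp only [Finset.mem_singleton] at this
    simp only [Finset.coe_erase, Set.mem_union, Set.mem_sdiff, Finset.mem_coe,
      Set.mem_singleton_iff, Set.mem_insert_iff, Set.mem_univ, iff_true]
    tauto
  · rw [Set.ncard_coe_finset]
    exact hq
  · intro i j hij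
    have n1 := h₁x.ne
    have n2 := h₂x.ne
    have n3 := hb₁.ne
    have n4 := hb₂.ne
    fin_cases i <;> fin_cases j <;> simp_all
  · have hadj : ∀ i j : Fin 4, G.Adj (![s₁, x, s₂, b] i) (![s₁, x, s₂, b] j) ↔
        (SimpleGraph.cycleGraph 4).Adj i j := by
      have hs' : ¬ G.Adj s₂ s₁ := fun h => hs h.symm
      have hbx' : ¬ G.Adj b x := fun h => hbx h.symm
      have hc : ∀ i j : Fin 4, (SimpleGraph.cycleGraph 4).Adj i j ↔ (j = i + 1 ∨ i = j + 1) := by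
        decide
      intro i j
      rw [hc]
      fin_cases i <;> fin_cases j <;>
        simp [hs, hs', hbx, hbx', h₁x, h₁x.symm, h₂x, h₂x.symm, hb₁, hb₁.symm, hb₂, hb₂.symm]
    exact fun {i j} => hadj i j
  · change Set.range ![s₁, x, s₂, b] = _
    ext v
    simp
    tauto
  · change nbrIn G _ s₁ = nbrIn G _ x
    ext v
    constructor
    · rintro ⟨hv, hvA⟩
      obtain ⟨hvx, hvA'⟩ := Finset.mem_erase.1 (Finset.mem_coe.1 hvA)
      exact ⟨(hnb v hvA' hvx).1 hv, hvA⟩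
    · rintro ⟨hv, hvA⟩
      obtain ⟨hvx, hvA'⟩ := Finset.mem_erase.1 (Finset.mem_coe.1 hvA)
      exact ⟨(hnb v hvA' hvx).2 hv, hvA⟩
  · change 2 ≤ (nbrIn G _ s₁).ncard
    rw [← Set.ncard_pair hw₂₁.symm]
    refine Set.ncard_le_ncard ?_ (Set.toFinite _)
    rintro v (rfl | rfl)
    · exact ⟨hsw₁, by simp [hw₁, hw₁x]⟩
    · exact ⟨hsw₂, by simp [hw₂, hw₂x]⟩
  · change (nbrIn G _ s₁).ncard < _
    refine Set.ncard_lt_ncard ?_ (Set.toFinite _)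
    refine (Set.ssubset_iff_of_subset
      (show nbrIn G _ s₁ ⊆ _ from Set.inter_subset_right)).2 ⟨y, ?_, fun h => h₁y h.1⟩
    simp [hy, hyx]
  · change nbrIn G _ s₂ = ∅
    refine Set.eq_empty_iff_forall_notMem.2 fun v hv => ?_
    obtain ⟨hvx, hvA⟩ := Finset.mem_erase.1 (Finset.mem_coe.1 hv.2)
    exact h₂ v hvA hvx hv.1
  · change nbrIn G _ b = ∅
    refine Set.eq_empty_iff_forall_notMem.2 fun v hv => ?_
    obtain ⟨hvx, hvA⟩ := Finset.mem_erase.1 (Finset.mem_coe.1 hv.2)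
    exact S.not_adj v hvA b (by simp) (SimpleGraph.Adj.symm hv.1)

end IsTwoConnectedECF

end

section

variable {V : Type*} [DecidableEq V] {G : SimpleGraph V} [Fintype V]

namespace IsTwoConnectedECF

/-- Let one side of a separation be a singleton and let `x`, `y` be the two vertices of the other
side `A` missed by a matching of `A`. If the separating pair together with the matched vertices has
no component avoiding the pair, then it falls into two components, one for each separating vertex
`sᵢ`. If one of `x`, `y` has a neighbour other than `sᵢ` in the component of `sᵢ`, then the other
one is not adjacent to `sᵢ`. -/
theorem exists_components_of_uncovered (hG : IsTwoConnectedECF G) {A K : Finset V}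
    {s₁ s₂ b x y c₁ c₂ : V} (S : Sep G A {b} s₁ s₂) (hKA : K ⊆ A) (hK : PM G K) (hxy : x ≠ y)
    (hAK : A \ K = {x, y}) (nxy : ¬ G.Adj x y) (hc₁ : c₁ ∈ K) (hs₁ : G.Adj s₁ c₁) (hc₂ : c₂ ∈ K)
    (hs₂ : G.Adj s₂ c₂)
    (hcl : ∀ Z ⊆ K, Z.Nonempty → (∀ z ∈ Z, ¬ G.Adj z s₁ ∧ ¬ G.Adj z s₂) →
      ¬ ∀ z ∈ Z, ∀ v ∈ K, v ∉ Z → ¬ G.Adj z v) :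
    ∃ X Y, X ∪ Y = insert s₁ (insert s₂ K) ∧ s₁ ∈ X ∧ s₂ ∈ Y ∧
      (∀ v ∈ X, ∀ w ∈ Y, ¬ G.Adj v w) ∧
      ∀ u w, u = x ∧ w = y ∨ u = y ∧ w = x →
        (∀ d ∈ Y, d ≠ s₂ → G.Adj u d → ¬ G.Adj w s₂) ∧
        (∀ d ∈ X, d ≠ s₁ → G.Adj u d → ¬ G.Adj w s₁) := by
  have hmem : ∀ v, v ∈ A ∧ v ∉ K ↔ v = x ∨ v = y := by
    intro v
    rw [← Finset.mem_sdiff, hAK]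
    simp
  obtain ⟨hxA, hxK⟩ := (hmem x).2 (Or.inl rfl)
  obtain ⟨hyA, hyK⟩ := (hmem y).2 (Or.inr rfl)
  have h1A := S.fst_left
  have h2A := S.snd_left
  have hbA : b ∉ A := fun h => S.disj b h (by simp)
  have hb1 : b ≠ s₁ := by rintro rfl; exact S.fst_right (by simp)
  have hb2 : b ≠ s₂ := by rintro rfl; exact S.snd_right (by simp)
  have nb : ∀ v ∈ A, ¬ G.Adj v b := fun v hv => S.not_adj v hv b (by simp)
  have h1K : s₁ ∉ K := fun h => h1A (hKA h)
  have h2K : s₂ ∉ K := fun h => h2A (hKA h)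
  have hne_of_mem : ∀ v ∈ A, v ≠ s₁ ∧ v ≠ s₂ ∧ v ≠ b := fun v hv =>
    ⟨by rintro rfl; exact h1A hv, by rintro rfl; exact h2A hv, by rintro rfl; exact hbA hv⟩
  obtain ⟨hx1, hx2, hxb⟩ := hne_of_mem x hxA
  obtain ⟨hy1, hy2, hyb⟩ := hne_of_mem y hyA
  have hcov : ∀ v, v ∈ insert s₁ (insert s₂ K) ∨ v = x ∨ v = y ∨ v = b := by
    intro v
    have h1 := S.cover v
    have h2 := hmem v
    simp only [Finset.mem_singleton, Finset.mem_insert] at h1 ⊢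
    clear * - h1 h2
    tauto
  have hev : Even (insert s₁ (insert s₂ K)).card := by
    rw [Finset.card_insert_of_notMem (by simp [S.ne, h1K]), Finset.card_insert_of_notMem h2K]
    have := hK.even
    grind
  obtain ⟨X, Y, hXY, hdisj, h1X, h2Y, hcX, hcY, hXo, hYo, hno⟩ :=
    exists_odd_components hG.claw (s₁ := s₁) (s₂ := s₂) (by simp) (by simp) hev
      (fun hPM => hG.false_of_pm hPM (a := x) (b := y) (c := b)
        (fun v hv => (hcov v).resolve_left hv) (by simp [hx1, hx2, hxK]) (by simp [hy1, hy2, hyK])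
        hxy nxy (nb x hxA) (nb y hyA))
      (by
        intro Z hZ hne h1Z h2Z hclosed
        refine hcl Z ?_ hne ?_ fun z hz v hv => hclosed z hz v (by simp [hv])
        · intro z hz
          have := hZ hz
          simp only [Finset.mem_insert] at this
          rcases this with rfl | rfl | h
          · exact absurd hz h1Z
          · exact absurd hz h2Z
          · exact h
        · exact fun z hz => ⟨hclosed z hz s₁ (by simp) h1Z, hclosed z hz s₂ (by simp) h2Z⟩)
  have hdisj' := Finset.disjoint_left.1 hdisj
  have hmemXY : ∀ v, v ∈ X ∨ v ∈ Y ↔ v = s₁ ∨ v = s₂ ∨ v ∈ K := by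
    intro v
    rw [← Finset.mem_union, hXY]
    simp
  have hout : ∀ v, v ≠ s₁ → v ≠ s₂ → v ∉ K → v ∉ X ∧ v ∉ Y := by
    intro v h1 h2 h3
    have := hmemXY v
    clear * - this h1 h2 h3
    tauto
  obtain ⟨hxX, hxY⟩ := hout x hx1 hx2 hxK
  obtain ⟨hyX, hyY⟩ := hout y hy1 hy2 hyK
  obtain ⟨hbX, hbY⟩ := hout b hb1 hb2 fun h => hbA (hKA h)
  have hc₁X : c₁ ∈ X := ((hmemXY c₁).2 (by simp [hc₁])).resolve_right fun h => hno s₁ h1X c₁ h hs₁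
  have hc₂Y : c₂ ∈ Y :=
    ((hmemXY c₂).2 (by simp [hc₂])).resolve_left fun h => hno c₂ h s₂ h2Y hs₂.symm
  have hX2 : 2 ≤ X.card := Finset.one_lt_card.2 ⟨s₁, h1X, c₁, hc₁X, hs₁.ne⟩
  have hY2 : 2 ≤ Y.card := Finset.one_lt_card.2 ⟨s₂, h2Y, c₂, hc₂Y, hs₂.ne⟩
  refine ⟨X, Y, hXY, h1X, h2Y, hno, fun u w huw => ?_⟩
  obtain ⟨huX, huY, hwX, hwY, huw', hub, hwb⟩ :
      u ∉ X ∧ u ∉ Y ∧ w ∉ X ∧ w ∉ Y ∧ u ≠ w ∧ u ≠ b ∧ w ≠ b := by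
    rcases huw with ⟨rfl, rfl⟩ | ⟨rfl, rfl⟩
    · exact ⟨hxX, hxY, hyX, hyY, hxy, hxb, hyb⟩
    · exact ⟨hyX, hyY, hxX, hxY, hxy.symm, hyb, hxb⟩
  have hcov' : ∀ v, v ∈ X ∨ v ∈ Y ∨ v = u ∨ v = w ∨ v = b := by
    intro v
    have h := hcov v
    rw [← hXY, Finset.mem_union] at h
    clear * - h huw
    rcases huw with ⟨rfl, rfl⟩ | ⟨rfl, rfl⟩ <;> tauto
  constructor
  · intro d hd hds hud hws
    exact hG.false_of_odd_components S hcX hcY hXo hYo hX2 hY2 h1X h2Y hdisj' hno huX huY hwX hwY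
      huw' hbX hbY hub hwb hcov' hd hds hud hws
  · intro d hd hds hud hws
    exact hG.false_of_odd_components S.swap hcY hcX hYo hXo hY2 hX2 h2Y h1X
      (fun v hY hX => hdisj' hX hY) (fun v hv w hw h => hno w hw v hv h.symm) huY huX hwY hwX
      huw' hbY hbX hub hwb (fun v => (or_left_comm.1 (hcov' v))) hd hds hud hws

/-- Suppose that the odd side of every separation by non-adjacent vertices is a singleton. Then the
vertices `x` and `y` missed by a matching of the even side cannot be such that `s₁` is adjacent to
`x` only and `s₂` to `y` only: the hypothesis prevents the pairs `x, s₂` and `y, s₁` and `x, y` from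
separating `G`, so that `exists_components_of_uncovered` applies, and as `A` is connected, an edge
joins the component of one separating vertex to `x` or `y` in the way excluded there. -/
theorem false_of_crossing (hG : IsTwoConnectedECF G) {A K : Finset V} {s₁ s₂ b x y : V}
    (hβ : ∀ A' B' q₁ q₂, Sep G A' B' q₁ q₂ → ¬ G.Adj q₁ q₂ → Odd B'.card → B'.card = 1)
    (S : Sep G A {b} s₁ s₂) (hA : Even A.card) (hKA : K ⊆ A) (hK : PM G K)
    (hxy : x ≠ y) (hAK : A \ K = {x, y}) (nxy : ¬ G.Adj x y) (h₁x : G.Adj s₁ x) (h₂y : G.Adj s₂ y)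
    (h₁y : ¬ G.Adj s₁ y) (h₂x : ¬ G.Adj s₂ x) : False := by
  have hmem : ∀ v, v ∈ A ∧ v ∉ K ↔ v = x ∨ v = y := by
    intro v
    rw [← Finset.mem_sdiff, hAK]
    simp
  obtain ⟨hxA, hxK⟩ := (hmem x).2 (Or.inl rfl)
  obtain ⟨hyA, hyK⟩ := (hmem y).2 (Or.inr rfl)
  have hne_of_mem : ∀ v ∈ A, v ≠ s₁ ∧ v ≠ s₂ := fun v hv =>
    ⟨by rintro rfl; exact S.fst_left hv, by rintro rfl; exact S.snd_left hv⟩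
  have hcon := hG.connOn_left S
  -- If all neighbours of `p` in `A` are `u`, then `u` and the other separating vertex separate `A`
  -- without `u`, which has odd order and contains `w` and a neighbour of `w`.
  have key : ∀ p q u w, Sep G A {b} p q → u ∈ A → w ∈ A → u ≠ w → ¬ G.Adj u w → ¬ G.Adj q u →
      ∃ c ∈ A, c ≠ u ∧ G.Adj p c := by
    intro p q u w T hu hw huw nuw nqu
    by_contra! hcon'
    have T' := T.of_split hu ⟨w, by simp [hw, huw.symm]⟩ hcon'
    have hodd : Odd (A.erase u).card := by
      have := Finset.card_erase_add_one hu
      grind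
    obtain ⟨w', hw', v, hv, hvw, hwv⟩ := hcon.2 {w} (by simpa using hw) (by simp) (by
      intro h
      rw [← h] at hu
      exact huw (Finset.mem_singleton.1 hu))
    rw [Finset.mem_singleton] at hw' hvw
    subst hw'
    have hvu : v ≠ u := by rintro rfl; exact nuw hwv.symm
    have h1 := hβ _ _ _ _ T' (fun h => nqu h.symm) hodd
    have : 1 < (A.erase u).card :=
      Finset.one_lt_card.2 ⟨w', by simp [hw, huw.symm], v, by simp [hv, hvu], fun h => hvw h.symm⟩
    omega
  obtain ⟨c₁, hc₁A, hc₁x, hc₁⟩ := key s₁ s₂ x y S hxA hyA hxy nxy h₂x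
  obtain ⟨c₂, hc₂A, hc₂y, hc₂⟩ := key s₂ s₁ y x S.swap hyA hxA hxy.symm (fun h => nxy h.symm) h₁y
  have hinK : ∀ c ∈ A, c ≠ x → c ≠ y → c ∈ K := by
    intro c hc hcx hcy
    by_contra h
    rcases (hmem c).1 ⟨hc, h⟩ with h | h
    · exact hcx h
    · exact hcy h
  have hc₁K := hinK c₁ hc₁A hc₁x (by rintro rfl; exact h₁y hc₁)
  have hc₂K := hinK c₂ hc₂A (by rintro rfl; exact h₂x hc₂) hc₂y
  obtain ⟨X, Y, hXY, h1X, h2Y, hno, hfin⟩ := hG.exists_components_of_uncovered S hKA hK hxy hAK nxy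
    hc₁K hc₁ hc₂K hc₂ (by
      -- A set `Z` of matched vertices closed in this sense is separated by `x` and `y`; it is even,
      -- so the other side is odd, but contains both `s₁` and `s₂`.
      intro Z hZ hne hZs hclosed
      have hxZ : x ∉ Z := fun h => hxK (hZ h)
      have hyZ : y ∉ Z := fun h => hyK (hZ h)
      have h1Z : s₁ ∉ Z := fun h => S.fst_left (hKA (hZ h))
      have h2Z : s₂ ∉ Z := fun h => S.snd_left (hKA (hZ h))
      have T : Sep G Z (Finset.univ \ insert x (insert y Z)) x y := by
        refine Sep.of_closed hne hxy hxZ hyZ ?_ ⟨s₁, h1Z, (hne_of_mem x hxA).1.symm,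
          (hne_of_mem y hyA).1.symm⟩
        intro z hz v hvZ hvx hvy hzv
        have hzA := hKA (hZ hz)
        rcases S.cover v with h | h | rfl | rfl
        · exact hclosed z hz v (hinK v h hvx hvy) hvZ hzv
        · exact S.not_adj z hzA v h hzv
        · exact (hZs z hz).1 hzv
        · exact (hZs z hz).2 hzv
      have hZe : Even Z.card := hK.even_of_closed hZ hclosed
      have hadd := T.card_add
      have hVo := hG.odd
      have h1 := hβ _ _ _ _ T nxy (by grind)
      have : 1 < (Finset.univ \ insert x (insert y Z)).card :=
        Finset.one_lt_card.2 ⟨s₁, by simp [h1Z, (hne_of_mem x hxA).1.symm,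
          (hne_of_mem y hyA).1.symm], s₂, by simp [h2Z, (hne_of_mem x hxA).2.symm,
          (hne_of_mem y hyA).2.symm], S.ne⟩
      omega)
  have hXA : ∀ v, v ∈ X ∨ v ∈ Y ↔ v = s₁ ∨ v = s₂ ∨ v ∈ K := by
    intro v
    rw [← Finset.mem_union, hXY]
    simp
  have hyX : y ∉ X := by
    intro h
    rcases (hXA y).1 (Or.inl h) with h | h | h
    · exact (hne_of_mem y hyA).1 h
    · exact (hne_of_mem y hyA).2 h
    · exact hyK h
  have h2X : ∀ v ∈ X, v ≠ s₁ → v ∈ K := by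
    intro v hv hv1
    rcases (hXA v).1 (Or.inl hv) with h | h | h
    · exact absurd h hv1
    · subst h
      -- `s₂` lies in `Y`; in `X` as well, it would have no neighbour in `X ∪ Y`.
      exact absurd hc₂ (hno v hv c₂ (((hXA c₂).2 (by simp [hc₂K])).resolve_left
        fun h => hno c₂ h v h2Y hc₂.symm))
    · exact h
  obtain ⟨p, hp, q, hqA, hq, hpq⟩ := hcon.2 (insert x (X.erase s₁)) (by
    intro v hv
    rcases Finset.mem_insert.1 hv with rfl | hv
    · exact hxA
    · obtain ⟨hv1, hv⟩ := Finset.mem_erase.1 hv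
      exact hKA (h2X v hv hv1)) (by simp) (by
    intro h
    rw [← h] at hyA
    simp [hxy.symm, hyX] at hyA)
  simp only [Finset.mem_insert, Finset.mem_erase, not_or, not_and] at hp hq
  have hq1 := hne_of_mem q hqA
  have hqX := hq.2 hq1.1
  by_cases hqy : q = y
  · subst hqy
    rcases hp with rfl | ⟨hp1, hpX⟩
    · exact nxy hpq
    · exact (hfin q x (Or.inr ⟨rfl, rfl⟩)).2 p hpX hp1 hpq.symm h₁x.symm
  · have hqY : q ∈ Y := ((hXA q).2 (by simp [hinK q hqA hq.1 hqy])).resolve_left hqX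
    rcases hp with rfl | ⟨hp1, hpX⟩
    · exact (hfin p y (Or.inl ⟨rfl, rfl⟩)).1 q hqY hq1.2 hpq h₂y.symm
    · exact hno p hpX q hqY hpq

/-- The classification when every separation by a non-adjacent pair has a single vertex as its odd
side. -/
theorem classification_of_singleton (hG : IsTwoConnectedECF G) {A : Finset V} {s₁ s₂ b : V}
    (hβ : ∀ A' B' q₁ q₂, Sep G A' B' q₁ q₂ → ¬ G.Adj q₁ q₂ → Odd B'.card → B'.card = 1)
    (S : Sep G A {b} s₁ s₂) (hs : ¬ G.Adj s₁ s₂) (hA : Even A.card) : MemG21 G ∨ MemG22 G := by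
  have hb₁ : G.Adj s₁ b := by simpa using hG.exists_adj_fst_right S
  have hb₂ : G.Adj s₂ b := by simpa using hG.exists_adj_snd_right S
  by_cases hJ : ∀ K ⊆ A, PM G K → (∀ x ∈ A \ K, ∀ y ∈ A \ K, ¬ G.Adj x y) → K = A
  · rcases (hG.connOn_left S).isClique_or_inducesFourCycle hG.claw hJ with hAc | ⟨p, t, z, w, h⟩
    · exact Or.inr (hG.memG22_of_full S hs hA (by simp) hAc (by simp) (by simpa using hb₁)
        (by simpa using hb₂))
    · exact absurd (hG.adj_and_exists_sep_of_inducesFourCycle S (by simp) h).1 hs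
  push Not at hJ
  obtain ⟨K, hKA, hK, hind, hne⟩ := hJ
  obtain ⟨x, y, hxy, hAK, h₁x, h⟩ :=
    (hG.uncovered_of_singleton S hs hA hKA hK hind).resolve_left hne
  have hmem : ∀ v, v ∈ A ∧ v ∉ K ↔ v = x ∨ v = y := by
    intro v
    rw [← Finset.mem_sdiff, hAK]
    simp
  obtain ⟨hxA, hxK⟩ := (hmem x).2 (Or.inl rfl)
  obtain ⟨hyA, hyK⟩ := (hmem y).2 (Or.inr rfl)
  have nxy : ¬ G.Adj x y := hind x (by simp [hAK]) y (by simp [hAK])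
  rcases h with ⟨h₂y, h₁y, h₂x⟩ | ⟨h₂x, h₁y, h₂y⟩
  · exact (hG.false_of_crossing hβ S hA hKA hK hxy hAK nxy h₁x h₂y h₁y h₂x).elim
  left
  by_cases g₂ : ∀ c ∈ A, c ≠ x → ¬ G.Adj s₂ c
  · exact hG.memG21_of_singleton S hs hA hxA h₁x h₂x g₂ hyA hxy.symm h₁y
  by_cases g₁ : ∀ c ∈ A, c ≠ x → ¬ G.Adj s₁ c
  · exact hG.memG21_of_singleton S.swap (fun h => hs h.symm) hA hxA h₂x h₁x g₁ hyA hxy.symm h₂y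
  push Not at g₁ g₂
  obtain ⟨c₁, hc₁A, hc₁x, hc₁⟩ := g₁
  obtain ⟨c₂, hc₂A, hc₂x, hc₂⟩ := g₂
  exfalso
  have hinK : ∀ c ∈ A, c ≠ x → c ≠ y → c ∈ K := by
    intro c hc hcx hcy
    by_contra h
    rcases (hmem c).1 ⟨hc, h⟩ with h | h
    · exact hcx h
    · exact hcy h
  have hc₁K := hinK c₁ hc₁A hc₁x (by rintro rfl; exact h₁y hc₁)
  have hc₂K := hinK c₂ hc₂A hc₂x (by rintro rfl; exact h₂y hc₂)
  obtain ⟨X, Y, hXY, -, -, -, hfin⟩ := hG.exists_components_of_uncovered S hKA hK hxy hAK nxy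
    hc₁K hc₁ hc₂K hc₂ (by
      -- An edge leaving `Z` and avoiding `y` can only end in `x`, and then `x` is the centre of a
      -- claw with `s₁` and `s₂`.
      intro Z hZ hne hZs hclosed
      obtain ⟨z₀, hz₀⟩ := hne
      obtain ⟨z, hz, -, v, hvZ, hvy, hzv⟩ := hG.exit Z y
        ⟨z₀, hz₀, by rintro rfl; exact hyK (hZ hz₀)⟩
        ⟨s₁, fun h => S.fst_left (hKA (hZ h)), by rintro rfl; exact S.fst_left hyA⟩
      have hzA := hKA (hZ hz)
      rcases S.cover v with h | h | rfl | rfl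
      · by_cases hvx : v = x
        · subst hvx
          rcases hG.claw.adj_of_adj hzv.symm h₁x.symm h₂x.symm
            (by rintro rfl; exact S.fst_left hzA) (by rintro rfl; exact S.snd_left hzA) S.ne
            with h | h | h
          · exact (hZs z hz).1 h
          · exact (hZs z hz).2 h
          · exact hs h
        · exact hclosed z hz v (hinK v h hvx hvy) hvZ hzv
      · exact S.not_adj z hzA v h hzv
      · exact (hZs z hz).1 hzv
      · exact (hZs z hz).2 hzv)
  obtain ⟨y', hy', v, hvA, hvy, hyv⟩ := (hG.connOn_left S).2 {y} (by simpa using hyA) (by simp) (by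
    intro h
    rw [← h] at hxA
    exact hxy (Finset.mem_singleton.1 hxA))
  rw [Finset.mem_singleton] at hy' hvy
  subst hy'
  have hvx : v ≠ x := by rintro rfl; exact nxy hyv.symm
  have hv1 : v ≠ s₁ := by rintro rfl; exact S.fst_left hvA
  have hv2 : v ≠ s₂ := by rintro rfl; exact S.snd_left hvA
  have hv : v ∈ X ∪ Y := by rw [hXY]; simp [hinK v hvA hvx hvy]
  rcases Finset.mem_union.1 hv with hv | hv
  · exact (hfin y' x (Or.inr ⟨rfl, rfl⟩)).2 v hv hv1 hyv h₁x.symm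
  · exact (hfin y' x (Or.inr ⟨rfl, rfl⟩)).1 v hv hv2 hyv h₂x.symm

/-- The two parts of the classification, together with the existence of an independent separating
pair. -/
theorem classification_of_sep (hG : IsTwoConnectedECF G) {A B : Finset V} {s₁ s₂ : V}
    (S : Sep G A B s₁ s₂) :
    MemG21 G ∨ MemG22 G ∨ MemG23 G ∨ Nonempty (G ≃g SimpleGraph.cycleGraph 7) := by
  have hparity : ∀ {A B : Finset V} {s₁ s₂ : V}, Sep G A B s₁ s₂ →
      (Even A.card ∧ Odd B.card) ∨ (Even B.card ∧ Odd A.card) := by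
    intro A B s₁ s₂ S
    have h1 := S.card_add
    have h2 := hG.odd
    grind
  by_cases hβ : ∃ A' B' q₁ q₂, Sep G A' B' q₁ q₂ ∧ ¬ G.Adj q₁ q₂ ∧ Odd B'.card ∧ 3 ≤ B'.card
  · obtain ⟨A', B', q₁, q₂, T, hq, hB, h3⟩ := hβ
    have hA : Even A'.card := by
      rcases hparity T with h | h
      · exact h.1
      · exact absurd h.1 (Nat.not_even_iff_odd.2 hB)
    exact Or.inr (hG.classification_of_three_le T hq hA hB h3)
  · have hβ' : ∀ A' B' q₁ q₂, Sep G A' B' q₁ q₂ → ¬ G.Adj q₁ q₂ → Odd B'.card → B'.card = 1 := by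
      intro A' B' q₁ q₂ T hq hB
      by_contra h1
      refine hβ ⟨A', B', q₁, q₂, T, hq, hB, ?_⟩
      obtain ⟨k, hk⟩ := hB
      omega
    obtain ⟨A', B', q₁, q₂, T, hq⟩ : ∃ A' B' q₁ q₂, Sep G A' B' q₁ q₂ ∧ ¬ G.Adj q₁ q₂ := by
      rcases hparity S with h | h
      · exact hG.exists_sep_not_adj S h.1 h.2
      · exact hG.exists_sep_not_adj S.symm h.1 h.2
    obtain ⟨A'', B'', T', hA, hB⟩ :
        ∃ A'' B'', Sep G A'' B'' q₁ q₂ ∧ Even A''.card ∧ Odd B''.card := by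
      rcases hparity T with h | h
      · exact ⟨A', B', T, h⟩
      · exact ⟨B', A', T.symm, h⟩
    obtain ⟨b, rfl⟩ := Finset.card_eq_one.1 (hβ' _ _ _ _ T' hq hB)
    rcases hG.classification_of_singleton hβ' T' hq hA with h | h
    · exact Or.inl h
    · exact Or.inr (Or.inl h)

end IsTwoConnectedECF

end

/-! ### Reduction from vertex connectivity two -/

section

variable {V : Type*} {G : SimpleGraph V}

theorem exists_not_adj_of_three_le_indepNum (h : 3 ≤ G.indepNum) :
    ∃ x y z, x ≠ y ∧ x ≠ z ∧ y ≠ z ∧ ¬ G.Adj x y ∧ ¬ G.Adj x z ∧ ¬ G.Adj y z := by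
  obtain ⟨s, hs⟩ := G.exists_isNIndepSet_indepNum
  obtain ⟨x, hx, y, hy, z, hz, hxy, hxz, hyz⟩ :=
    Finset.two_lt_card.1 (show 2 < s.card by rw [hs.card_eq]; omega)
  exact ⟨x, y, z, hxy, hxz, hyz, hs.isIndepSet hx hy hxy, hs.isIndepSet hx hz hxz,
    hs.isIndepSet hy hz hyz⟩

theorem preconnected_induce_compl_of_ncard_lt {S : Set V} (h : S.ncard < vertexConnectivity G) :
    (G.induce Sᶜ).Preconnected := by
  by_contra hcon
  exact Nat.notMem_of_lt_sInf h ⟨S, rfl, Or.inl hcon⟩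

variable [Fintype V]

theorem isTwoConnectedECF [DecidableEq V] (hequi : IsEquimatchable G) (hclaw : IsClawFree G)
    (hodd : Odd (Fintype.card V)) (halpha : 3 ≤ G.indepNum) (hkappa : vertexConnectivity G = 2) :
    IsTwoConnectedECF G := by
  have hconn : ConnOn G (Finset.univ : Finset V) := by
    have h := preconnected_induce_iff.1
      (preconnected_induce_compl_of_ncard_lt (G := G) (S := ∅) (by simp [hkappa]))
    obtain ⟨x, -⟩ := exists_not_adj_of_three_le_indepNum halpha
    refine ⟨⟨x, by simp⟩, fun X _ hne hX => ?_⟩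
    obtain ⟨a, ha, b, -, hb, hab⟩ := h X (by simp) (by simpa using hne) (by
      rw [Set.compl_empty]
      exact fun h => hX (Finset.coe_eq_univ.1 h))
    exact ⟨a, ha, b, by simp, hb, hab⟩
  refine ⟨hclaw, hodd, ?_, fun K hK hind x hx y hy =>
    hequi.eq_of_notMem hclaw hodd hconn hK hind hx hy, exists_not_adj_of_three_le_indepNum halpha⟩
  rintro X s ⟨x, hx, hxs⟩ ⟨y, hy, hys⟩
  have h := preconnected_induce_iff.1
    (preconnected_induce_compl_of_ncard_lt (G := G) (S := {s}) (by simp [hkappa]))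
  obtain ⟨a, ha, b, hbs, hb, hab⟩ := h (X \ {s}) (fun v hv => hv.2) ⟨x, hx, hxs⟩ (by
    intro h
    have : y ∈ ({s}ᶜ : Set V) := hys
    rw [← h] at this
    exact hy this.1)
  exact ⟨a, ha.1, ha.2, b, fun h => hb ⟨h, hbs⟩, hbs, hab⟩

/-- Connectivity two is witnessed by a separating pair: if deleting two vertices left at most one,
then `G` would consist of three independent vertices. -/
theorem IsTwoConnectedECF.exists_sep [DecidableEq V] (hG : IsTwoConnectedECF G)
    (hkappa : vertexConnectivity G = 2) : ∃ A B s₁ s₂, Sep G A B s₁ s₂ := by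
  classical
  obtain ⟨S, hS, hcut⟩ := Nat.sInf_mem (s := {k | ∃ S : Set V, S.ncard = k ∧
    (IsCutSet G S ∨ Sᶜ.Subsingleton)}) (Nat.nonempty_of_pos_sInf (by
      change 0 < vertexConnectivity G
      omega))
  change S.ncard = vertexConnectivity G at hS
  rw [hkappa] at hS
  obtain ⟨s₁, s₂, hne, rfl⟩ := Set.ncard_eq_two.1 hS
  rcases hcut with hcut | hsub
  · rw [IsCutSet, preconnected_induce_iff] at hcut
    push Not at hcut
    obtain ⟨X, hX, ⟨x, hx⟩, hXne, hno⟩ := hcut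
    obtain ⟨y, hy, hyX⟩ : ∃ y ∈ ({s₁, s₂} : Set V)ᶜ, y ∉ X := by
      by_contra! h
      exact hXne (Set.Subset.antisymm hX h)
    have hX' : ∀ v ∈ X, v ≠ s₁ ∧ v ≠ s₂ := fun v hv => by simpa using hX hv
    refine ⟨X.toFinset, _, s₁, s₂, Sep.of_closed ⟨x, by simpa using hx⟩ hne
      (fun h => (hX' s₁ (by simpa using h)).1 rfl) (fun h => (hX' s₂ (by simpa using h)).2 rfl)
      ?_ ⟨y, by simpa using hyX, by simpa using hy⟩⟩
    intro z hz v hv h1 h2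
    exact hno z (by simpa using hz) v (by simp [h1, h2]) (by simpa using hv)
  · exfalso
    obtain ⟨x, y, z, hxy, hxz, hyz, nxy, nxz, nyz⟩ := hG.triple
    have hall : ∀ v, v = x ∨ v = y ∨ v = z := by
      have h : ∀ v w, v = s₁ ∨ v = s₂ ∨ w = s₁ ∨ w = s₂ ∨ v = w := by
        intro v w
        by_contra! h
        exact h.2.2.2.2 (hsub (by simp [h.1, h.2.1]) (by simp [h.2.2.1, h.2.2.2.1]))
      intro v
      have hx := h x y
      have hx' := h x z
      have hx'' := h y z
      have h1 := h v x
      have h2 := h v y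
      have h3 := h v z
      clear h
      grind
    exact hG.false_of_pm PM.empty (fun v _ => hall v) (Finset.notMem_empty x)
      (Finset.notMem_empty y) hxy nxy nxz nyz

end

end EquimatchableClawFree

theorem mainTheorem3 {V : Type*} [Fintype V] (G : SimpleGraph V)
    (hequi : EquimatchableClawFree.IsEquimatchable G)
    (hclaw : EquimatchableClawFree.IsClawFree G)
    (hodd : Odd (Fintype.card V))
    (halpha : 3 ≤ G.indepNum)
    (hkappa : EquimatchableClawFree.vertexConnectivity G = 2) :
    EquimatchableClawFree.MemG21 G ∨ EquimatchableClawFree.MemG22 G ∨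
      EquimatchableClawFree.MemG23 G ∨ Nonempty (G ≃g SimpleGraph.cycleGraph 7) := by
  classical
  have hG := EquimatchableClawFree.isTwoConnectedECF hequi hclaw hodd halpha hkappa
  obtain ⟨A, B, s₁, s₂, S⟩ := hG.exists_sep hkappa
  exact hG.classification_of_sep S
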